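/- **Setting.** Let $I=\{1,\dots,n\}$, $I^*=\{1^*,\dots,n^*\}$, $J=I\cup I^*$, with the involution $i\leftrightarrow i^*$ and the order $n^*<\dots<1^*<1<\dots<n$. A set $A\subseteq J$ is admissible if $A\cap A^*=\emptyset$; $J_n$ is the collection of admissible $n$-subsets. Let $W$ be the group of permutations $w$ of $J$ with $w(x^*)=w(x)^*$. For $w\in W$ put $x\leqslant^w y$ iff $w^{-1}x\leqslant w^{-1}y$, and for $A,B\in J_n$ put $A\leqslant^w B$ iff, listing both sets increasingly for $\leqslant^w$, each term of $A$ is $\leqslant^w$ the corresponding term of $B$. A *Lagrangian matroid* is a collection $\mathcal B\subseteq J_n$ (of *bases*) such that for every $w\in W$ there is $A\in\mathcal B$ with $B\leqslant^w A$ for all $B\in\mathcal B$. With $e_1,\dots,e_n$ the standard basis of $\mathbb R^n$, $e_{i^*}=-e_i$ and $e_A=\sum_{j\in A}e_j$, its *matroid polytope* is the convex hull of the points $e_A$, $A\in\mathcal B$. We identify $A$ with $e_A$. An edge $AB$ of the polytope is *short* if $A=B\,\Delta\,\{i,i^*\}$ for some $i\in I$, and *long* if $A=B\,\Delta\,\{i,j,i^*,j^*\}$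 for some $i\neq j$ in $I$. For $F\in J_n$ the *height* of $A\in J_n$ relative to $F$ is $h(A)=n-|A\cap F|$. A long edge $AB$ is *horizontal* relative to $F$ if $h(A)=h(B)$, and *vertical* otherwise. **Oriented Lagrangian matroids.** Let $F\in\mathcal B$. A *relative sign function* (orientation of $\mathcal B$ relative to $F$) is a map $s_F:\mathcal B\to\{+1,-1\}$ such that: (a) $s_F(A)=s_F(B)$ for every horizontal long edge $AB$; (b) $s_F(A)=-s_F(B)$ for every vertical long edge $AB$; (c) if in a 2-dimensional face that is a square with short edges three bases have one sign and the fourth has the other, then the fourth is a highest or a lowest basis of that face relative to $F$; (d) $s_F(F)=+1$. Such an $s_F$ is *extended* to a function of two arguments by $$s(G,A)=s_F(A)\,s_F(G)\,(-1)^{|G\smallsetminus(F\cup A)|}\quad(G,A\in\mathcal B),$$ with $s(G,A)=0$ if $G$ or $A$ is not a basis; orientations relative to $F$ and to $G$ are *equivalent* if they have the same extension. An *oriented Lagrangian matroid* is a Lagrangian matroid $\mathcal B$ with a function $s:J_n\times J_n\to\{+1,-1,0\}$, zero if one of its arguments is not a basis, such that $s(G,\cdot)$ is an orientation relative to $G$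 for every $G\in\mathcal B$, and $s(G,A)=s(H,A)\,s(H,G)\,(-1)^{|G\smallsetminus(H\cup A)|}$ for all $G,H,A\in\mathcal B$. **Oriented Lagrangian matroid polytopes.** An *oriented Lagrangian matroid polytope* is the matroid polytope of a Lagrangian matroid together with a direction on each short edge such that every 2-dimensional face (including the polytope itself if it is 2-dimensional) has as many short edges directed clockwise as anticlockwise. Relative to $F$, an edge is *inducing* if it is a vertical long edge, or a short edge directed downwards (from the end of larger height to the end of smaller height). **Theorem.** Let an oriented Lagrangian matroid polytope with set of bases $\mathcal B$ be given. For $F\in\mathcal B$ assign signs $\pm1$ to the bases as follows: $F$ gets $+1$; two bases joined by an inducing edge (relative to $F$) get opposite signs; two bases joined by any other edge of the polytope get equal signs. 1. For every $F\in\mathcal B$ this procedure is contradiction-free: there is exactly one assignment $s_F$ of signs satisfying these rules. 2. $s_F$ is an orientation of $\mathcal B$ relative to $F$, and its extension makes $\mathcal B$ an oriented Lagrangian matroid; for any $F,G\in\mathcal B$ the orientations $s_F$ and $s_G$ are equivalent. So an oriented Lagrangian matroid polytope determines a unique oriented Lagrangian matroid $(\mathcal B,s)$ with $s(F,\cdot)=s_F$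 for all $F\in\mathcal B$. 3. Every oriented Lagrangian matroid is induced in this way from exactly one orientation of its matroid polytope: the map in 2 is a bijection from the oriented Lagrangian matroid polytopes in $\mathbb R^n$ to the oriented Lagrangian matroids of rank $n$. -/

import Mathlib

namespace LagrangianMatroid

/-! ### Signed labels, admissible sets, symplectic and Lagrangian matroids -/

/-- The set `J = I ∪ I*` of labels, with its linear order `n* < ⋯ < 1* < 1 < ⋯ < n`
(the labels are indexed by `Fin n`). -/
abbrev Label (n : ℕ) : Type := (Fin n)ᵒᵈ ⊕ₗ Fin n

/-- The unstarred label `i`. -/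
def pos {n : ℕ} (i : Fin n) : Label n := toLex (Sum.inr i)

/-- The starred label `i*`. -/
def neg {n : ℕ} (i : Fin n) : Label n := toLex (Sum.inl (OrderDual.toDual i))

/-- The involution `*` on labels. -/
def star {n : ℕ} (x : Label n) : Label n :=
  match ofLex x with
  | Sum.inl i => pos (OrderDual.ofDual i)
  | Sum.inr i => neg i

/-- A set `A` of labels is admissible when `A ∩ A* = ∅`. -/
def Admissible {n : ℕ} (A : Finset (Label n)) : Prop :=
  A ∩ A.image star = ∅

/-- Admissible permutations of the labels (the elements of the hyperoctahedral group). -/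
def IsAdmissiblePerm {n : ℕ} (w : Equiv.Perm (Label n)) : Prop :=
  ∀ x, w (star x) = star (w x)

/-- `A ≤ʷ B`: the elements of `A` and of `B`, both listed increasingly in the order
`x ≤ʷ y ↔ w⁻¹ x ≤ w⁻¹ y`, are compared term by term. -/
def LeW {n : ℕ} (w : Equiv.Perm (Label n)) (A B : Finset (Label n)) : Prop :=
  List.Forall₂ (fun x y => x ≤ y) (A.image w.symm).sort (B.image w.symm).sort

/-- `ℬ` is the collection of bases of a symplectic matroid of rank `k`
(Maximality Property). -/
def IsSymplecticMatroid (n k : ℕ) (ℬ : Finset (Finset (Label n))) : Prop :=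
  (∀ A ∈ ℬ, Admissible A ∧ A.card = k) ∧
    ∀ w : Equiv.Perm (Label n), IsAdmissiblePerm w → ∃ A ∈ ℬ, ∀ B ∈ ℬ, LeW w B A

/-- A Lagrangian matroid is a symplectic matroid of rank `n`. -/
def IsLagrangianMatroid (n : ℕ) (ℬ : Finset (Finset (Label n))) : Prop :=
  IsSymplecticMatroid n n ℬ

/-! ### The matroid polytope and its edges and faces -/

/-- `e_i` is the standard basis vector, and `e_{i*} = -e_i`. -/
def labelVec {n : ℕ} (x : Label n) : Fin n → ℝ :=
  match ofLex x with
  | Sum.inl i => -Pi.single (OrderDual.ofDual i) 1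
  | Sum.inr i => Pi.single i 1

/-- `e_A = ∑_{j ∈ A} e_j`. -/
def point {n : ℕ} (A : Finset (Label n)) : Fin n → ℝ :=
  ∑ x ∈ A, labelVec x

/-- The matroid polytope: the convex hull of the points `e_A`, `A ∈ ℬ`. -/
def polytope {n : ℕ} (ℬ : Finset (Finset (Label n))) : Set (Fin n → ℝ) :=
  convexHull ℝ (point '' (ℬ : Set (Finset (Label n))))

/-- The pair `{i, i*}`. -/
def starPair {n : ℕ} (i : Fin n) : Finset (Label n) := {pos i, neg i}

/-- `e_A` and `e_B` are the ends of an edge of the matroid polytope. -/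
def IsEdge {n : ℕ} (ℬ : Finset (Finset (Label n))) (A B : Finset (Label n)) : Prop :=
  A ∈ ℬ ∧ B ∈ ℬ ∧ A ≠ B ∧ IsExposed ℝ (polytope ℬ) (segment ℝ (point A) (point B))

/-- Short edges: `A = B Δ {i, i*}`. -/
def IsShortEdge {n : ℕ} (ℬ : Finset (Finset (Label n))) (A B : Finset (Label n)) : Prop :=
  IsEdge ℬ A B ∧ ∃ i : Fin n, A = symmDiff B (starPair i)

/-- Long edges: `A = B Δ {i, j, i*, j*}` with `i ≠ j`. -/
def IsLongEdge {n : ℕ} (ℬ : Finset (Finset (Label n))) (A B : Finset (Label n)) : Prop :=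
  IsEdge ℬ A B ∧ ∃ i j : Fin n, i ≠ j ∧ A = symmDiff B (starPair i ∪ starPair j)

/-- `T` is a two-dimensional face (the polytope itself is allowed). -/
def IsTwoFace {n : ℕ} (ℬ : Finset (Finset (Label n))) (T : Set (Fin n → ℝ)) : Prop :=
  IsExposed ℝ (polytope ℬ) T ∧ Module.finrank ℝ (vectorSpan ℝ T) = 2

/-- `Q` is the set of the four bases at the vertices of a two-dimensional face which is
a square with short edges. -/
def IsShortSquare {n : ℕ} (ℬ Q : Finset (Finset (Label n))) : Prop :=
  Q ⊆ ℬ ∧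
    (∃ (A : Finset (Label n)) (i j : Fin n), i ≠ j ∧
      Q = {A, symmDiff A (starPair i), symmDiff A (starPair j),
        symmDiff A (starPair i ∪ starPair j)}) ∧
    IsTwoFace ℬ (polytope Q)

/-- The height `n - |A ∩ F|` of `A` relative to `F`. -/
def height {n : ℕ} (F A : Finset (Label n)) : ℕ := n - (A ∩ F).card

/-- A long edge between two bases of the same height. -/
def IsHorizontalLongEdge {n : ℕ} (ℬ : Finset (Finset (Label n)))
    (F A B : Finset (Label n)) : Prop :=
  IsLongEdge ℬ A B ∧ height F A = height F B

/-- A long edge between two bases of different heights. -/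
def IsVerticalLongEdge {n : ℕ} (ℬ : Finset (Finset (Label n)))
    (F A B : Finset (Label n)) : Prop :=
  IsLongEdge ℬ A B ∧ height F A ≠ height F B

/-! ### Oriented Lagrangian matroids -/

/-- `s` takes values in `{1, -1}` on `ℬ`; it is extended by `0` to all other sets. -/
def IsSignOn {n : ℕ} (ℬ : Finset (Finset (Label n))) (s : Finset (Label n) → SignType) :
    Prop :=
  ∀ A, s A ≠ 0 ↔ A ∈ ℬ

/-- `s` is a relative sign function (an orientation relative to `F`) on the matroid with
bases `ℬ`. -/
structure IsRelativeSign {n : ℕ} (ℬ : Finset (Finset (Label n))) (F : Finset (Label n))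
    (s : Finset (Label n) → SignType) : Prop where
  isSign : IsSignOn ℬ s
  horizontal : ∀ A B, IsHorizontalLongEdge ℬ F A B → s A = s B
  vertical : ∀ A B, IsVerticalLongEdge ℬ F A B → s A = -s B
  square : ∀ Q, IsShortSquare ℬ Q → ∀ D ∈ Q, ∀ ε : SignType,
    (∀ X ∈ Q, X ≠ D → s X = ε) → s D = -ε →
      (∀ X ∈ Q, height F X ≤ height F D) ∨ (∀ X ∈ Q, height F D ≤ height F X)
  base : s F = 1

/-- The extension of a relative sign function `t` with respect to `F` to a function of two
arguments, `(G, A) ↦ t(A) t(G) (-1)^{|G ∖ (F ∪ A)|}`; it is `0` unless `G` and `A` are both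
bases, because `t` is `0` off the bases. -/
def extend {n : ℕ} (F : Finset (Label n)) (t : Finset (Label n) → SignType) :
    Finset (Label n) → Finset (Label n) → SignType :=
  fun G A => t A * t G * (-1) ^ (G \ (F ∪ A)).card

/-- `s` is an orientation of the Lagrangian matroid with bases `ℬ`. -/
structure IsOrientation {n : ℕ} (ℬ : Finset (Finset (Label n)))
    (s : Finset (Label n) → Finset (Label n) → SignType) : Prop where
  zero_off : ∀ G A, G ∉ ℬ ∨ A ∉ ℬ → s G A = 0
  relative : ∀ G ∈ ℬ, IsRelativeSign ℬ G (s G)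
  exchange : ∀ G ∈ ℬ, ∀ H ∈ ℬ, ∀ A ∈ ℬ,
    s G A = s H A * s H G * (-1) ^ (G \ (H ∪ A)).card

/-- Oriented Lagrangian matroids of rank `n`. -/
@[ext]
structure OrientedMatroid (n : ℕ) where
  bases : Finset (Finset (Label n))
  isLagrangian : IsLagrangianMatroid n bases
  sgn : Finset (Label n) → Finset (Label n) → SignType
  isOrientation : IsOrientation bases sgn

/-! ### Oriented Lagrangian matroid polytopes -/

/-- The alternating 2-form `ω` does not vanish on the plane of `T`, and hence fixes a sense
of rotation in that plane. -/
def Orients {n : ℕ} (ω : (Fin n → ℝ) [⋀^Fin 2]→ₗ[ℝ] ℝ) (T : Set (Fin n → ℝ)) : Prop :=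
  ∃ u ∈ vectorSpan ℝ T, ∃ v ∈ vectorSpan ℝ T, ω ![u, v] ≠ 0

/-- The directed edges `A → B` of the face `T` which are anticlockwise for `ω`,
i.e. have `T` on their left. -/
def anticlockwise {n : ℕ} (dir : Finset (Label n) → Finset (Label n) → Prop)
    (ω : (Fin n → ℝ) [⋀^Fin 2]→ₗ[ℝ] ℝ) (T : Set (Fin n → ℝ)) :
    Set (Finset (Label n) × Finset (Label n)) :=
  {e | dir e.1 e.2 ∧ point e.1 ∈ T ∧ point e.2 ∈ T ∧
    ∀ x ∈ T, 0 ≤ ω ![point e.2 - point e.1, x - point e.1]}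

/-- The directed edges `A → B` of the face `T` which are clockwise for `ω`,
i.e. have `T` on their right. -/
def clockwise {n : ℕ} (dir : Finset (Label n) → Finset (Label n) → Prop)
    (ω : (Fin n → ℝ) [⋀^Fin 2]→ₗ[ℝ] ℝ) (T : Set (Fin n → ℝ)) :
    Set (Finset (Label n) × Finset (Label n)) :=
  {e | dir e.1 e.2 ∧ point e.1 ∈ T ∧ point e.2 ∈ T ∧
    ∀ x ∈ T, ω ![point e.2 - point e.1, x - point e.1] ≤ 0}

/-- Oriented Lagrangian matroid polytopes: `dir A B` says that the short edge `AB` is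
directed from `A` to `B`. -/
@[ext]
structure OrientedPolytope (n : ℕ) where
  bases : Finset (Finset (Label n))
  isLagrangian : IsLagrangianMatroid n bases
  dir : Finset (Label n) → Finset (Label n) → Prop
  short_of_dir : ∀ A B, dir A B → IsShortEdge bases A B
  dir_of_short : ∀ A B, IsShortEdge bases A B → Xor (dir A B) (dir B A)
  balanced : ∀ T, IsTwoFace bases T → ∀ ω : (Fin n → ℝ) [⋀^Fin 2]→ₗ[ℝ] ℝ, Orients ω T →
    (anticlockwise dir ω T).ncard = (clockwise dir ω T).ncard

/-- The edge `AB` is inducing relative to `F`: it is long and vertical, or short and directed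
downwards. -/
def OrientedPolytope.IsInducing {n : ℕ} (P : OrientedPolytope n)
    (F A B : Finset (Label n)) : Prop :=
  IsVerticalLongEdge P.bases F A B ∨
    (P.dir A B ∧ height F B < height F A) ∨ (P.dir B A ∧ height F A < height F B)

/-- `t` is an assignment of signs to the bases as produced by the sign propagation procedure
started at `F`. -/
structure OrientedPolytope.IsPropagated {n : ℕ} (P : OrientedPolytope n)
    (F : Finset (Label n)) (t : Finset (Label n) → SignType) : Prop where
  isSign : IsSignOn P.bases t
  base : t F = 1
  inducing : ∀ A B, IsEdge P.bases A B → P.IsInducing F A B → t A = -t B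
  nonInducing : ∀ A B, IsEdge P.bases A B → ¬ P.IsInducing F A B → t A = t B

/-- The oriented Lagrangian matroid `N` is induced from the oriented polytope `P`: they have
the same bases, and for every fundamental basis `F` the signs of `N` relative to `F` are those
propagated from `F`. -/
def OrientedPolytope.Induces {n : ℕ} (P : OrientedPolytope n) (N : OrientedMatroid n) : Prop :=
  N.bases = P.bases ∧ ∀ F ∈ P.bases, P.IsPropagated F (N.sgn F)

end LagrangianMatroid

/-!
A basis is an admissible `n`-set of labels, so it is `enc a` for a unique `a : Finset (Fin n)`, and
`point (enc a)` is a vertex of the cube `[-1, 1]ⁿ`. Heights become Hamming distances, and the number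
`|G ∖ (F ∪ A)|` in the extension formula becomes a Gromov product (`card_symmDiff_add`).

Geometry. The maximality property of Lagrangian matroids yields the symmetric exchange axiom of
delta-matroids (`IsLagrangianMatroid.symmExchange`). Exchanging an element on which a supporting
functional is largest in absolute value stays on the face (`SymmExchange.exists_mem_faceSet`). Hence
edges change one or two coordinates (`isEdge_iff_adj`), and a two-dimensional face with a short edge
is a right-angled triangle with two short legs, a square with short edges, or a rectangle with two
short and two long edges. The balance condition thus splits into one condition on signs for each of
the three types (`IsBalanced.isSignBalanced`, `IsSignBalanced.isBalanced`).

From polytopes to signs. The propagation rules depend on `F` through the heights, but this dependence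
can be removed. Let `δ` be `1` or `-1` according to whether a short edge from `X` to `Y` is directed
that way, and put `κ(X, Y) = (-1) ^ |X| δ(X, Y)`, which is symmetric. A function `σ` on the bases is a
potential if it is constant along long edges and has `σ(X) σ(Y) = κ(X, Y)` on short edges; then
`A ↦ σ(F) σ(A) (-1) ^ (|F| d + ⌊d / 2⌋)`, with `d` the height of `A`, satisfies the rules relative to
`F`, for every `F` at once (`isPropagatedFrom_totalSign`). The balance conditions say that `κ` has
product `1` around every two-dimensional face with short edges (`IsSignBalanced.isFlat`). A potential
exists for such a `κ` (`IsFlat.exists_potential`): the vertices are added in the order of an injective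
linear weight, and the exchange axiom provides enough two-dimensional faces to show that all
neighbours of a new vertex among the earlier ones prescribe the same value. Uniqueness of the signs is
the connectedness of the basis graph (`SymmExchange.connected`). That the extension of the signs
relative to one basis gives the signs relative to all others is a parity identity for heights and
Gromov products (`neg_one_pow_height`, `extend_totalSign`).

From signs to polytopes. In an oriented Lagrangian matroid the sign of one end `A` of a short edge
relative to the other end `B` tells its direction: towards `B` if it is `-1`. The signs relative to
any basis follow the propagation rules for these directions (`isPropagatedFrom_inducedDir`), and the
conditions on long edges and squares, taken relative to a vertex of a face, show that the directions
are balanced (`isSignBalanced_inducedDir`). No other direction of the short edges induces the same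
signs (`OrientedPolytope.Induces.dir_iff`), so the correspondence is bijective.
-/

namespace LagrangianMatroid
open Finset
variable {n : ℕ}

/-! ### Bases as subsets of `Fin n` -/

theorem pos_ne_neg (i j : Fin n) : (pos i : Label n) ≠ neg j := by
  simp [pos, neg]

theorem pos_injective : Function.Injective (pos : Fin n → Label n) := by
  intro i j h
  simpa [pos] using h

theorem neg_injective : Function.Injective (neg : Fin n → Label n) := by
  intro i j h
  simpa [neg] using h

@[simp] theorem pos_eq_pos {i j : Fin n} : (pos i : Label n) = pos j ↔ i = j :=
  pos_injective.eq_iff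

@[simp] theorem neg_eq_neg {i j : Fin n} : (neg i : Label n) = neg j ↔ i = j :=
  neg_injective.eq_iff

@[simp] theorem pos_eq_neg (i j : Fin n) : ((pos i : Label n) = neg j) ↔ False :=
  iff_of_false (pos_ne_neg i j) id

@[simp] theorem neg_eq_pos (i j : Fin n) : ((neg i : Label n) = pos j) ↔ False :=
  iff_of_false (pos_ne_neg j i).symm id

theorem eq_pos_or_eq_neg (x : Label n) : ∃ i, x = pos i ∨ x = neg i := by
  rcases h : ofLex x with i | i
  · exact ⟨OrderDual.ofDual i, Or.inr (by rw [← toLex_ofLex x, h]; rfl)⟩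
  · exact ⟨i, Or.inl (by rw [← toLex_ofLex x, h]; rfl)⟩

@[simp] theorem star_pos (i : Fin n) : star (pos i) = neg i := rfl

@[simp] theorem star_neg (i : Fin n) : star (neg i) = pos i := rfl

/-- The admissible `n`-set of labels which contains `i` for `i ∈ a` and `i*` for `i ∉ a`.
All bases are of this form, so bases are encoded by subsets of `Fin n`. -/
def enc (a : Finset (Fin n)) : Finset (Label n) :=
  a.image pos ∪ aᶜ.image neg

@[simp] theorem pos_mem_enc {a : Finset (Fin n)} {i : Fin n} : pos i ∈ enc a ↔ i ∈ a := by
  simp [enc]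

@[simp] theorem neg_mem_enc {a : Finset (Fin n)} {i : Fin n} : neg i ∈ enc a ↔ i ∉ a := by
  simp [enc]

theorem label_ext {A B : Finset (Label n)} (hp : ∀ i, pos i ∈ A ↔ pos i ∈ B)
    (hn : ∀ i, neg i ∈ A ↔ neg i ∈ B) : A = B := by
  ext x
  obtain ⟨i, rfl | rfl⟩ := eq_pos_or_eq_neg x
  exacts [hp i, hn i]

theorem enc_injective : Function.Injective (enc : Finset (Fin n) → Finset (Label n)) := by
  intro a b h
  ext i
  rw [← pos_mem_enc, h, pos_mem_enc]

@[simp] theorem enc_inj {a b : Finset (Fin n)} : enc a = enc b ↔ a = b :=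
  enc_injective.eq_iff

theorem card_enc (a : Finset (Fin n)) : (enc a).card = n := by
  rw [enc, card_union_of_disjoint, card_image_of_injective _ pos_injective,
    card_image_of_injective _ neg_injective, card_add_card_compl, Fintype.card_fin]
  rw [disjoint_left]
  simp only [mem_image, not_exists, not_and]
  rintro _ ⟨i, -, rfl⟩ j -
  exact (pos_ne_neg i j).symm

theorem exists_enc {A : Finset (Label n)} (hA : Admissible A) (hc : A.card = n) :
    ∃ a, A = enc a := by
  refine ⟨univ.filter fun i => pos i ∈ A, eq_of_subset_of_card_le ?_ ?_⟩
  · intro x hx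
    obtain ⟨i, rfl | rfl⟩ := eq_pos_or_eq_neg x
    · simpa using hx
    · have : pos i ∉ A := by
        intro h
        have h2 : neg i ∈ A ∩ A.image star := mem_inter.2 ⟨hx, mem_image.2 ⟨_, h, rfl⟩⟩
        rw [hA] at h2
        simp at h2
      simpa using this
  · rw [card_enc, hc]

@[simp] theorem pos_mem_starPair {i j : Fin n} : pos i ∈ starPair j ↔ i = j := by
  simp [starPair]

@[simp] theorem neg_mem_starPair {i j : Fin n} : neg i ∈ starPair j ↔ i = j := by
  simp [starPair]

theorem enc_symmDiff_starPair (a : Finset (Fin n)) (i : Fin n) :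
    symmDiff (enc a) (starPair i) = enc (symmDiff a {i}) := by
  apply label_ext <;> intro k <;>
    grind [Finset.mem_symmDiff, pos_mem_enc, neg_mem_enc, pos_mem_starPair, neg_mem_starPair]

theorem enc_symmDiff_starPair_union (a : Finset (Fin n)) (i j : Fin n) :
    symmDiff (enc a) (starPair i ∪ starPair j) = enc (symmDiff a {i, j}) := by
  apply label_ext <;> intro k <;>
    grind [Finset.mem_symmDiff, pos_mem_enc, neg_mem_enc, pos_mem_starPair, neg_mem_starPair]

theorem enc_inter_card (f a : Finset (Fin n)) :
    (enc a ∩ enc f).card + (symmDiff f a).card = n := by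
  have h : enc a ∩ enc f = (a ∩ f).image pos ∪ (a ∪ f)ᶜ.image neg := by
    apply label_ext <;> intro k <;> simp
  rw [h, card_union_of_disjoint, card_image_of_injective _ pos_injective,
    card_image_of_injective _ neg_injective]
  · have h1 := card_add_card_compl (a ∪ f)
    have h2 : (a ∪ f).card = (a ∩ f).card + (symmDiff f a).card := by
      rw [← card_union_of_disjoint]
      · congr 1; ext k; simp [mem_symmDiff]; tauto
      · rw [disjoint_left]; intro k; simp [mem_symmDiff]; tauto
    rw [Fintype.card_fin] at h1
    omega
  · rw [disjoint_left]
    simp only [mem_image, not_exists, not_and]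
    rintro _ ⟨i, -, rfl⟩ j -
    exact (pos_ne_neg i j).symm

/-- The height is the Hamming distance. -/
theorem height_enc (f a : Finset (Fin n)) : height (enc f) (enc a) = (symmDiff f a).card := by
  have := enc_inter_card f a
  simp only [height]
  omega

theorem card_enc_sdiff (f g a : Finset (Fin n)) :
    (enc g \ (enc f ∪ enc a)).card = (symmDiff g f ∩ symmDiff g a).card := by
  have h : enc g \ (enc f ∪ enc a) =
      (g \ (f ∪ a)).image pos ∪ ((f ∩ a) \ g).image neg := by
    apply label_ext <;> intro k <;>
      grind [pos_mem_enc, neg_mem_enc, pos_eq_pos, neg_eq_neg, pos_ne_neg]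
  rw [h, card_union_of_disjoint, card_image_of_injective _ pos_injective,
    card_image_of_injective _ neg_injective, ← card_union_of_disjoint]
  · congr 1; ext k; simp [mem_symmDiff]; tauto
  · rw [disjoint_left]; intro k; simp; tauto
  · rw [disjoint_left]
    simp only [mem_image, not_exists, not_and]
    rintro _ ⟨i, -, rfl⟩ j -
    exact (pos_ne_neg i j).symm

/-- By `card_enc_sdiff` the last term is twice `|G ∖ (F ∪ A)|`, which is thus the Gromov product of
`F` and `A` with respect to `G` in the Hamming metric. -/
theorem card_symmDiff_add (f g a : Finset (Fin n)) :
    (symmDiff f g).card + (symmDiff g a).card =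
      (symmDiff f a).card + 2 * (symmDiff g f ∩ symmDiff g a).card := by
  have h1 := card_union_add_card_inter (symmDiff f g) (symmDiff g a)
  have h2 : symmDiff f g ∪ symmDiff g a = symmDiff f a ∪ (symmDiff g f ∩ symmDiff g a) := by
    ext k; simp [mem_symmDiff]; tauto
  have h3 : Disjoint (symmDiff f a) (symmDiff g f ∩ symmDiff g a) := by
    rw [disjoint_left]; intro k; simp [mem_symmDiff]; tauto
  rw [h2, card_union_of_disjoint h3, symmDiff_comm f g] at h1
  rw [symmDiff_comm f g]
  omega

theorem card_symmDiff_symmDiff_singleton (f a : Finset (Fin n)) (i : Fin n) :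
    (symmDiff f (symmDiff a {i})).card = (symmDiff f a).card + 1 ∧ i ∉ symmDiff f a ∨
    (symmDiff f a).card = (symmDiff f (symmDiff a {i})).card + 1 ∧ i ∈ symmDiff f a := by
  rw [← symmDiff_assoc]
  set D := symmDiff f a
  by_cases h : i ∈ D
  · right
    have : symmDiff D {i} = D.erase i := by ext k; simp [mem_symmDiff]; grind
    rw [this, card_erase_add_one h]
    exact ⟨rfl, h⟩
  · left
    have : symmDiff D {i} = insert i D := by ext k; simp [mem_symmDiff]; grind
    rw [this, card_insert_of_notMem h]
    exact ⟨rfl, h⟩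

/-- The index sets of the bases in `ℬ`. -/
def Feas (ℬ : Finset (Finset (Label n))) (a : Finset (Fin n)) : Prop := enc a ∈ ℬ

theorem IsLagrangianMatroid.exists_enc {ℬ : Finset (Finset (Label n))}
    (h : IsLagrangianMatroid n ℬ) {A : Finset (Label n)} (hA : A ∈ ℬ) : ∃ a, A = enc a :=
  LagrangianMatroid.exists_enc (h.1 A hA).1 (h.1 A hA).2

theorem labelVec_pos (i : Fin n) : labelVec (pos i) = Pi.single i 1 := rfl

theorem labelVec_neg (i : Fin n) : labelVec (neg i) = -Pi.single i 1 := rfl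

theorem point_enc (a : Finset (Fin n)) (k : Fin n) :
    point (enc a) k = if k ∈ a then 1 else -1 := by
  have hd : Disjoint (a.image pos) (aᶜ.image (neg : Fin n → Label n)) := by
    rw [disjoint_left]
    simp only [mem_image, not_exists, not_and]
    rintro _ ⟨i, -, rfl⟩ j -
    exact (pos_ne_neg i j).symm
  rw [point, enc, sum_union hd, sum_image (fun _ _ _ _ h => pos_injective h),
    sum_image (fun _ _ _ _ h => neg_injective h)]
  simp only [labelVec_pos, labelVec_neg, Pi.add_apply, Finset.sum_apply]
  by_cases hk : k ∈ a <;> simp [hk, Pi.single_apply]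

/-! ### The symmetric exchange property -/

/-- The symmetric exchange axiom of delta-matroids. The case `v = u` is the exchange of the single
element `u`. -/
def SymmExchange {α : Type*} [DecidableEq α] (𝓕 : Finset α → Prop) : Prop :=
  ∀ X Y, 𝓕 X → 𝓕 Y → ∀ u ∈ symmDiff X Y, ∃ v ∈ symmDiff X Y, 𝓕 (symmDiff X {u, v})

theorem card_filter_sort {B : Finset (Label n)} (p : Label n → Prop) [DecidablePred p] :
    (B.filter p).card = B.sort.countP (fun x => decide (p x)) := by
  rw [← Multiset.coe_countP, Finset.sort_eq, Finset.card, filter_val,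
    Multiset.countP_eq_card_filter]

/-- Comparing sorted lists term by term compares the numbers of elements in every upper set. -/
theorem LeW.card_filter_le {w : Equiv.Perm (Label n)} {A B : Finset (Label n)} (h : LeW w A B)
    (p : Label n → Prop) [DecidablePred p] (hp : ∀ x y, x ≤ y → p x → p y) :
    ((A.image w.symm).filter p).card ≤ ((B.image w.symm).filter p).card := by
  rw [card_filter_sort, card_filter_sort]
  unfold LeW at h
  generalize (A.image w.symm).sort = l₁, (B.image w.symm).sort = l₂ at h
  induction h with
  | nil => simp
  | @cons a b l₁ l₂ hab _ ih =>
    rw [List.countP_cons, List.countP_cons]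
    have := hp a b hab
    by_cases ha : p a <;> simp_all
    omega

theorem exists_pos_of_pos_le {i : Fin n} {y : Label n} (h : pos i ≤ y) :
    ∃ j, i ≤ j ∧ y = pos j := by
  obtain ⟨j, rfl | rfl⟩ := eq_pos_or_eq_neg y
  · exact ⟨j, Sum.Lex.inr_le_inr_iff.1 h, rfl⟩
  · exact absurd h Sum.Lex.not_inr_le_inl

/-- The admissible permutation which lists the index `k` at the place `σ.symm k` and makes the
labels of `enc g` the large ones. -/
theorem exists_admissiblePerm (g : Finset (Fin n)) (σ : Equiv.Perm (Fin n)) :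
    ∃ w : Equiv.Perm (Label n), IsAdmissiblePerm w ∧
      (∀ k, w.symm (pos k) = if k ∈ g then pos (σ.symm k) else neg (σ.symm k)) ∧
      ∀ k, w.symm (neg k) = if k ∈ g then neg (σ.symm k) else pos (σ.symm k) := by
  have hex : ∀ x : Label n, ∃ y : Label n,
      (∀ k, x = pos k → y = if k ∈ g then pos (σ.symm k) else neg (σ.symm k)) ∧
      ∀ k, x = neg k → y = if k ∈ g then neg (σ.symm k) else pos (σ.symm k) := by
    intro x
    obtain ⟨i, rfl | rfl⟩ := eq_pos_or_eq_neg x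
    · exact ⟨if i ∈ g then pos (σ.symm i) else neg (σ.symm i), by simp, by simp⟩
    · exact ⟨if i ∈ g then neg (σ.symm i) else pos (σ.symm i), by simp, by simp⟩
  choose v hv1 hv2 using hex
  replace hv1 := fun k => hv1 _ k rfl
  replace hv2 := fun k => hv2 _ k rfl
  have hinj : Function.Injective v := by
    intro x y h
    obtain ⟨i, rfl | rfl⟩ := eq_pos_or_eq_neg x <;> obtain ⟨j, rfl | rfl⟩ := eq_pos_or_eq_neg y <;>
      simp only [hv1, hv2] at h <;> split_ifs at h <;> simp_all
  have hstar : ∀ x, v (star x) = star (v x) := by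
    intro x
    obtain ⟨i, rfl | rfl⟩ := eq_pos_or_eq_neg x <;> simp only [star_pos, star_neg, hv1, hv2] <;>
      split_ifs <;> simp
  set e := Equiv.ofBijective v (Finite.injective_iff_bijective.1 hinj)
  have he : ∀ x, e x = v x := fun x => rfl
  refine ⟨e.symm, fun x => ?_, hv1, hv2⟩
  rw [Equiv.symm_apply_eq, he, hstar, ← he, Equiv.apply_symm_apply]

/-- For any key on the indices and any `g`, some member of `ℬ` maximizes, among all members and for
all `c` at once, the number of indices with key at least `c` at which it agrees with `g`. -/
theorem IsLagrangianMatroid.exists_max {ℬ : Finset (Finset (Label n))}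
    (h : IsLagrangianMatroid n ℬ) (g : Finset (Fin n)) (key : Fin n → ℕ) :
    ∃ m, Feas ℬ m ∧ ∀ b, Feas ℬ b → ∀ c,
      (univ.filter fun k => c ≤ key k ∧ (k ∈ b ↔ k ∈ g)).card ≤
      (univ.filter fun k => c ≤ key k ∧ (k ∈ m ↔ k ∈ g)).card := by
  classical
  set σ := Tuple.sort key
  have hmono : Monotone (key ∘ σ) := Tuple.monotone_sort key
  obtain ⟨w, hw, hp, hn⟩ := exists_admissiblePerm g σ
  obtain ⟨A, hA, hmax⟩ := h.2 w hw
  obtain ⟨m, rfl⟩ := h.exists_enc hA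
  refine ⟨m, hA, fun b hb c => ?_⟩
  have key1 := (hmax _ hb).card_filter_le (fun x => ∃ i, x = pos i ∧ c ≤ key (σ i)) (by
    rintro _ y hxy ⟨i, rfl, hi⟩
    obtain ⟨j, hij, rfl⟩ := exists_pos_of_pos_le hxy
    exact ⟨j, rfl, hi.trans (hmono hij)⟩)
  have key2 : ∀ b : Finset (Fin n), (((enc b).image w.symm).filter
      (fun x => ∃ i, x = pos i ∧ c ≤ key (σ i))) =
      (univ.filter fun k => c ≤ key k ∧ (k ∈ b ↔ k ∈ g)).image (fun k => pos (σ.symm k)) := by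
    intro b
    ext x
    simp only [mem_filter, mem_image, mem_univ, true_and]
    constructor
    · rintro ⟨⟨y, hy, hyx⟩, i, rfl, hi⟩
      refine ⟨σ i, ⟨hi, ?_⟩, by simp⟩
      obtain ⟨k, rfl | rfl⟩ := eq_pos_or_eq_neg y
      · rw [hp] at hyx
        split_ifs at hyx with hk
        · simp only [pos_eq_pos] at hyx
          subst hyx
          simpa [hk] using hy
        · simp at hyx
      · rw [hn] at hyx
        split_ifs at hyx with hk
        · simp at hyx
        · simp only [pos_eq_pos] at hyx
          subst hyx
          simpa [hk] using hy
    · rintro ⟨k, ⟨hk, hkb⟩, rfl⟩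
      refine ⟨?_, _, rfl, by simpa using hk⟩
      by_cases hg : k ∈ g
      · exact ⟨pos k, by simp [hkb, hg], by rw [hp, if_pos hg]⟩
      · exact ⟨neg k, by simp [hkb, hg], by rw [hn, if_neg hg]⟩
  rw [key2, key2, card_image_of_injective, card_image_of_injective] at key1
  · exact key1
  all_goals exact fun i j hij => σ.symm.injective (pos_injective hij)

/-- The maximality property implies symmetric exchange: a suitable order makes the indices
outside `X ∆ Y`, and then `u`, prevail over all others. -/
theorem IsLagrangianMatroid.symmExchange {ℬ : Finset (Finset (Label n))}
    (h : IsLagrangianMatroid n ℬ) : SymmExchange (Feas ℬ) := by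
  intro X Y hX hY u hu
  set D := symmDiff X Y
  -- Indices off `D` are the most important ones and `u` comes next, so a maximal member can
  -- differ from `X ∆ {u}` only in `D ∖ {u}`; comparison with `X` bounds the difference by one.
  set g := symmDiff X {u} with hg
  set key : Fin n → ℕ := fun k => if k ∉ D then 2 else if k = u then 1 else 0 with hkey
  have key2 : ∀ k, 2 ≤ key k ↔ k ∉ D := by intro k; simp only [hkey]; split_ifs <;> simp_all
  have key1 : ∀ k, 1 ≤ key k ↔ k ∉ D ∨ k = u := by
    intro k; simp only [hkey]; split_ifs <;> simp_all
  have memD : ∀ k, k ∈ D ↔ ¬ (k ∈ X ↔ k ∈ Y) := by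
    intro k; simp only [D, mem_symmDiff]; tauto
  have memg : ∀ k, k ∈ g ↔ ¬ (k ∈ X ↔ k = u) := by
    intro k; simp only [hg, mem_symmDiff, mem_singleton]; tauto
  rw [memD] at hu
  obtain ⟨m, hm, hmax⟩ := h.exists_max g key
  have hoff : ∀ k, k ∉ D ∨ k = u → (k ∈ m ↔ k ∈ g) := by
    have h2 := hmax X hX 2
    have h1 := hmax Y hY 1
    simp only [key2] at h2
    simp only [key1] at h1
    have e2 := eq_of_subset_of_card_le (fun k => by
      simp only [mem_filter, mem_univ, true_and, memD, memg]; grind) h2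
    have e1 := eq_of_subset_of_card_le (fun k => by
      simp only [mem_filter, mem_univ, true_and, memD, memg]; grind) h1
    intro k hk
    have f1 := Finset.ext_iff.1 e1 k
    simp only [mem_filter, mem_univ, true_and, memD, memg] at hk f1 ⊢
    grind
  have hcard : (symmDiff m g).card ≤ 1 := by
    have h0 := hmax X hX 0
    simp only [Nat.zero_le, true_and] at h0
    have a1 : (univ.filter fun k => (k ∈ X ↔ k ∈ g)) = ({u} : Finset (Fin n))ᶜ := by
      ext k; simp only [mem_filter, mem_univ, true_and, memg, mem_compl, mem_singleton]; tauto
    have a2 : (univ.filter fun k => (k ∈ m ↔ k ∈ g)) = (symmDiff m g)ᶜ := by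
      ext k; simp only [mem_filter, mem_univ, true_and, mem_compl, mem_symmDiff]; tauto
    rw [a1, a2] at h0
    have b1 := card_add_card_compl ({u} : Finset (Fin n))
    have b2 := card_add_card_compl (symmDiff m g)
    rw [card_singleton] at b1
    omega
  rcases (symmDiff m g).eq_empty_or_nonempty with he | ⟨v, hv⟩
  · refine ⟨u, (memD u).2 hu, ?_⟩
    have : m = g := symmDiff_eq_bot.1 he
    rwa [pair_eq_singleton, ← hg, ← this]
  · have hs : symmDiff m g = {v} := by
      apply (eq_of_subset_of_card_le (singleton_subset_iff.2 hv) _).symm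
      rwa [card_singleton]
    have hvD : v ∈ D ∧ v ≠ u := by
      by_contra hcon
      have := hoff v (by tauto)
      rw [mem_symmDiff] at hv
      tauto
    refine ⟨v, hvD.1, ?_⟩
    have : m = symmDiff X {u, v} := by
      have e : m = symmDiff g {v} := by
        rw [← hs, symmDiff_comm m g, symmDiff_symmDiff_cancel_left]
      rw [e, hg, symmDiff_assoc]
      congr 1
      ext k; simp [mem_symmDiff]; grind
    rwa [← this]

/-! ### Potentials on the basis graph of a delta-matroid -/

section Potential
variable {α : Type*} [DecidableEq α]

theorem empty_symmDiff (X : Finset α) : symmDiff ∅ X = X := bot_symmDiff X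

/-- `X` and `Y` differ in one element. -/
def ShortAdj (X Y : Finset α) : Prop := ∃ i, Y = symmDiff X {i}

/-- `X` and `Y` differ in two elements and span a diagonal of a square of the cube, at most one of
whose other two corners is feasible. -/
def LongAdj (𝓕 : Finset α → Prop) (X Y : Finset α) : Prop :=
  ∃ i j, i ≠ j ∧ Y = symmDiff X {i, j} ∧ ¬ (𝓕 (symmDiff X {i}) ∧ 𝓕 (symmDiff X {j}))

/-- The signs `κ` on short edges, together with the sign `1` on long edges, have product `1` around
each two-dimensional face having short edges: triangles with one long edge, squares, and
rectangles with two long edges. -/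
structure IsFlat (𝓕 : Finset α → Prop) (κ : Finset α → Finset α → ℤˣ) : Prop where
  symm : ∀ X Y, 𝓕 X → 𝓕 Y → ShortAdj X Y → κ X Y = κ Y X
  triangle : ∀ X i j, i ≠ j → 𝓕 X → 𝓕 (symmDiff X {i}) → 𝓕 (symmDiff X {j}) →
    ¬ 𝓕 (symmDiff X {i, j}) → κ X (symmDiff X {i}) = κ X (symmDiff X {j})
  square : ∀ X i j, i ≠ j → 𝓕 X → 𝓕 (symmDiff X {i}) → 𝓕 (symmDiff X {j}) →
    𝓕 (symmDiff X {i, j}) → κ X (symmDiff X {i}) * κ (symmDiff X {i}) (symmDiff X {i, j}) *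
      (κ (symmDiff X {i, j}) (symmDiff X {j}) * κ (symmDiff X {j}) X) = 1
  rectangle : ∀ X i j k, i ≠ j → i ≠ k → j ≠ k → 𝓕 X → 𝓕 (symmDiff X {i}) →
    𝓕 (symmDiff X {j, k}) → 𝓕 (symmDiff X {i, j, k}) →
    ¬ 𝓕 (symmDiff X {k}) → ¬ 𝓕 (symmDiff X {i, k}) →
    κ X (symmDiff X {i}) = κ (symmDiff X {j, k}) (symmDiff X {i, j, k})

/-- `σ` is a potential for `κ` on the members of `S`: its coboundary is `κ` on short edges and
`1` on long edges. -/
structure IsPotentialOn (𝓕 : Finset α → Prop) (κ : Finset α → Finset α → ℤˣ)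
    (S : Finset α → Prop) (σ : Finset α → ℤˣ) : Prop where
  short : ∀ X Y, S X → S Y → ShortAdj X Y → σ X * σ Y = κ X Y
  long : ∀ X Y, S X → S Y → LongAdj 𝓕 X Y → σ X = σ Y

theorem ShortAdj.symm {X Y : Finset α} (h : ShortAdj X Y) : ShortAdj Y X := by
  obtain ⟨i, rfl⟩ := h
  exact ⟨i, by rw [symmDiff_symmDiff_cancel_right]⟩

theorem LongAdj.symm {𝓕 : Finset α → Prop} {X Y : Finset α} (h : LongAdj 𝓕 X Y) :
    LongAdj 𝓕 Y X := by
  obtain ⟨i, j, hij, rfl, h⟩ := h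
  refine ⟨i, j, hij, by rw [symmDiff_symmDiff_cancel_right], ?_⟩
  have h1 : symmDiff (symmDiff X {i, j}) {i} = symmDiff X {j} := by
    ext x; grind [Finset.mem_symmDiff]
  have h2 : symmDiff (symmDiff X {i, j}) {j} = symmDiff X {i} := by
    ext x; grind [Finset.mem_symmDiff]
  rw [h1, h2]
  tauto

theorem SymmExchange.twist {𝓕 : Finset α → Prop} (h : SymmExchange 𝓕) (v : Finset α) :
    SymmExchange fun D => 𝓕 (symmDiff v D) := by
  intro X Y hX hY u hu
  have e : symmDiff (symmDiff v X) (symmDiff v Y) = symmDiff X Y := by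
    ext x; grind [Finset.mem_symmDiff]
  obtain ⟨w, hw, hw2⟩ := h _ _ hX hY u (by rwa [e])
  exact ⟨w, by rwa [e] at hw, by simpa only [symmDiff_assoc] using hw2⟩

theorem shortAdj_twist {v X Y : Finset α} :
    ShortAdj (symmDiff v X) (symmDiff v Y) ↔ ShortAdj X Y := by
  simp only [ShortAdj, symmDiff_assoc, symmDiff_right_inj]

theorem longAdj_twist {𝓕 : Finset α → Prop} {v X Y : Finset α} :
    LongAdj 𝓕 (symmDiff v X) (symmDiff v Y) ↔
      LongAdj (fun D => 𝓕 (symmDiff v D)) X Y := by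
  simp only [LongAdj, symmDiff_assoc, symmDiff_right_inj]

theorem IsFlat.twist {𝓕 : Finset α → Prop} {κ : Finset α → Finset α → ℤˣ} (h : IsFlat 𝓕 κ)
    (v : Finset α) :
    IsFlat (fun D => 𝓕 (symmDiff v D)) (fun D E => κ (symmDiff v D) (symmDiff v E)) where
  symm X Y hX hY hXY := h.symm _ _ hX hY (shortAdj_twist.2 hXY)
  triangle X i j := by simpa only [symmDiff_assoc] using h.triangle (symmDiff v X) i j
  square X i j := by simpa only [symmDiff_assoc] using h.square (symmDiff v X) i j
  rectangle X i j k := by simpa only [symmDiff_assoc] using h.rectangle (symmDiff v X) i j k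

section Local

/-! The vertex `∅` is added to the members `D` with `∑ i ∈ D, g i < 0`, on which a potential is
already given. Its neighbours among them all prescribe the same sign for it. -/

variable {𝓕 : Finset α → Prop} {κ : Finset α → Finset α → ℤˣ} {σ : Finset α → ℤˣ} {g : α → ℤ}

theorem IsPotentialOn.long_eq (hσ : IsPotentialOn 𝓕 κ (fun D => 𝓕 D ∧ ∑ i ∈ D, g i < 0) σ)
    {X Y : Finset α} (i j : α) (hij : i ≠ j) (hX : 𝓕 X) (hY : 𝓕 Y) (gX : ∑ i ∈ X, g i < 0)
    (gY : ∑ i ∈ Y, g i < 0) (hXY : Y = symmDiff X {i, j})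
    (hn : ¬ (𝓕 (symmDiff X {i}) ∧ 𝓕 (symmDiff X {j}))) : σ X = σ Y :=
  hσ.long X Y ⟨hX, gX⟩ ⟨hY, gY⟩ ⟨i, j, hij, hXY, hn⟩

theorem potential_short_short (h0 : 𝓕 ∅) (hκ : IsFlat 𝓕 κ)
    (hσ : IsPotentialOn 𝓕 κ (fun D => 𝓕 D ∧ ∑ i ∈ D, g i < 0) σ) {i j : α}
    (hi : 𝓕 {i}) (hj : 𝓕 {j}) (gi : g i < 0) (gj : g j < 0) :
    κ ∅ {i} * σ {i} = κ ∅ {j} * σ {j} := by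
  rcases eq_or_ne i j with rfl | hij
  · rfl
  by_cases hF : 𝓕 {i, j}
  · have e := hκ.square ∅ i j hij h0
    simp only [empty_symmDiff] at e
    have gij : ∑ x ∈ {i, j}, g x < 0 := by rw [sum_pair hij]; omega
    have e1 := hσ.short {i} {i, j} ⟨hi, by simpa⟩ ⟨hF, gij⟩
      ⟨j, by ext x; grind [Finset.mem_symmDiff]⟩
    have e2 := hσ.short {i, j} {j} ⟨hF, gij⟩ ⟨hj, by simpa⟩
      ⟨i, by ext x; grind [Finset.mem_symmDiff]⟩
    have e3 := hκ.symm ∅ {j} h0 hj ⟨j, (empty_symmDiff _).symm⟩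
    have e := e hi hj hF
    rw [← e1, ← e2, ← e3] at e
    generalize κ ∅ {i} = a, κ ∅ {j} = b, σ {i} = c, σ {j} = d, σ {i, j} = f at e
    revert a b c d f
    decide
  · have e := hκ.triangle ∅ i j hij h0
    simp only [empty_symmDiff] at e
    rw [e hi hj hF, hσ.long_eq i j hij hi hj (by simpa) (by simpa)
      (by ext x; grind [Finset.mem_symmDiff])]
    have : symmDiff {i} {j} = ({i, j} : Finset α) := by ext x; grind [Finset.mem_symmDiff]
    rw [this]
    tauto

theorem potential_short_long_adj (h0 : 𝓕 ∅) (hκ : IsFlat 𝓕 κ)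
    (hσ : IsPotentialOn 𝓕 κ (fun D => 𝓕 D ∧ ∑ i ∈ D, g i < 0) σ) {a b : α} (hab : a ≠ b)
    (ha : 𝓕 {a}) (hF : 𝓕 {a, b}) (hb : ¬ 𝓕 {b}) (ga : g a < 0) (gab : g a + g b < 0) :
    κ ∅ {a} * σ {a} = σ {a, b} := by
  have e := hκ.triangle {a} a b hab ha
  have e1 : symmDiff {a} {b} = ({a, b} : Finset α) := by ext x; grind [Finset.mem_symmDiff]
  have e2 : symmDiff {a} {a, b} = ({b} : Finset α) := by ext x; grind [Finset.mem_symmDiff]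
  rw [symmDiff_self, bot_eq_empty, e1, e2] at e
  have e := e h0 hF hb
  rw [← hκ.symm ∅ {a} h0 ha ⟨a, (empty_symmDiff _).symm⟩, ← hσ.short {a} {a, b} ⟨ha, by simpa⟩
    ⟨hF, by rwa [sum_pair hab]⟩ ⟨b, e1.symm⟩] at e
  rw [e, mul_comm, ← mul_assoc, Int.units_mul_self, one_mul]

theorem potential_short_long_of_notMem (hE : SymmExchange 𝓕) (h0 : 𝓕 ∅) (hκ : IsFlat 𝓕 κ)
    (hσ : IsPotentialOn 𝓕 κ (fun D => 𝓕 D ∧ ∑ i ∈ D, g i < 0) σ) {i j k : α} (hij : i ≠ j)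
    (hik : i ≠ k) (hjk : j ≠ k) (hi : 𝓕 {i}) (hF : 𝓕 {j, k}) (hk : ¬ 𝓕 {k}) (gi : g i < 0)
    (gk : g k < 0) (gjk : g j + g k < 0) :
    κ ∅ {i} * σ {i} = σ {j, k} := by
  by_cases hFik : 𝓕 {i, k}
  · rw [potential_short_long_adj h0 hκ hσ hik hi hFik hk gi (by omega)]
    refine hσ.long_eq i j hij hFik hF (by rw [sum_pair hik]; omega) (by rwa [sum_pair hjk])
      (by ext x; grind [Finset.mem_symmDiff]) fun h => hk ?_
    convert h.1 using 1
    ext x; grind [Finset.mem_symmDiff]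
  · -- Now `∅`, `{i}`, `{j, k}` and `{i, j, k}` are the vertices of a rectangle.
    have hFijk : 𝓕 {i, j, k} := by
      obtain ⟨v, hv, hv2⟩ := hE {i} {j, k} hi hF k (by grind [Finset.mem_symmDiff])
      have : v = i ∨ v = j ∨ v = k := by grind [Finset.mem_symmDiff]
      rcases this with rfl | rfl | rfl
      · exact absurd (by convert hv2 using 1; ext x; grind [Finset.mem_symmDiff]) hk
      · convert hv2 using 1; ext x; grind [Finset.mem_symmDiff]
      · exact absurd (by convert hv2 using 1; ext x; grind [Finset.mem_symmDiff]) hFik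
    have e := hκ.rectangle ∅ i j k hij hik hjk h0
    simp only [empty_symmDiff] at e
    have gs : ∑ x ∈ {i, j, k}, g x < 0 := by
      rw [sum_insert (by simp [hij, hik]), sum_pair hjk]; omega
    have e1 : symmDiff {i} {k} = ({i, k} : Finset α) := by ext x; grind [Finset.mem_symmDiff]
    rw [e hi hF hFijk hk hFik, ← hσ.short {j, k} {i, j, k} ⟨hF, by rwa [sum_pair hjk]⟩ ⟨hFijk, gs⟩
      ⟨i, by ext x; grind [Finset.mem_symmDiff]⟩,
      hσ.long_eq (X := {i}) (Y := {i, j, k}) j k hjk hi hFijk (by simpa) gs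
        (by ext x; grind [Finset.mem_symmDiff]) (by rw [e1]; tauto), mul_assoc,
      Int.units_mul_self, mul_one]

theorem potential_short_long (hE : SymmExchange 𝓕) (h0 : 𝓕 ∅) (hκ : IsFlat 𝓕 κ)
    (hσ : IsPotentialOn 𝓕 κ (fun D => 𝓕 D ∧ ∑ i ∈ D, g i < 0) σ) {i j k : α}
    (hjk : j ≠ k) (hi : 𝓕 {i}) (hF : 𝓕 {j, k}) (hn : ¬ (𝓕 {j} ∧ 𝓕 {k})) (gi : g i < 0)
    (gjk : g j + g k < 0) :
    κ ∅ {i} * σ {i} = σ {j, k} := by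
  wlog hle : g k ≤ g j generalizing j k
  · rw [pair_comm]
    exact this hjk.symm (by rwa [pair_comm]) (by tauto) (by omega) (by omega)
  have gk : g k < 0 := by omega
  by_cases hk : 𝓕 {k}
  · rw [potential_short_short h0 hκ hσ hi hk gi gk, pair_comm j k]
    exact potential_short_long_adj h0 hκ hσ hjk.symm hk (by rwa [pair_comm]) (by tauto) gk
      (by omega)
  · rcases eq_or_ne i j with rfl | hij
    · exact potential_short_long_adj h0 hκ hσ hjk hi hF hk gi gjk
    · refine potential_short_long_of_notMem hE h0 hκ hσ hij ?_ hjk hi hF hk gi gk gjk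
      rintro rfl
      exact hk hi

theorem potential_long_long_of_common_notMem
    (hσ : IsPotentialOn 𝓕 κ (fun D => 𝓕 D ∧ ∑ i ∈ D, g i < 0) σ) {i j k : α}
    (hik : i ≠ k) (hjk : j ≠ k) (hF : 𝓕 {j, k}) (hF' : 𝓕 {i, k}) (hk : ¬ 𝓕 {k})
    (gjk : g j + g k < 0) (gik : g i + g k < 0) :
    σ {j, k} = σ {i, k} := by
  rcases eq_or_ne i j with rfl | hij
  · rfl
  refine hσ.long_eq j i hij.symm hF hF' (by rwa [sum_pair hjk]) (by rwa [sum_pair hik])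
    (by ext x; grind [Finset.mem_symmDiff]) fun h => hk ?_
  convert h.1 using 1
  ext x; grind [Finset.mem_symmDiff]

theorem potential_long_long_of_common (hE : SymmExchange 𝓕) (h0 : 𝓕 ∅)
    (hσ : IsPotentialOn 𝓕 κ (fun D => 𝓕 D ∧ ∑ i ∈ D, g i < 0) σ) {i j k : α}
    (hij : i ≠ j) (hik : i ≠ k) (hjk : j ≠ k) (hF : 𝓕 {j, k}) (hF' : 𝓕 {j, i}) (hk : ¬ 𝓕 {k})
    (hi : ¬ 𝓕 {i}) (gk : g k < 0) (gi : g i < 0) (gjk : g j + g k < 0) (gji : g j + g i < 0) :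
    σ {j, k} = σ {j, i} := by
  by_cases h : 𝓕 (symmDiff {j, k} {i}) ∧ 𝓕 (symmDiff {j, k} {k})
  · obtain ⟨v, hv, hv2⟩ := hE _ _ h.1 h0 j (by grind [Finset.mem_symmDiff])
    have hFik : 𝓕 {i, k} := by
      have : v = j ∨ v = i ∨ v = k := by grind [Finset.mem_symmDiff]
      rcases this with rfl | rfl | rfl
      · convert hv2 using 1; ext x; grind [Finset.mem_symmDiff]
      · exact absurd (by convert hv2 using 1; ext x; grind [Finset.mem_symmDiff]) hk
      · exact absurd (by convert hv2 using 1; ext x; grind [Finset.mem_symmDiff]) hi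
    rw [potential_long_long_of_common_notMem hσ hik hjk hF hFik hk gjk (by omega), pair_comm i k]
    exact potential_long_long_of_common_notMem hσ hij.symm hik.symm (by rwa [pair_comm]) hF' hi
      (by omega) gji
  · exact hσ.long_eq i k hik hF hF' (by rwa [sum_pair hjk]) (by rwa [sum_pair hij.symm])
      (by ext x; grind [Finset.mem_symmDiff]) h

theorem potential_long_long_of_disjoint (hE : SymmExchange 𝓕) (h0 : 𝓕 ∅)
    (hσ : IsPotentialOn 𝓕 κ (fun D => 𝓕 D ∧ ∑ i ∈ D, g i < 0) σ) {i j k l : α}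
    (hij : i ≠ j) (hik : i ≠ k) (hil : i ≠ l) (hjk : j ≠ k) (hjl : j ≠ l) (hkl : k ≠ l)
    (hF : 𝓕 {j, k}) (hF' : 𝓕 {i, l}) (hk : ¬ 𝓕 {k}) (hl : ¬ 𝓕 {l}) (gk : g k < 0) (gl : g l < 0)
    (gjk : g j + g k < 0) (gil : g i + g l < 0) (hle : g k ≤ g l) :
    σ {j, k} = σ {i, l} := by
  by_cases hFkl : 𝓕 {k, l}
  · rw [potential_long_long_of_common_notMem hσ hkl.symm hjk hF (by rwa [pair_comm]) hk gjk
      (by omega), pair_comm l k]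
    exact potential_long_long_of_common_notMem hσ hil hkl hFkl hF' hl (by omega) gil
  by_cases hFik : 𝓕 {i, k}
  · rw [potential_long_long_of_common_notMem hσ hik hjk hF hFik hk gjk (by omega)]
    exact potential_long_long_of_common hE h0 hσ hil.symm hkl.symm hik hFik hF' hk hl gk gl
      (by omega) gil
  -- Without `{k}`, `{l}` and `{k, l}`, no third element can join `k` and `l`.
  have hx : ∀ x, x ≠ k → x ≠ l → ¬ 𝓕 {x, k, l} := by
    intro x hxk hxl hx
    obtain ⟨v, hv, hv2⟩ := hE _ _ hx h0 x (by grind [Finset.mem_symmDiff])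
    have : v = x ∨ v = k ∨ v = l := by grind [Finset.mem_symmDiff]
    rcases this with rfl | rfl | rfl
    · exact hFkl (by convert hv2 using 1; ext x; grind [Finset.mem_symmDiff])
    · exact hl (by convert hv2 using 1; ext x; grind [Finset.mem_symmDiff])
    · exact hk (by convert hv2 using 1; ext x; grind [Finset.mem_symmDiff])
  have hF4 : 𝓕 {i, j, k, l} := by
    obtain ⟨v, hv, hv2⟩ := hE _ _ hF' hF k (by grind [Finset.mem_symmDiff])
    have : v = i ∨ v = j ∨ v = k ∨ v = l := by grind [Finset.mem_symmDiff]
    rcases this with rfl | rfl | rfl | rfl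
    · exact absurd (by convert hv2 using 1; ext x; grind [Finset.mem_symmDiff]) hFkl
    · convert hv2 using 1; ext x; grind [Finset.mem_symmDiff]
    · exact absurd (by convert hv2 using 1; ext x; grind [Finset.mem_symmDiff]) (hx i hik hil)
    · exact absurd (by convert hv2 using 1; ext x; grind [Finset.mem_symmDiff]) hFik
  have gs : ∑ x ∈ {i, j, k, l}, g x < 0 := by
    rw [sum_insert (by simp [hij, hik, hil]), sum_insert (by simp [hjk, hjl]), sum_pair hkl]
    omega
  have e1 : σ {j, k} = σ {i, j, k, l} := by
    refine hσ.long_eq i l hil hF hF4 (by rwa [sum_pair hjk]) gs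
      (by ext x; grind [Finset.mem_symmDiff]) fun h => hx j hjk hjl ?_
    convert h.2 using 1
    ext x; grind [Finset.mem_symmDiff]
  have e2 : σ {i, l} = σ {i, j, k, l} := by
    refine hσ.long_eq j k hjk hF' hF4 (by rwa [sum_pair hil]) gs
      (by ext x; grind [Finset.mem_symmDiff]) fun h => hx i hik hil ?_
    convert h.2 using 1
    ext x; grind [Finset.mem_symmDiff]
  rw [e1, e2]

theorem potential_long_long (hE : SymmExchange 𝓕) (h0 : 𝓕 ∅) (hκ : IsFlat 𝓕 κ)
    (hσ : IsPotentialOn 𝓕 κ (fun D => 𝓕 D ∧ ∑ i ∈ D, g i < 0) σ) {i j k l : α}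
    (hjk : j ≠ k) (hF : 𝓕 {j, k}) (hn : ¬ (𝓕 {j} ∧ 𝓕 {k})) (gjk : g j + g k < 0)
    (hil : i ≠ l) (hF' : 𝓕 {i, l}) (hn' : ¬ (𝓕 {i} ∧ 𝓕 {l})) (gil : g i + g l < 0) :
    σ {j, k} = σ {i, l} := by
  wlog hkj : g k ≤ g j generalizing j k
  · rw [pair_comm]
    exact this hjk.symm (by rwa [pair_comm]) (by tauto) (by omega) (by omega)
  wlog hli : g l ≤ g i generalizing i l
  · rw [pair_comm i l]
    exact this hil.symm (by rwa [pair_comm]) (by tauto) (by omega) (by omega)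
  have gk : g k < 0 := by omega
  have gl : g l < 0 := by omega
  by_cases hk : 𝓕 {k}
  · rw [← potential_short_long hE h0 hκ hσ hjk hk hF hn gk gjk]
    exact potential_short_long hE h0 hκ hσ hil hk hF' hn' gk gil
  by_cases hl : 𝓕 {l}
  · rw [← potential_short_long hE h0 hκ hσ hil hl hF' hn' gl gil]
    exact (potential_short_long hE h0 hκ hσ hjk hl hF hn gl gjk).symm
  rcases eq_or_ne k l with rfl | hkl
  · exact potential_long_long_of_common_notMem hσ hil hjk hF hF' hk gjk gil
  rcases eq_or_ne i k with rfl | hik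
  · rw [pair_comm i l]
    exact potential_long_long_of_common_notMem hσ hil.symm hjk hF (by rwa [pair_comm]) hk gjk
      (by omega)
  rcases eq_or_ne j l with rfl | hjl
  · rw [pair_comm]
    exact potential_long_long_of_common_notMem hσ hil hkl (by rwa [pair_comm]) hF' hl
      (by omega) gil
  rcases eq_or_ne i j with rfl | hij
  · exact potential_long_long_of_common hE h0 hσ hil.symm hkl.symm hik hF hF' hk hl gk gl gjk gil
  rcases le_total (g k) (g l) with hle | hle
  · exact potential_long_long_of_disjoint hE h0 hσ hij hik hil hjk hjl hkl hF hF' hk hl gk gl gjk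
      gil hle
  · exact (potential_long_long_of_disjoint hE h0 hσ hij.symm hjl hjk hil hik hkl.symm hF' hF hl hk
      gl gk gil gjk hle).symm

theorem exists_extension_to_empty (hE : SymmExchange 𝓕) (h0 : 𝓕 ∅) (hκ : IsFlat 𝓕 κ)
    (hσ : IsPotentialOn 𝓕 κ (fun D => 𝓕 D ∧ ∑ i ∈ D, g i < 0) σ) :
    ∃ s : ℤˣ, (∀ Y, 𝓕 Y → ∑ i ∈ Y, g i < 0 → ShortAdj ∅ Y → s * σ Y = κ ∅ Y) ∧
      ∀ Y, 𝓕 Y → ∑ i ∈ Y, g i < 0 → LongAdj 𝓕 ∅ Y → s = σ Y := by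
  let V : ℤˣ → Prop := fun s => (∃ i, 𝓕 {i} ∧ g i < 0 ∧ s = κ ∅ {i} * σ {i}) ∨
    ∃ j k, j ≠ k ∧ 𝓕 {j, k} ∧ ¬ (𝓕 {j} ∧ 𝓕 {k}) ∧ g j + g k < 0 ∧ s = σ {j, k}
  have hV : ∀ s t, V s → V t → s = t := by
    rintro _ _ (⟨i, hi, gi, rfl⟩ | ⟨j, k, hjk, hF, hn, gjk, rfl⟩)
      (⟨i', hi', gi', rfl⟩ | ⟨j', k', hjk', hF', hn', gjk', rfl⟩)
    · exact potential_short_short h0 hκ hσ hi hi' gi gi'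
    · exact potential_short_long hE h0 hκ hσ hjk' hi hF' hn' gi gjk'
    · exact (potential_short_long hE h0 hκ hσ hjk hi' hF hn gi' gjk).symm
    · exact potential_long_long hE h0 hκ hσ hjk hF hn gjk hjk' hF' hn' gjk'
  have hs : ∃ s, ∀ t, V t → s = t := by
    by_cases h : ∃ s, V s
    · obtain ⟨s, hs⟩ := h
      exact ⟨s, fun t ht => hV s t hs ht⟩
    · exact ⟨1, fun t ht => absurd ⟨t, ht⟩ h⟩
  obtain ⟨s, hs⟩ := hs
  refine ⟨s, ?_, ?_⟩
  · rintro _ hY gY ⟨i, rfl⟩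
    simp only [empty_symmDiff] at *
    rw [hs _ (Or.inl ⟨i, hY, by simpa using gY, rfl⟩), mul_assoc, Int.units_mul_self, mul_one]
  · rintro _ hY gY ⟨i, j, hij, rfl, hn⟩
    simp only [empty_symmDiff] at *
    exact hs _ (Or.inr ⟨i, j, hij, hY, hn, by rwa [sum_pair hij] at gY, rfl⟩)

end Local

theorem sum_symmDiff (w : α → ℤ) (v D : Finset α) :
    ∑ i ∈ symmDiff v D, w i = ∑ i ∈ v, w i + ∑ i ∈ D, if i ∈ v then - w i else w i := by
  have h1 : ∑ i ∈ symmDiff v D, w i = ∑ i ∈ v \ D, w i + ∑ i ∈ D \ v, w i := by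
    rw [← sum_union disjoint_sdiff_sdiff]; rfl
  have h2 : ∑ i ∈ D, (if i ∈ v then - w i else w i) =
      ∑ i ∈ D ∩ v, - w i + ∑ i ∈ D \ v, w i := by
    rw [← sum_inter_add_sum_sdiff D v]
    congr 1
    · exact sum_congr rfl fun i hi => if_pos (mem_inter.1 hi).2
    · exact sum_congr rfl fun i hi => if_neg (mem_sdiff.1 hi).2
  have h3 := sum_inter_add_sum_sdiff v D w
  rw [h1, h2, ← h3, sum_neg_distrib, inter_comm D v]
  ring

/-- Sweeping the cube by an injective weight, a potential is built one vertex at a time. The new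
vertex is moved to `∅` by a symmetry of the cube, which turns `w` into a signed weight `g`. -/
theorem IsFlat.exists_potential [Fintype α] {𝓕 : Finset α → Prop}
    {κ : Finset α → Finset α → ℤˣ} (hE : SymmExchange 𝓕) (hκ : IsFlat 𝓕 κ)
    (w : α → ℕ) (hw : Function.Injective fun X : Finset α => ∑ i ∈ X, w i) :
    ∃ σ, IsPotentialOn 𝓕 κ 𝓕 σ := by
  classical
  have main : ∀ m : ℕ, ∃ σ, IsPotentialOn 𝓕 κ (fun X => 𝓕 X ∧ ∑ i ∈ X, w i < m) σ := by
    intro m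
    induction m with
    | zero => exact ⟨1, by simp, by simp⟩
    | succ m ih =>
      obtain ⟨σ, hσ⟩ := ih
      by_cases hv : ∃ v, 𝓕 v ∧ ∑ i ∈ v, w i = m
      · obtain ⟨v, hv, hm⟩ := hv
        set g : α → ℤ := fun i => if i ∈ v then - (w i : ℤ) else w i with hg
        have hsum : ∀ D, ((∑ i ∈ symmDiff v D, w i : ℕ) : ℤ) = m + ∑ i ∈ D, g i := by
          intro D
          push_cast
          rw [sum_symmDiff, ← hm]
          push_cast
          rfl
        have hlt : ∀ D, ∑ i ∈ D, g i < 0 ↔ ∑ i ∈ symmDiff v D, w i < m := by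
          intro D; have := hsum D; omega
        obtain ⟨s, hs1, hs2⟩ := exists_extension_to_empty (σ := fun D => σ (symmDiff v D)) (g := g)
          (hE.twist v) (by simpa [← bot_eq_empty] using hv) (hκ.twist v) (by
            simp only [hlt]
            exact ⟨fun X Y hX hY h => hσ.short _ _ hX hY (shortAdj_twist.2 h),
              fun X Y hX hY h => hσ.long _ _ hX hY (longAdj_twist.2 h)⟩)
        simp only [hlt] at hs1 hs2
        have hs1 : ∀ Y, 𝓕 Y → ∑ i ∈ Y, w i < m → ShortAdj v Y → s * σ Y = κ v Y := by
          intro Y hY hYm h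
          have := hs1 (symmDiff v Y)
          rw [symmDiff_symmDiff_cancel_left, ← shortAdj_twist (v := v),
            symmDiff_symmDiff_cancel_left, ← bot_eq_empty, symmDiff_bot] at this
          exact this hY hYm h
        have hs2 : ∀ Y, 𝓕 Y → ∑ i ∈ Y, w i < m → LongAdj 𝓕 v Y → s = σ Y := by
          intro Y hY hYm h
          have := hs2 (symmDiff v Y)
          rw [symmDiff_symmDiff_cancel_left, ← longAdj_twist (v := v),
            symmDiff_symmDiff_cancel_left, ← bot_eq_empty, symmDiff_bot] at this
          exact this hY hYm h
        have hlt' : ∀ Y, Y ≠ v → ∑ i ∈ Y, w i < m + 1 → ∑ i ∈ Y, w i < m := by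
          intro Y hY h
          have : ∑ i ∈ Y, w i ≠ ∑ i ∈ v, w i := fun h => hY (hw h)
          omega
        refine ⟨Function.update σ v s, ?_, ?_⟩
        · rintro X Y ⟨hX, hXm⟩ ⟨hY, hYm⟩ h
          by_cases hXv : X = v <;> by_cases hYv : Y = v
          · subst hXv hYv
            obtain ⟨i, hi⟩ := h
            exact absurd (symmDiff_eq_left.1 hi.symm) (singleton_ne_empty i)
          · subst hXv
            rw [Function.update_self, Function.update_of_ne hYv]
            exact hs1 Y hY (hlt' Y hYv hYm) h
          · subst hYv
            rw [Function.update_self, Function.update_of_ne hXv, mul_comm, hκ.symm _ _ hX hY h]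
            exact hs1 X hX (hlt' X hXv hXm) h.symm
          · rw [Function.update_of_ne hYv, Function.update_of_ne hXv]
            exact hσ.short X Y ⟨hX, hlt' X hXv hXm⟩ ⟨hY, hlt' Y hYv hYm⟩ h
        · rintro X Y ⟨hX, hXm⟩ ⟨hY, hYm⟩ h
          by_cases hXv : X = v <;> by_cases hYv : Y = v
          · rw [hXv, hYv]
          · subst hXv
            rw [Function.update_self, Function.update_of_ne hYv]
            exact hs2 Y hY (hlt' Y hYv hYm) h
          · subst hYv
            rw [Function.update_self, Function.update_of_ne hXv]
            exact (hs2 X hX (hlt' X hXv hXm) h.symm).symm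
          · rw [Function.update_of_ne hYv, Function.update_of_ne hXv]
            exact hσ.long X Y ⟨hX, hlt' X hXv hXm⟩ ⟨hY, hlt' Y hYv hYm⟩ h
      · refine ⟨σ, fun X Y hX hY => hσ.short X Y ⟨hX.1, ?_⟩ ⟨hY.1, ?_⟩,
          fun X Y hX hY => hσ.long X Y ⟨hX.1, ?_⟩ ⟨hY.1, ?_⟩⟩
        all_goals
          have h1 : ∑ i ∈ X, w i ≠ m := fun h => hv ⟨X, hX.1, h⟩
          have h2 : ∑ i ∈ Y, w i ≠ m := fun h => hv ⟨Y, hY.1, h⟩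
          have := hX.2
          have := hY.2
          omega
  obtain ⟨σ, hσ⟩ := main (∑ i, w i + 1)
  have hle : ∀ X : Finset α, ∑ i ∈ X, w i < ∑ i, w i + 1 := fun X =>
    Nat.lt_succ_of_le (sum_le_sum_of_subset (subset_univ X))
  exact ⟨σ, fun X Y hX hY => hσ.short X Y ⟨hX, hle X⟩ ⟨hY, hle Y⟩,
    fun X Y hX hY => hσ.long X Y ⟨hX, hle X⟩ ⟨hY, hle Y⟩⟩

/-- The basis graph is connected. -/
theorem SymmExchange.connected {𝓕 : Finset α → Prop} (hE : SymmExchange 𝓕) {p : Finset α → Prop}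
    (hs : ∀ X Y, 𝓕 X → 𝓕 Y → ShortAdj X Y → p X → p Y)
    (hl : ∀ X Y, 𝓕 X → 𝓕 Y → LongAdj 𝓕 X Y → p X → p Y) {X Y : Finset α} (hX : 𝓕 X) (hY : 𝓕 Y)
    (hp : p X) : p Y := by
  induction hd : (symmDiff X Y).card using Nat.strong_induction_on generalizing X with
  | _ d ih =>
    rcases (symmDiff X Y).eq_empty_or_nonempty with he | ⟨u, hu⟩
    · have : X = Y := symmDiff_eq_bot.1 he
      rwa [← this]
    · obtain ⟨v, hv, hF⟩ := hE X Y hX hY u hu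
      have hlt : (symmDiff (symmDiff X {u, v}) Y).card < d := by
        rw [← hd]
        refine card_lt_card ⟨fun x => ?_, fun h => ?_⟩
        · grind [Finset.mem_symmDiff]
        · have := h hu
          grind [Finset.mem_symmDiff]
      refine ih _ hlt hF ?_ rfl
      rcases eq_or_ne u v with rfl | huv
      · exact hs X _ hX hF ⟨u, by simp⟩ hp
      by_cases hb : 𝓕 (symmDiff X {u}) ∧ 𝓕 (symmDiff X {v})
      · exact hs (symmDiff X {u}) _ hb.1 hF ⟨v, by ext x; grind [Finset.mem_symmDiff]⟩
          (hs X _ hX hb.1 ⟨u, rfl⟩ hp)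
      · exact hl X _ hX hF ⟨u, v, huv, rfl, hb⟩ hp

end Potential

/-! ### Faces of the matroid polytope -/

/-- The vertex of the cube `[-1, 1]ⁿ` whose coordinates in `a` are positive. -/
def vtx (a : Finset (Fin n)) : Fin n → ℝ := point (enc a)

theorem vtx_apply (a : Finset (Fin n)) (k : Fin n) : vtx a k = if k ∈ a then 1 else -1 :=
  point_enc a k

/-- The displacement from the vertex `X` of the cube along its edge in direction `k`. -/
def stepVec (X : Finset (Fin n)) (k : Fin n) : Fin n → ℝ :=
  Pi.single k (if k ∈ X then -2 else 2)

theorem stepVec_self_ne_zero (X : Finset (Fin n)) (k : Fin n) : stepVec X k k ≠ 0 := by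
  rw [stepVec, Pi.single_eq_same]
  split_ifs <;> norm_num

theorem sum_stepVec_apply (X D : Finset (Fin n)) (k : Fin n) :
    (∑ i ∈ D, stepVec X i) k = if k ∈ D then stepVec X k k else 0 := by
  rw [Finset.sum_apply]
  simp only [stepVec, Pi.single_apply]
  simp

theorem vtx_symmDiff (X D : Finset (Fin n)) :
    vtx (symmDiff X D) = vtx X + ∑ i ∈ D, stepVec X i := by
  ext k
  rw [Pi.add_apply, sum_stepVec_apply, vtx_apply, vtx_apply, stepVec, Pi.single_eq_same]
  by_cases h1 : k ∈ X <;> by_cases h2 : k ∈ D <;> simp [mem_symmDiff, h1, h2] <;> norm_num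

theorem vtx_eq (X Y : Finset (Fin n)) : vtx Y = vtx X + ∑ i ∈ symmDiff X Y, stepVec X i := by
  rw [← vtx_symmDiff, symmDiff_symmDiff_cancel_left]

/-- `φ` gives, in the coordinates centred at the vertex `X`, a linear functional which is maximal
at `X` among the feasible vertices. -/
def IsSupp (𝓕 : Finset (Fin n) → Prop) (X : Finset (Fin n)) (φ : Fin n → ℝ) : Prop :=
  𝓕 X ∧ ∀ Y, 𝓕 Y → ∑ i ∈ symmDiff X Y, φ i ≤ 0

/-- The feasible vertices on the face supported by `φ`. -/
def faceSet (𝓕 : Finset (Fin n) → Prop) (X : Finset (Fin n)) (φ : Fin n → ℝ) :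
    Set (Finset (Fin n)) :=
  {Y | 𝓕 Y ∧ ∑ i ∈ symmDiff X Y, φ i = 0}

theorem self_mem_faceSet {𝓕 : Finset (Fin n) → Prop} {X : Finset (Fin n)} {φ : Fin n → ℝ}
    (h : 𝓕 X) : X ∈ faceSet 𝓕 X φ := ⟨h, by simp⟩

/-- The points of a convex hull at which a linear functional attains its maximum `c` are in the
convex hull of the generators with that property. -/
theorem mem_convexHull_of_eq_max {E : Type*} [AddCommGroup E] [Module ℝ E] (l : E →ₗ[ℝ] ℝ)
    {S : Set E} {c : ℝ} (hS : ∀ x ∈ S, l x ≤ c) {x : E} (hx : x ∈ convexHull ℝ S) :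
    l x ≤ c ∧ (l x = c → x ∈ convexHull ℝ {y ∈ S | l y = c}) := by
  set K := convexHull ℝ {y ∈ S | l y = c}
  have hK : ∀ y ∈ K, l y = c := by
    have : K ⊆ {y | l y = c} :=
      convexHull_min (fun y hy => hy.2) (convex_hyperplane l.isLinear c)
    exact fun y hy => this hy
  have hsub : convexHull ℝ S ⊆ {y | l y < c} ∪ K := by
    refine convexHull_min (fun y hy => ?_) ?_
    · rcases (hS y hy).lt_or_eq with h | h
      · exact Or.inl h
      · exact Or.inr (subset_convexHull ℝ _ ⟨hy, h⟩)
    · rw [convex_iff_forall_pos]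
      intro y hy z hz a b ha hb hab
      have hy' : l y ≤ c := hy.elim (fun h => le_of_lt h) fun h => (hK y h).le
      have hz' : l z ≤ c := hz.elim (fun h => le_of_lt h) fun h => (hK z h).le
      have e : l (a • y + b • z) = a * l y + b * l z := by simp
      have ec : c = a * c + b * c := by rw [← add_mul, hab, one_mul]
      rcases hy with hy | hy
      · left
        have h1 := mul_lt_mul_of_pos_left (show l y < c from hy) ha
        have h2 := mul_le_mul_of_nonneg_left hz' hb.le
        show l (a • y + b • z) < c
        linarith
      · rcases hz with hz | hz
        · left
          have h1 := mul_le_mul_of_nonneg_left hy' ha.le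
          have h2 := mul_lt_mul_of_pos_left (show l z < c from hz) hb
          show l (a • y + b • z) < c
          linarith
        · exact Or.inr (convex_convexHull ℝ _ hy hz ha.le hb.le hab)
  rcases hsub hx with h | h
  · exact ⟨le_of_lt h, fun h' => absurd h' (ne_of_lt h)⟩
  · exact ⟨(hK x h).le, fun _ => h⟩

theorem exists_functional (X : Finset (Fin n)) (φ : Fin n → ℝ) :
    ∃ l : StrongDual ℝ (Fin n → ℝ), ∀ k, l (stepVec X k) = φ k := by
  refine ⟨∑ k, (φ k / stepVec X k k) • ContinuousLinearMap.proj k, fun k => ?_⟩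
  have h := stepVec_self_ne_zero X k
  simp only [FunLike.coe_sum, Finset.sum_apply, FunLike.coe_smul,
    Pi.smul_apply, ContinuousLinearMap.proj_apply, smul_eq_mul]
  rw [sum_eq_single k]
  · field_simp
  · intro j _ hj
    simp [stepVec, hj]
  · simp

section Polytope
variable {ℬ : Finset (Finset (Label n))}

theorem IsLagrangianMatroid.polytope_eq (h : IsLagrangianMatroid n ℬ) :
    polytope ℬ = convexHull ℝ (vtx '' {Y | Feas ℬ Y}) := by
  rw [polytope]
  congr 1
  ext x
  constructor
  · rintro ⟨A, hA, rfl⟩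
    obtain ⟨a, rfl⟩ := h.exists_enc hA
    exact ⟨a, hA, rfl⟩
  · rintro ⟨a, ha, rfl⟩
    exact ⟨enc a, ha, rfl⟩

theorem IsLagrangianMatroid.vtx_mem (h : IsLagrangianMatroid n ℬ) {Y : Finset (Fin n)}
    (hY : Feas ℬ Y) : vtx Y ∈ polytope ℬ := by
  rw [h.polytope_eq]
  exact subset_convexHull ℝ _ ⟨Y, hY, rfl⟩

theorem IsLagrangianMatroid.face_eq (h : IsLagrangianMatroid n ℬ) {X : Finset (Fin n)}
    {φ : Fin n → ℝ} (hφ : IsSupp (Feas ℬ) X φ) (l : StrongDual ℝ (Fin n → ℝ))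
    (hl : ∀ k, l (stepVec X k) = φ k) :
    convexHull ℝ (vtx '' faceSet (Feas ℬ) X φ) =
      {x ∈ polytope ℬ | ∀ y ∈ polytope ℬ, l y ≤ l x} := by
  have hval : ∀ Y, l (vtx Y) = l (vtx X) + ∑ i ∈ symmDiff X Y, φ i := by
    intro Y
    rw [vtx_eq X Y, map_add, map_sum]
    simp only [hl]
  have hS : ∀ x ∈ vtx '' {Y | Feas ℬ Y}, l x ≤ l (vtx X) := by
    rintro _ ⟨Y, hY, rfl⟩
    rw [hval]
    linarith [hφ.2 Y hY]
  have hset : {y ∈ vtx '' {Y | Feas ℬ Y} | l y = l (vtx X)} = vtx '' faceSet (Feas ℬ) X φ := by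
    ext x
    constructor
    · rintro ⟨⟨Y, hY, rfl⟩, hx⟩
      rw [hval] at hx
      exact ⟨Y, ⟨hY, by linarith⟩, rfl⟩
    · rintro ⟨Y, ⟨hY, hY2⟩, rfl⟩
      exact ⟨⟨Y, hY, rfl⟩, by rw [hval, hY2, add_zero]⟩
  have key : ∀ x ∈ polytope ℬ, _ := fun x hx =>
    mem_convexHull_of_eq_max l.toLinearMap hS (by rwa [← h.polytope_eq])
  simp only [ContinuousLinearMap.coe_coe, hset] at key
  apply Set.Subset.antisymm
  · intro x hx
    have h1 : x ∈ polytope ℬ := by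
      rw [h.polytope_eq]
      exact convexHull_mono (Set.image_mono fun Y hY => hY.1) hx
    have h2 : l x = l (vtx X) := by
      have : convexHull ℝ (vtx '' faceSet (Feas ℬ) X φ) ⊆ {y | l y = l (vtx X)} := by
        refine convexHull_min ?_ (convex_hyperplane l.toLinearMap.isLinear _)
        rw [← hset]
        exact fun y hy => hy.2
      exact this hx
    exact ⟨h1, fun y hy => h2 ▸ (key y hy).1⟩
  · rintro x ⟨hx, hmax⟩
    exact (key x hx).2 (le_antisymm (key x hx).1 (hmax _ (h.vtx_mem hφ.1)))

theorem IsLagrangianMatroid.isExposed_face (h : IsLagrangianMatroid n ℬ) {X : Finset (Fin n)}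
    {φ : Fin n → ℝ} (hφ : IsSupp (Feas ℬ) X φ) :
    IsExposed ℝ (polytope ℬ) (convexHull ℝ (vtx '' faceSet (Feas ℬ) X φ)) := by
  obtain ⟨l, hl⟩ := exists_functional X φ
  exact fun _ => ⟨l, h.face_eq hφ l hl⟩

theorem IsLagrangianMatroid.vtx_mem_face_iff (h : IsLagrangianMatroid n ℬ) {X : Finset (Fin n)}
    {φ : Fin n → ℝ} (hφ : IsSupp (Feas ℬ) X φ) {Y : Finset (Fin n)} (hY : Feas ℬ Y) :
    vtx Y ∈ convexHull ℝ (vtx '' faceSet (Feas ℬ) X φ) ↔ Y ∈ faceSet (Feas ℬ) X φ := by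
  refine ⟨fun hm => ?_, fun hm => subset_convexHull ℝ _ ⟨Y, hm, rfl⟩⟩
  obtain ⟨l, hl⟩ := exists_functional X φ
  rw [h.face_eq hφ l hl] at hm
  have := hm.2 _ (h.vtx_mem hφ.1)
  rw [vtx_eq X Y, map_add, map_sum] at this
  simp only [hl] at this
  exact ⟨hY, le_antisymm (hφ.2 Y hY) (by linarith)⟩

theorem IsLagrangianMatroid.exists_supp (h : IsLagrangianMatroid n ℬ) {T : Set (Fin n → ℝ)}
    (hT : IsExposed ℝ (polytope ℬ) T) {X : Finset (Fin n)} (hX : Feas ℬ X) (hXT : vtx X ∈ T) :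
    ∃ φ, IsSupp (Feas ℬ) X φ ∧ T = convexHull ℝ (vtx '' faceSet (Feas ℬ) X φ) := by
  obtain ⟨l, rfl⟩ := hT ⟨_, hXT⟩
  have hφ : IsSupp (Feas ℬ) X fun k => l (stepVec X k) := by
    refine ⟨hX, fun Y hY => ?_⟩
    have := hXT.2 _ (h.vtx_mem hY)
    rw [vtx_eq X Y, map_add, map_sum] at this
    linarith
  exact ⟨_, hφ, (h.face_eq hφ l fun _ => rfl).symm⟩

end Polytope

/-- A functional on the coordinates in `S` extends to one which is very negative on all other
coordinates, so that the face it supports lies in the face of the cube spanned by `S`. -/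
theorem exists_isSupp_of_local {𝓕 : Finset (Fin n) → Prop} {X : Finset (Fin n)} (hX : 𝓕 X)
    (S : Finset (Fin n)) (ψ : Fin n → ℝ)
    (hψ : ∀ D ⊆ S, 𝓕 (symmDiff X D) → ∑ i ∈ D, ψ i ≤ 0) :
    ∃ φ, IsSupp 𝓕 X φ ∧
      ∀ Y, Y ∈ faceSet 𝓕 X φ ↔ 𝓕 Y ∧ symmDiff X Y ⊆ S ∧ ∑ i ∈ symmDiff X Y, ψ i = 0 := by
  classical
  set M := ∑ i ∈ S, |ψ i|
  have hM : 0 ≤ M := sum_nonneg fun i _ => abs_nonneg _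
  set φ : Fin n → ℝ := fun i => if i ∈ S then ψ i else -(1 + M) with hφ
  have h1 : ∀ D ⊆ S, ∑ i ∈ D, φ i = ∑ i ∈ D, ψ i := fun D hD =>
    sum_congr rfl fun i hi => if_pos (hD hi)
  have h2 : ∀ D, ¬ D ⊆ S → ∑ i ∈ D, φ i < 0 := by
    intro D hD
    rw [← sum_inter_add_sum_sdiff D S, h1 _ inter_subset_right]
    have e1 : ∑ i ∈ D ∩ S, ψ i ≤ M :=
      (sum_le_sum fun i _ => le_abs_self _).trans
        (sum_le_sum_of_subset_of_nonneg inter_subset_right fun i _ _ => abs_nonneg _)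
    have e2 : ∑ i ∈ D \ S, φ i = ((D \ S).card : ℝ) * -(1 + M) := by
      rw [← nsmul_eq_mul, ← sum_const]
      exact sum_congr rfl fun i hi => if_neg (mem_sdiff.1 hi).2
    have e3 : (1 : ℝ) ≤ (D \ S).card := by
      exact_mod_cast card_pos.2 (sdiff_nonempty.2 hD)
    rw [e2]
    nlinarith
  refine ⟨φ, ⟨hX, fun Y hY => ?_⟩, fun Y => ?_⟩
  · by_cases hS : symmDiff X Y ⊆ S
    · rw [h1 _ hS]
      exact hψ _ hS (by rwa [symmDiff_symmDiff_cancel_left])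
    · exact (h2 _ hS).le
  · by_cases hS : symmDiff X Y ⊆ S
    · simp only [faceSet, Set.mem_ofPred_eq, h1 _ hS, hS, true_and]
    · simp only [faceSet, Set.mem_ofPred_eq, hS, false_and, and_false, iff_false, not_and]
      exact fun _ => (h2 _ hS).ne

/-- Two vertices on a face can be joined through the face by exchanging at most two elements:
exchange an element on which the supporting functional is largest in absolute value. -/
theorem SymmExchange.exists_mem_faceSet {𝓕 : Finset (Fin n) → Prop} (hE : SymmExchange 𝓕)
    {X C : Finset (Fin n)} {φ : Fin n → ℝ} (hφ : IsSupp 𝓕 X φ) (hC : C ∈ faceSet 𝓕 X φ)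
    (hne : X ≠ C) :
    ∃ u ∈ symmDiff X C, ∃ v ∈ symmDiff X C,
      symmDiff X {u, v} ∈ faceSet 𝓕 X φ ∨ symmDiff C {u, v} ∈ faceSet 𝓕 X φ := by
  have hD : (symmDiff X C).Nonempty := by
    rw [nonempty_iff_ne_empty]
    exact fun h => hne (symmDiff_eq_bot.1 h)
  obtain ⟨u, hu, hmax⟩ := exists_max_image (symmDiff X C) (fun i => |φ i|) hD
  have hpair : ∀ v, v ≠ u → ∑ i ∈ {u, v}, φ i = φ u + φ v := fun v hv => sum_pair hv.symm
  rcases le_total 0 (φ u) with hpos | hneg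
  · obtain ⟨v, hv, hF⟩ := hE X C hφ.1 hC.1 u hu
    refine ⟨u, hu, v, hv, Or.inl ⟨hF, le_antisymm (hφ.2 _ hF) ?_⟩⟩
    rw [symmDiff_symmDiff_cancel_left]
    rcases eq_or_ne v u with rfl | hvu
    · simpa using hpos
    · rw [hpair v hvu]
      have := hmax v hv
      rw [abs_of_nonneg hpos] at this
      linarith [neg_abs_le (φ v)]
  · obtain ⟨v, hv, hF⟩ := hE C X hC.1 hφ.1 u (by rwa [symmDiff_comm])
    rw [symmDiff_comm] at hv
    refine ⟨u, hu, v, hv, Or.inr ⟨hF, le_antisymm (hφ.2 _ hF) ?_⟩⟩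
    have hsub : {u, v} ⊆ symmDiff X C := by
      intro x; simp only [mem_insert, mem_singleton]; rintro (rfl | rfl) <;> assumption
    have e : symmDiff X (symmDiff C {u, v}) = symmDiff X C \ {u, v} := by
      rw [← symmDiff_assoc, symmDiff_of_ge hsub]
    have hsum := sum_sdiff (f := φ) hsub
    rw [e]
    rw [hC.2] at hsum
    rcases eq_or_ne v u with rfl | hvu
    · simp only [pair_eq_singleton, sum_singleton] at hsum ⊢
      linarith
    · rw [hpair v hvu] at hsum
      have := hmax v hv
      rw [abs_of_nonpos hneg] at this
      linarith [le_abs_self (φ v)]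

theorem eq_or_eq_of_vtx_mem_segment {A B Y : Finset (Fin n)}
    (h : vtx Y ∈ segment ℝ (vtx A) (vtx B)) : Y = A ∨ Y = B := by
  obtain ⟨s, t, hs, ht, hst, h⟩ := h
  have hk : ∀ k, s * (if k ∈ A then 1 else -1) + t * (if k ∈ B then 1 else -1) =
      if k ∈ Y then (1 : ℝ) else -1 := by
    intro k
    simpa [vtx_apply] using congrFun h k
  by_contra! hcon
  obtain ⟨h1, h2⟩ := hcon
  have a1 : ∃ k, ¬ (k ∈ Y ↔ k ∈ A) := by
    by_contra! h; exact h1 (Finset.ext h)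
  have a2 : ∃ k, ¬ (k ∈ Y ↔ k ∈ B) := by
    by_contra! h; exact h2 (Finset.ext h)
  obtain ⟨k, hk1⟩ := a1
  obtain ⟨m, hm1⟩ := a2
  have e1 := hk k
  have e2 := hk m
  split_ifs at e1 e2 <;> first | (exfalso; linarith) | tauto

section Edges
variable {ℬ : Finset (Finset (Label n))}

theorem IsLagrangianMatroid.isEdge_iff (h : IsLagrangianMatroid n ℬ) {A B : Finset (Fin n)} :
    IsEdge ℬ (enc A) (enc B) ↔ A ≠ B ∧ Feas ℬ B ∧
      ∃ φ, IsSupp (Feas ℬ) A φ ∧ faceSet (Feas ℬ) A φ = {A, B} := by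
  constructor
  · rintro ⟨hA, hB, hne, hexp⟩
    refine ⟨fun h => hne (by rw [h]), hB, ?_⟩
    obtain ⟨φ, hφ, hT⟩ := h.exists_supp hexp (X := A) hA (left_mem_segment ℝ _ _)
    refine ⟨φ, hφ, Set.Subset.antisymm (fun Y hY => ?_) ?_⟩
    · have := (h.vtx_mem_face_iff hφ hY.1).2 hY
      rw [← hT] at this
      exact eq_or_eq_of_vtx_mem_segment this
    · rintro Y (rfl | rfl)
      · exact self_mem_faceSet hA
      · rw [← h.vtx_mem_face_iff hφ hB, ← hT]
        exact right_mem_segment ℝ _ _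
  · rintro ⟨hne, hB, φ, hφ, hT⟩
    refine ⟨hφ.1, hB, fun h => hne (enc_injective h), ?_⟩
    have := h.isExposed_face hφ
    rwa [hT, Set.image_pair, convexHull_pair] at this

theorem subset_pair_cases {α : Type*} [DecidableEq α] {D : Finset α} {i j : α} (h : D ⊆ {i, j}) :
    D = ∅ ∨ D = {i} ∨ D = {j} ∨ D = {i, j} := by
  have h' : ∀ x ∈ D, x = i ∨ x = j := fun x hx => by simpa using h hx
  by_cases hi : i ∈ D <;> by_cases hj : j ∈ D
  · right; right; right; ext x; grind
  · right; left; ext x; grind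
  · right; right; left; ext x; grind
  · left; ext x; grind

/-- The edges of a Lagrangian matroid polytope are edges of the cube and those diagonals of its
squares which do not have both other corners in the polytope: by `SymmExchange.exists_mem_faceSet`
the ends of an edge differ in at most two indices. -/
theorem IsLagrangianMatroid.isEdge_iff_adj (h : IsLagrangianMatroid n ℬ) {A B : Finset (Fin n)} :
    IsEdge ℬ (enc A) (enc B) ↔
      Feas ℬ A ∧ Feas ℬ B ∧ (ShortAdj A B ∨ LongAdj (Feas ℬ) A B) := by
  rw [h.isEdge_iff]
  constructor
  · rintro ⟨hne, hB, φ, hφ, hT⟩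
    refine ⟨hφ.1, hB, ?_⟩
    have hBT : B ∈ faceSet (Feas ℬ) A φ := by rw [hT]; simp
    obtain ⟨u, hu, v, hv, huv⟩ := h.symmExchange.exists_mem_faceSet hφ hBT hne
    have hBuv : B = symmDiff A {u, v} := by
      have hnn : ∀ Z : Finset (Fin n), symmDiff Z {u, v} ≠ Z := by
        intro Z hZ
        have := symmDiff_eq_left.1 hZ
        simp at this
      rw [hT] at huv
      rcases huv with (h1 | h1) | (h1 | h1)
      · exact absurd h1 (hnn A)
      · exact h1.symm
      · rw [← h1, symmDiff_symmDiff_cancel_right]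
      · exact absurd h1 (hnn B)
    rcases eq_or_ne u v with rfl | huv'
    · exact Or.inl ⟨u, by rw [hBuv, pair_eq_singleton]⟩
    · refine Or.inr ⟨u, v, huv', hBuv, fun hboth => ?_⟩
      have e1 := hφ.2 _ hboth.1
      have e2 := hφ.2 _ hboth.2
      have e3 := hBT.2
      rw [hBuv] at e3
      simp only [symmDiff_symmDiff_cancel_left, sum_singleton, sum_pair huv'] at e1 e2 e3
      have : symmDiff A {u} ∈ faceSet (Feas ℬ) A φ :=
        ⟨hboth.1, by simp only [symmDiff_symmDiff_cancel_left, sum_singleton]; linarith⟩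
      rw [hT, hBuv] at this
      rcases this with h1 | h1
      · simpa using symmDiff_eq_left.1 h1
      · have := symmDiff_right_inj.1 h1
        have hv : v ∈ ({u} : Finset (Fin n)) := by rw [this]; simp
        exact huv' (mem_singleton.1 hv).symm
  · rintro ⟨hA, hB, ⟨i, rfl⟩ | ⟨i, j, hij, rfl, hn⟩⟩
    · refine ⟨fun h => by simpa using symmDiff_eq_left.1 h.symm, hB, ?_⟩
      obtain ⟨φ, hφ, hT⟩ := exists_isSupp_of_local hA {i} 0 (by simp)
      refine ⟨φ, hφ, ?_⟩
      ext Y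
      rw [hT]
      simp only [subset_singleton_iff, Pi.zero_apply, sum_const_zero, and_true,
        Set.mem_insert_iff, Set.mem_singleton_iff]
      constructor
      · rintro ⟨-, h1 | h1⟩
        · exact Or.inl (symmDiff_eq_bot.1 h1).symm
        · right; rw [← h1, symmDiff_symmDiff_cancel_left]
      · rintro (rfl | rfl)
        · exact ⟨hA, by simp⟩
        · exact ⟨hB, by simp⟩
    · refine ⟨fun h => by simpa using symmDiff_eq_left.1 h.symm, hB, ?_⟩
      wlog hj : ¬ Feas ℬ (symmDiff A {j}) generalizing i j
      · rw [pair_comm]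
        exact this j i hij.symm (by tauto) (by rwa [pair_comm]) (by tauto)
      -- The functional is negative at the only corner `A ∆ {i}` off the diagonal that may be
      -- feasible.
      obtain ⟨φ, hφ, hT⟩ := exists_isSupp_of_local hA {i, j} (fun k => if k = j then 1 else -1) (by
        intro D hD hF
        rcases subset_pair_cases hD with rfl | rfl | rfl | rfl
        · simp
        · simp [hij]
        · exact absurd hF hj
        · simp [sum_pair hij, hij])
      refine ⟨φ, hφ, ?_⟩
      ext Y
      rw [hT, Set.mem_insert_iff, Set.mem_singleton_iff]
      constructor
      · rintro ⟨-, h1, h2⟩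
        rcases subset_pair_cases h1 with h3 | h3 | h3 | h3
        · exact Or.inl (symmDiff_eq_bot.1 h3).symm
        · rw [h3] at h2; simp [hij] at h2
        · rw [h3] at h2; simp at h2
        · right; rw [← h3, symmDiff_symmDiff_cancel_left]
      · rintro (rfl | rfl)
        · exact ⟨hA, by simp⟩
        · exact ⟨hB, by simp, by simp [sum_pair hij, hij]⟩

theorem IsLagrangianMatroid.isShortEdge_iff (h : IsLagrangianMatroid n ℬ)
    {A B : Finset (Fin n)} :
    IsShortEdge ℬ (enc A) (enc B) ↔ Feas ℬ A ∧ Feas ℬ B ∧ ShortAdj A B := by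
  rw [IsShortEdge, h.isEdge_iff_adj]
  simp only [enc_symmDiff_starPair, enc_inj]
  constructor
  · rintro ⟨⟨hA, hB, -⟩, i, rfl⟩
    exact ⟨hA, hB, i, by rw [symmDiff_symmDiff_cancel_right]⟩
  · rintro ⟨hA, hB, i, rfl⟩
    exact ⟨⟨hA, hB, Or.inl ⟨i, rfl⟩⟩, i, by rw [symmDiff_symmDiff_cancel_right]⟩

theorem IsLagrangianMatroid.isLongEdge_iff (h : IsLagrangianMatroid n ℬ)
    {A B : Finset (Fin n)} :
    IsLongEdge ℬ (enc A) (enc B) ↔ Feas ℬ A ∧ Feas ℬ B ∧ LongAdj (Feas ℬ) A B := by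
  rw [IsLongEdge, h.isEdge_iff_adj]
  simp only [enc_symmDiff_starPair_union, enc_inj]
  constructor
  · rintro ⟨⟨hA, hB, ⟨k, rfl⟩ | hl⟩, i, j, hij, he⟩
    · have h1 : ({k} : Finset (Fin n)) = {i, j} := by
        rw [symmDiff_assoc] at he
        exact symmDiff_eq_bot.1 (symmDiff_eq_left.1 he.symm)
      have h2 := congrArg card h1
      rw [card_pair hij] at h2
      simp at h2
    · exact ⟨hA, hB, hl⟩
  · rintro ⟨hA, hB, hl⟩
    refine ⟨⟨hA, hB, Or.inr hl⟩, ?_⟩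
    obtain ⟨i, j, hij, rfl, -⟩ := hl
    exact ⟨i, j, hij, by rw [symmDiff_symmDiff_cancel_right]⟩

end Edges

/-! ### Balanced two-dimensional faces -/

section Form
variable (ω : (Fin n → ℝ) [⋀^Fin 2]→ₗ[ℝ] ℝ)

theorem form_self (x : Fin n → ℝ) : ω ![x, x] = 0 :=
  ω.map_eq_zero_of_eq _ (i := 0) (j := 1) rfl (by decide)

theorem form_swap (x y : Fin n → ℝ) : ω ![y, x] = - ω ![x, y] := by
  have h := ω.map_swap ![x, y] (i := 0) (j := 1) (by decide)
  rw [← h]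
  congr 1
  ext i : 1
  fin_cases i <;> simp

theorem form_add_left (x y z : Fin n → ℝ) : ω ![x + y, z] = ω ![x, z] + ω ![y, z] :=
  ω.map_vecCons_add _ _ _

theorem form_smul_left (c : ℝ) (x z : Fin n → ℝ) : ω ![c • x, z] = c * ω ![x, z] :=
  ω.map_vecCons_smul _ _ _

theorem form_add_right (x y z : Fin n → ℝ) : ω ![z, x + y] = ω ![z, x] + ω ![z, y] := by
  rw [form_swap ω _ z, form_add_left, form_swap ω z x, form_swap ω z y]
  ring

theorem form_smul_right (c : ℝ) (x z : Fin n → ℝ) : ω ![z, c • x] = c * ω ![z, x] := by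
  rw [form_swap ω _ z, form_smul_left, form_swap ω z x]
  ring

theorem form_combination (u v : Fin n → ℝ) (a b c d : ℝ) :
    ω ![a • u + b • v, c • u + d • v] = (a * d - b * c) * ω ![u, v] := by
  simp only [form_add_left, form_add_right, form_smul_left, form_smul_right, form_self]
  rw [form_swap ω u v]
  ring

/-- Reversing an edge exchanges the two sides of it. -/
theorem form_reverse (a b x : Fin n → ℝ) : ω ![a - b, x - b] = - ω ![b - a, x - a] := by
  have e1 : a - b = (-1 : ℝ) • (b - a) + (0 : ℝ) • (x - a) := by simp
  have e2 : x - b = (-1 : ℝ) • (b - a) + (1 : ℝ) • (x - a) := by simp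
  rw [e1, e2, form_combination]
  ring

theorem form_nonneg_on_convexHull (w a : Fin n → ℝ) (S : Set (Fin n → ℝ)) :
    (∀ x ∈ convexHull ℝ S, 0 ≤ ω ![w, x - a]) ↔ ∀ x ∈ S, 0 ≤ ω ![w, x - a] := by
  refine ⟨fun h x hx => h x (subset_convexHull ℝ S hx), fun h x hx => ?_⟩
  let l : (Fin n → ℝ) →ₗ[ℝ] ℝ :=
    { toFun := fun x => ω ![w, x]
      map_add' := fun x y => form_add_right ω x y w
      map_smul' := fun c x => form_smul_right ω c x w }
  have hl : ∀ x, ω ![w, x - a] = l x - l a := fun x => map_sub l x a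
  have hsub : convexHull ℝ S ⊆ {x | l a ≤ l x} :=
    convexHull_min (fun y hy => by have := h y hy; rw [hl] at this; exact sub_nonneg.1 this)
      (convex_halfSpace_ge l.isLinear _)
  rw [hl]
  exact sub_nonneg.2 (hsub hx)

end Form

/-- `dir` chooses one of the two directions of every short edge. -/
structure IsDirection (ℬ : Finset (Finset (Label n)))
    (dir : Finset (Label n) → Finset (Label n) → Prop) : Prop where
  short_of_dir : ∀ A B, dir A B → IsShortEdge ℬ A B
  dir_of_short : ∀ A B, IsShortEdge ℬ A B → Xor (dir A B) (dir B A)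

open Classical in
/-- The sign of the pair of bases encoded by `A` and `B`: it is `1` if there is a short edge
directed from the first to the second, and `-1` otherwise. -/
noncomputable def dirSign (dir : Finset (Label n) → Finset (Label n) → Prop)
    (A B : Finset (Fin n)) : ℤˣ :=
  if dir (enc A) (enc B) then 1 else -1

theorem dirSign_eq_one_iff {dir : Finset (Label n) → Finset (Label n) → Prop}
    {A B : Finset (Fin n)} : dirSign dir A B = 1 ↔ dir (enc A) (enc B) := by
  unfold dirSign
  split_ifs with h <;> simp [h]

section Balanced
variable {ℬ : Finset (Finset (Label n))} {dir : Finset (Label n) → Finset (Label n) → Prop}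

theorem dirSign_swap (h : IsLagrangianMatroid n ℬ) (hd : IsDirection ℬ dir)
    {A B : Finset (Fin n)} (hA : Feas ℬ A) (hB : Feas ℬ B) (hAB : ShortAdj A B) :
    dirSign dir B A = - dirSign dir A B := by
  have := hd.dir_of_short _ _ (h.isShortEdge_iff.2 ⟨hA, hB, hAB⟩)
  unfold dirSign
  rcases this with ⟨h1, h2⟩ | ⟨h1, h2⟩ <;> simp [h1, h2]

/-- A face is balanced if and only if the signs of its short edges, all of them traversed with the
face on their left, add up to zero. -/
theorem balanced_iff_sum (h : IsLagrangianMatroid n ℬ) (hd : IsDirection ℬ dir)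
    {X : Finset (Fin n)} {φ : Fin n → ℝ} (hφ : IsSupp (Feas ℬ) X φ)
    (ω : (Fin n → ℝ) [⋀^Fin 2]→ₗ[ℝ] ℝ) (E : Finset (Finset (Fin n) × Finset (Fin n)))
    (hE : ∀ A B, (A, B) ∈ E ↔ A ∈ faceSet (Feas ℬ) X φ ∧ B ∈ faceSet (Feas ℬ) X φ ∧
      ShortAdj A B ∧ ∀ Y ∈ faceSet (Feas ℬ) X φ, 0 ≤ ω ![vtx B - vtx A, vtx Y - vtx A]) :
    (anticlockwise dir ω (convexHull ℝ (vtx '' faceSet (Feas ℬ) X φ))).ncard =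
      (clockwise dir ω (convexHull ℝ (vtx '' faceSet (Feas ℬ) X φ))).ncard ↔
    ∑ e ∈ E, (dirSign dir e.1 e.2 : ℤ) = 0 := by
  classical
  set T := convexHull ℝ (vtx '' faceSet (Feas ℬ) X φ)
  have hE' : ∀ A B, (A, B) ∈ E ↔ (Feas ℬ A ∧ Feas ℬ B ∧ ShortAdj A B) ∧ vtx A ∈ T ∧ vtx B ∈ T ∧
      ∀ x ∈ T, 0 ≤ ω ![vtx B - vtx A, x - vtx A] := by
    intro A B
    rw [hE, form_nonneg_on_convexHull, Set.forall_mem_image]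
    constructor
    · rintro ⟨hA, hB, h1, h2⟩
      exact ⟨⟨hA.1, hB.1, h1⟩, (h.vtx_mem_face_iff hφ hA.1).2 hA,
        (h.vtx_mem_face_iff hφ hB.1).2 hB, h2⟩
    · rintro ⟨⟨hA, hB, h1⟩, hA', hB', h2⟩
      exact ⟨(h.vtx_mem_face_iff hφ hA).1 hA', (h.vtx_mem_face_iff hφ hB).1 hB', h1, h2⟩
  have hdir : ∀ A B, dir A B → ∃ a b, A = enc a ∧ B = enc b ∧
      Feas ℬ a ∧ Feas ℬ b ∧ ShortAdj a b := by
    intro A B hAB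
    have hs := hd.short_of_dir A B hAB
    obtain ⟨a, rfl⟩ := h.exists_enc hs.1.1
    obtain ⟨b, rfl⟩ := h.exists_enc hs.1.2.1
    exact ⟨a, b, rfl, rfl, h.isShortEdge_iff.1 hs⟩
  have h1 : anticlockwise dir ω T =
      ((E.filter fun e => dirSign dir e.1 e.2 = 1).image fun e => (enc e.1, enc e.2) :
        Finset (Finset (Label n) × Finset (Label n))) := by
    ext ⟨A, B⟩
    simp only [coe_image, coe_filter, Set.mem_image, Set.mem_ofPred_eq, Prod.exists,
      dirSign_eq_one_iff, Prod.mk.injEq, anticlockwise]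
    constructor
    · rintro ⟨hAB, hA, hB, hT⟩
      obtain ⟨a, b, rfl, rfl, hab⟩ := hdir A B hAB
      exact ⟨a, b, ⟨(hE' a b).2 ⟨hab, hA, hB, hT⟩, hAB⟩, rfl, rfl⟩
    · rintro ⟨a, b, ⟨hab, hd'⟩, rfl, rfl⟩
      exact ⟨hd', ((hE' a b).1 hab).2⟩
  have h2 : clockwise dir ω T =
      ((E.filter fun e => ¬ dirSign dir e.1 e.2 = 1).image fun e => (enc e.2, enc e.1) :
        Finset (Finset (Label n) × Finset (Label n))) := by
    ext ⟨A, B⟩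
    simp only [coe_image, coe_filter, Set.mem_image, Set.mem_ofPred_eq, Prod.exists,
      Prod.mk.injEq, clockwise]
    constructor
    · rintro ⟨hAB, hA, hB, hT⟩
      obtain ⟨a, b, rfl, rfl, hab⟩ := hdir A B hAB
      refine ⟨b, a, ⟨(hE' b a).2 ⟨⟨hab.2.1, hab.1, hab.2.2.symm⟩, hB, hA, fun x hx => ?_⟩, ?_⟩,
        rfl, rfl⟩
      · rw [form_reverse]
        exact neg_nonneg.2 (hT x hx)
      · rw [dirSign_swap h hd hab.1 hab.2.1 hab.2.2, dirSign_eq_one_iff.2 hAB]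
        decide
    · rintro ⟨a, b, ⟨hab, hd'⟩, rfl, rfl⟩
      obtain ⟨hs, hA, hB, hT⟩ := (hE' a b).1 hab
      refine ⟨?_, hB, hA, fun x hx => ?_⟩
      · refine dirSign_eq_one_iff.1 ?_
        rw [dirSign_swap h hd hs.1 hs.2.1 hs.2.2, (Int.units_eq_one_or _).resolve_left hd', neg_neg]
      · show ω ![vtx a - vtx b, x - vtx b] ≤ 0
        rw [form_reverse]
        exact neg_nonpos.2 (hT x hx)
  have h3 : ∑ e ∈ E, (dirSign dir e.1 e.2 : ℤ) =
      ((E.filter fun e => dirSign dir e.1 e.2 = 1).card : ℤ) -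
        (E.filter fun e => ¬ dirSign dir e.1 e.2 = 1).card := by
    rw [← sum_filter_add_sum_filter_not E fun e => dirSign dir e.1 e.2 = 1,
      sum_congr rfl (g := fun _ => (1 : ℤ)) fun e he => by rw [(mem_filter.1 he).2]; rfl,
      sum_congr (s₂ := E.filter fun e => ¬ dirSign dir e.1 e.2 = 1) rfl (g := fun _ => (-1 : ℤ))
        fun e he => by
          rw [(Int.units_eq_one_or _).resolve_left (mem_filter.1 he).2]; rfl]
    simp [sub_eq_add_neg]
  have i1 : Function.Injective fun e : Finset (Fin n) × Finset (Fin n) => (enc e.1, enc e.2) := by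
    rintro ⟨a, b⟩ ⟨c, d⟩ he
    simpa using he
  have i2 : Function.Injective fun e : Finset (Fin n) × Finset (Fin n) => (enc e.2, enc e.1) := by
    rintro ⟨a, b⟩ ⟨c, d⟩ he
    simpa [and_comm] using he
  rw [h1, h2, Set.ncard_coe_finset, Set.ncard_coe_finset, card_image_of_injective _ i1,
    card_image_of_injective _ i2, h3]
  omega

/-! The two-dimensional faces with short edges are spanned, from one of their vertices `X`, by a
short edge in direction `i` and by an edge in the directions `C`. -/

/-- The vertices `X`, `X ∆ {i}`, `X ∆ C` and `X ∆ ({i} ∪ C)` of a parallelogram. -/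
def corner (X : Finset (Fin n)) (i : Fin n) (C : Finset (Fin n)) (p : Bool × Bool) :
    Finset (Fin n) :=
  symmDiff X ((if p.1 then {i} else ∅) ∪ if p.2 then C else ∅)

/-- Three corners of a parallelogram. -/
def threeCorners : Finset (Bool × Bool) := {(false, false), (true, false), (false, true)}

/-- The pairs of corners in `S` which are joined by a short edge having all of `S` on its left;
`b` tells whether the second side of the parallelogram is short. -/
def leftPairs (S : Finset (Bool × Bool)) (b : Bool) :
    Finset ((Bool × Bool) × (Bool × Bool)) :=
  (S ×ˢ S).filter fun e =>
    ((e.1.1 ≠ e.2.1 ∧ e.1.2 = e.2.2) ∨ (b = true ∧ e.1.1 = e.2.1 ∧ e.1.2 ≠ e.2.2)) ∧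
    ∀ r ∈ S, 0 ≤ (e.2.1.toInt - e.1.1.toInt) * (r.2.toInt - e.1.2.toInt) -
      (e.2.2.toInt - e.1.2.toInt) * (r.1.toInt - e.1.1.toInt)

theorem leftPairs_threeCorners : leftPairs threeCorners true =
    {((false, false), (true, false)), ((false, true), (false, false))} := by decide

theorem leftPairs_univ_true : leftPairs univ true =
    {((false, false), (true, false)), ((true, false), (true, true)),
      ((true, true), (false, true)), ((false, true), (false, false))} := by decide

theorem leftPairs_univ_false : leftPairs univ false =
    {((false, false), (true, false)), ((true, true), (false, true))} := by decide

variable {X : Finset (Fin n)} {i : Fin n} {C : Finset (Fin n)}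

theorem corner_symmDiff_corner (hi : i ∉ C) (p q : Bool × Bool) :
    symmDiff (corner X i C p) (corner X i C q) =
      (if p.1 ≠ q.1 then {i} else ∅) ∪ if p.2 ≠ q.2 then C else ∅ := by
  obtain ⟨p1, p2⟩ := p
  obtain ⟨q1, q2⟩ := q
  ext x
  cases p1 <;> cases p2 <;> cases q1 <;> cases q2 <;>
    simp [corner, mem_symmDiff] <;> grind

theorem corner_injective (hi : i ∉ C) (hC : C.Nonempty) : Function.Injective (corner X i C) := by
  intro p q h
  have e := corner_symmDiff_corner (X := X) hi p q
  rw [h, symmDiff_self, bot_eq_empty, eq_comm, union_eq_empty] at e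
  ext1
  · by_contra hne
    simp [hne] at e
  · by_contra hne
    simp [hne, hC.ne_empty] at e

theorem shortAdj_iff_card {α : Type*} [DecidableEq α] {A B : Finset α} :
    ShortAdj A B ↔ (symmDiff A B).card = 1 := by
  rw [card_eq_one]
  constructor
  · rintro ⟨k, rfl⟩
    exact ⟨k, symmDiff_symmDiff_cancel_left _ _⟩
  · rintro ⟨k, hk⟩
    exact ⟨k, by rw [← hk, symmDiff_symmDiff_cancel_left]⟩

theorem shortAdj_corner_iff (hi : i ∉ C) (hC : C.Nonempty) (p q : Bool × Bool) :
    ShortAdj (corner X i C p) (corner X i C q) ↔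
      (p.1 ≠ q.1 ∧ p.2 = q.2) ∨ (decide (C.card = 1) = true ∧ p.1 = q.1 ∧ p.2 ≠ q.2) := by
  rw [shortAdj_iff_card, corner_symmDiff_corner hi]
  have hc : 0 < C.card := card_pos.2 hC
  by_cases h1 : p.1 = q.1 <;> by_cases h2 : p.2 = q.2 <;> simp [h1, h2]
  rw [card_insert_of_notMem hi]
  omega

theorem vtx_corner (hi : i ∉ C) (p : Bool × Bool) :
    vtx (corner X i C p) = vtx X + ((p.1.toInt : ℝ) • stepVec X i +
      (p.2.toInt : ℝ) • ∑ k ∈ C, stepVec X k) := by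
  rw [corner, vtx_symmDiff]
  congr 1
  rw [sum_union]
  · congr 1
    · cases p.1 <;> simp
    · cases p.2 <;> simp
  · split_ifs <;> simp [hi]

theorem form_corner (hi : i ∉ C) (ω : (Fin n → ℝ) [⋀^Fin 2]→ₗ[ℝ] ℝ) (p q r : Bool × Bool) :
    ω ![vtx (corner X i C q) - vtx (corner X i C p), vtx (corner X i C r) - vtx (corner X i C p)] =
      (((q.1.toInt - p.1.toInt) * (r.2.toInt - p.2.toInt) -
        (q.2.toInt - p.2.toInt) * (r.1.toInt - p.1.toInt) : ℤ) : ℝ) *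
        ω ![stepVec X i, ∑ k ∈ C, stepVec X k] := by
  have e : ∀ s : Bool × Bool, vtx (corner X i C s) - vtx (corner X i C p) =
      ((s.1.toInt : ℝ) - p.1.toInt) • stepVec X i +
      ((s.2.toInt : ℝ) - p.2.toInt) • ∑ k ∈ C, stepVec X k := by
    intro s
    rw [vtx_corner hi, vtx_corner hi, sub_smul, sub_smul]
    abel
  rw [e, e, form_combination]
  push_cast
  ring

theorem vectorSpan_face {Q : Set (Finset (Fin n))} (hX : X ∈ Q) :
    vectorSpan ℝ (convexHull ℝ (vtx '' Q)) =
      Submodule.span ℝ ((fun Y => vtx Y - vtx X) '' Q) := by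
  rw [← direction_affineSpan, affineSpan_convexHull, direction_affineSpan,
    vectorSpan_eq_span_vsub_set_right ℝ (Set.mem_image_of_mem vtx hX), Set.image_image]
  rfl

theorem vectorSpan_corners (hi : i ∉ C) {S : Finset (Bool × Bool)} (hS : threeCorners ⊆ S) :
    vectorSpan ℝ (convexHull ℝ (vtx '' (corner X i C '' S))) =
      Submodule.span ℝ {stepVec X i, ∑ k ∈ C, stepVec X k} := by
  have h00 : (false, false) ∈ S := hS (by decide)
  have h10 : (true, false) ∈ S := hS (by decide)
  have h01 : (false, true) ∈ S := hS (by decide)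
  have hX : X ∈ corner X i C '' (S : Set (Bool × Bool)) := ⟨_, h00, by simp [corner]⟩
  rw [vectorSpan_face hX]
  apply le_antisymm
  · rw [Submodule.span_le]
    rintro _ ⟨_, ⟨p, -, rfl⟩, rfl⟩
    simp only [vtx_corner hi, add_sub_cancel_left]
    exact Submodule.mem_span_pair.2 ⟨_, _, rfl⟩
  · rw [Submodule.span_le]
    rintro _ (rfl | rfl)
    · exact Submodule.subset_span ⟨_, ⟨_, h10, rfl⟩, by simp [vtx_corner hi]⟩
    · exact Submodule.subset_span ⟨_, ⟨_, h01, rfl⟩, by simp [vtx_corner hi]⟩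

theorem finrank_corners (hi : i ∉ C) (hC : C.Nonempty) {S : Finset (Bool × Bool)}
    (hS : threeCorners ⊆ S) :
    Module.finrank ℝ (vectorSpan ℝ (convexHull ℝ (vtx '' (corner X i C '' S)))) = 2 := by
  have hli : LinearIndependent ℝ ![stepVec X i, ∑ k ∈ C, stepVec X k] := by
    rw [LinearIndependent.pair_iff]
    intro s t h
    obtain ⟨c, hc⟩ := hC
    have hne : c ≠ i := fun h => hi (h ▸ hc)
    have e1 := congrFun h i
    have e2 := congrFun h c
    rw [Pi.add_apply, Pi.smul_apply, Pi.smul_apply, sum_stepVec_apply] at e1 e2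
    simp only [hi, hc, if_true, if_false, smul_eq_mul, mul_zero, add_zero, Pi.zero_apply,
      mul_eq_zero, stepVec_self_ne_zero, or_false] at e1 e2
    subst e1
    simp only [zero_mul, zero_add, mul_eq_zero, stepVec_self_ne_zero, or_false] at e2
    exact ⟨rfl, e2⟩
  have := finrank_span_eq_card hli
  rw [vectorSpan_corners hi hS]
  rwa [Matrix.range_cons, Matrix.range_cons, Matrix.range_empty, Set.union_empty,
    Set.singleton_union, Fintype.card_fin] at this

theorem orients_corners_iff (hi : i ∉ C) {S : Finset (Bool × Bool)} (hS : threeCorners ⊆ S)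
    (ω : (Fin n → ℝ) [⋀^Fin 2]→ₗ[ℝ] ℝ) :
    Orients ω (convexHull ℝ (vtx '' (corner X i C '' S))) ↔
      ω ![stepVec X i, ∑ k ∈ C, stepVec X k] ≠ 0 := by
  rw [Orients, vectorSpan_corners hi hS]
  constructor
  · rintro ⟨u, hu, v, hv, huv⟩ h0
    obtain ⟨a, b, rfl⟩ := Submodule.mem_span_pair.1 hu
    obtain ⟨c, d, rfl⟩ := Submodule.mem_span_pair.1 hv
    rw [form_combination, h0, mul_zero] at huv
    exact huv rfl
  · intro h
    exact ⟨_, Submodule.subset_span (by simp), _, Submodule.subset_span (by simp), h⟩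

theorem exists_orients_corners (hi : i ∉ C) (hC : C.Nonempty) {S : Finset (Bool × Bool)}
    (hS : threeCorners ⊆ S) :
    ∃ ω, Orients ω (convexHull ℝ (vtx '' (corner X i C '' S))) := by
  obtain ⟨c, hc⟩ := hC
  have hne : c ≠ i := fun h => hi (h ▸ hc)
  -- The determinant in the coordinates `i` and `c`.
  let f : (Fin n → ℝ) →ₗ[ℝ] (Fin 2 → ℝ) :=
    LinearMap.pi ![LinearMap.proj i, LinearMap.proj c]
  refine ⟨Matrix.detRowAlternating.compLinearMap f, (orients_corners_iff hi hS _).2 ?_⟩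
  have e : Matrix.detRowAlternating.compLinearMap f ![stepVec X i, ∑ k ∈ C, stepVec X k] =
      stepVec X i i * (∑ k ∈ C, stepVec X k) c - stepVec X i c * (∑ k ∈ C, stepVec X k) i := by
    rw [AlternatingMap.compLinearMap_apply]
    exact (Matrix.det_fin_two (Matrix.of fun j => f (![stepVec X i, ∑ k ∈ C, stepVec X k] j))).trans
      (by simp [f])
  rw [e, sum_stepVec_apply, sum_stepVec_apply, if_pos hc, if_neg hi, mul_zero, sub_zero]
  exact mul_ne_zero (stepVec_self_ne_zero X i) (stepVec_self_ne_zero X c)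

theorem balanced_corners_iff_of_pos (h : IsLagrangianMatroid n ℬ) (hd : IsDirection ℬ dir)
    {φ : Fin n → ℝ} (hφ : IsSupp (Feas ℬ) X φ) (hi : i ∉ C) (hC : C.Nonempty)
    {S : Finset (Bool × Bool)} (hQ : faceSet (Feas ℬ) X φ = corner X i C '' S)
    (ω : (Fin n → ℝ) [⋀^Fin 2]→ₗ[ℝ] ℝ) (hω : 0 < ω ![stepVec X i, ∑ k ∈ C, stepVec X k]) :
    (anticlockwise dir ω (convexHull ℝ (vtx '' (corner X i C '' S)))).ncard =
      (clockwise dir ω (convexHull ℝ (vtx '' (corner X i C '' S)))).ncard ↔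
    ∑ e ∈ leftPairs S (decide (C.card = 1)),
      (dirSign dir (corner X i C e.1) (corner X i C e.2) : ℤ) = 0 := by
  classical
  have hinj := corner_injective (X := X) hi hC
  rw [← hQ, balanced_iff_sum h hd hφ ω ((leftPairs S (decide (C.card = 1))).image
    (Prod.map (corner X i C) (corner X i C))), sum_image]
  · rfl
  · exact fun a _ b _ hab => (hinj.prodMap hinj) hab
  · intro A B
    have hform : ∀ p q r : Bool × Bool,
        0 ≤ ω ![vtx (corner X i C q) - vtx (corner X i C p),
          vtx (corner X i C r) - vtx (corner X i C p)] ↔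
        0 ≤ (q.1.toInt - p.1.toInt) * (r.2.toInt - p.2.toInt) -
          (q.2.toInt - p.2.toInt) * (r.1.toInt - p.1.toInt) := by
      intro p q r
      rw [form_corner hi, mul_nonneg_iff_of_pos_right hω, Int.cast_nonneg_iff]
    rw [hQ]
    simp only [mem_image, leftPairs, mem_filter, mem_product, Prod.exists, Set.forall_mem_image,
      Prod.map_apply]
    constructor
    · rintro ⟨p1, p2, q1, q2, ⟨⟨hp, hq⟩, hs, hr⟩, he⟩
      obtain ⟨rfl, rfl⟩ := Prod.mk.inj he
      exact ⟨⟨_, hp, rfl⟩, ⟨_, hq, rfl⟩, (shortAdj_corner_iff hi hC _ _).2 hs,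
        fun r hr' => (hform _ _ r).2 (hr r hr')⟩
    · rintro ⟨⟨p, hp, rfl⟩, ⟨q, hq, rfl⟩, hs, hr⟩
      exact ⟨p.1, p.2, q.1, q.2, ⟨⟨hp, hq⟩, (shortAdj_corner_iff hi hC _ _).1 hs,
        fun r hr' => (hform p q r).1 (hr hr')⟩, rfl⟩

theorem anticlockwise_neg (dir : Finset (Label n) → Finset (Label n) → Prop)
    (ω : (Fin n → ℝ) [⋀^Fin 2]→ₗ[ℝ] ℝ) (T : Set (Fin n → ℝ)) :
    anticlockwise dir (-ω) T = clockwise dir ω T := by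
  simp [anticlockwise, clockwise]

theorem clockwise_neg (dir : Finset (Label n) → Finset (Label n) → Prop)
    (ω : (Fin n → ℝ) [⋀^Fin 2]→ₗ[ℝ] ℝ) (T : Set (Fin n → ℝ)) :
    clockwise dir (-ω) T = anticlockwise dir ω T := by
  simp [anticlockwise, clockwise]

theorem balanced_corners_iff (h : IsLagrangianMatroid n ℬ) (hd : IsDirection ℬ dir)
    {φ : Fin n → ℝ} (hφ : IsSupp (Feas ℬ) X φ) (hi : i ∉ C) (hC : C.Nonempty)
    {S : Finset (Bool × Bool)} (hS : threeCorners ⊆ S)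
    (hQ : faceSet (Feas ℬ) X φ = corner X i C '' S)
    (ω : (Fin n → ℝ) [⋀^Fin 2]→ₗ[ℝ] ℝ)
    (hω : Orients ω (convexHull ℝ (vtx '' (corner X i C '' S)))) :
    (anticlockwise dir ω (convexHull ℝ (vtx '' (corner X i C '' S)))).ncard =
      (clockwise dir ω (convexHull ℝ (vtx '' (corner X i C '' S)))).ncard ↔
    ∑ e ∈ leftPairs S (decide (C.card = 1)),
      (dirSign dir (corner X i C e.1) (corner X i C e.2) : ℤ) = 0 := by
  rcases ((orients_corners_iff hi hS ω).1 hω).lt_or_gt with hlt | hgt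
  · rw [← balanced_corners_iff_of_pos h hd hφ hi hC hQ (-ω) (by simpa using hlt),
      anticlockwise_neg, clockwise_neg, eq_comm]
  · exact balanced_corners_iff_of_pos h hd hφ hi hC hQ ω hgt

/-- The balance condition for all choices of a sense of rotation on the plane of a face. -/
theorem forall_balanced_corners_iff (h : IsLagrangianMatroid n ℬ) (hd : IsDirection ℬ dir)
    {φ : Fin n → ℝ} (hφ : IsSupp (Feas ℬ) X φ) (hi : i ∉ C) (hC : C.Nonempty)
    {S : Finset (Bool × Bool)} (hS : threeCorners ⊆ S)
    (hQ : faceSet (Feas ℬ) X φ = corner X i C '' S) :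
    (∀ ω : (Fin n → ℝ) [⋀^Fin 2]→ₗ[ℝ] ℝ,
      Orients ω (convexHull ℝ (vtx '' (corner X i C '' S))) →
      (anticlockwise dir ω (convexHull ℝ (vtx '' (corner X i C '' S)))).ncard =
        (clockwise dir ω (convexHull ℝ (vtx '' (corner X i C '' S)))).ncard) ↔
    ∑ e ∈ leftPairs S (decide (C.card = 1)),
      (dirSign dir (corner X i C e.1) (corner X i C e.2) : ℤ) = 0 := by
  constructor
  · intro H
    obtain ⟨ω, hω⟩ := exists_orients_corners (X := X) hi hC hS
    exact (balanced_corners_iff h hd hφ hi hC hS hQ ω hω).1 (H ω hω)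
  · exact fun H ω hω => (balanced_corners_iff h hd hφ hi hC hS hQ ω hω).2 H

theorem isTwoFace_corners (h : IsLagrangianMatroid n ℬ)
    {φ : Fin n → ℝ} (hφ : IsSupp (Feas ℬ) X φ) (hi : i ∉ C) (hC : C.Nonempty)
    {S : Finset (Bool × Bool)} (hS : threeCorners ⊆ S)
    (hQ : faceSet (Feas ℬ) X φ = corner X i C '' S) :
    IsTwoFace ℬ (convexHull ℝ (vtx '' (corner X i C '' S))) := by
  refine ⟨?_, finrank_corners hi hC hS⟩
  rw [← hQ]
  exact h.isExposed_face hφ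

end Balanced

/-! ### Classification of the two-dimensional faces with short edges -/

section Classification
variable {ℬ : Finset (Finset (Label n))} {dir : Finset (Label n) → Finset (Label n) → Prop}
variable {X : Finset (Fin n)} {i : Fin n} {C : Finset (Fin n)}

theorem corner_false_false : corner X i C (false, false) = X := by simp [corner]

theorem corner_true_false : corner X i C (true, false) = symmDiff X {i} := by simp [corner]

theorem corner_false_true : corner X i C (false, true) = symmDiff X C := by simp [corner]

theorem corner_true_true : corner X i C (true, true) = symmDiff X (insert i C) := by
  rw [insert_eq]; rfl

theorem image_threeCorners : corner X i C '' (threeCorners : Set (Bool × Bool)) =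
    {X, symmDiff X {i}, symmDiff X C} := by
  simp [threeCorners, Set.image_insert_eq, corner_false_false, corner_true_false,
    corner_false_true]

theorem image_univ_corners : corner X i C '' ((univ : Finset (Bool × Bool)) : Set (Bool × Bool)) =
    {X, symmDiff X {i}, symmDiff X C, symmDiff X (insert i C)} := by
  have : (univ : Finset (Bool × Bool)) =
    {(false, false), (true, false), (false, true), (true, true)} := by decide
  simp [this, Set.image_insert_eq, corner_false_false, corner_true_false,
    corner_false_true, corner_true_true, -univ_product_univ]

theorem symmDiff_mem_corners {S : Finset (Bool × Bool)} {D : Finset (Fin n)}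
    (h : symmDiff X D ∈ corner X i C '' (S : Set (Bool × Bool))) :
    D = ∅ ∨ D = {i} ∨ D = C ∨ (D = insert i C ∧ (true, true) ∈ S) := by
  obtain ⟨⟨a, b⟩, hp, he⟩ := h
  have := symmDiff_right_inj.1 he
  cases a <;> cases b <;> simp at this
  · exact Or.inl this.symm
  · exact Or.inr (Or.inr (Or.inl this.symm))
  · exact Or.inr (Or.inl this.symm)
  · exact Or.inr (Or.inr (Or.inr ⟨this.symm, hp⟩))

theorem exists_supp_triangle {𝓕 : Finset (Fin n) → Prop} {j : Fin n} (hX : 𝓕 X)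
    (hi : 𝓕 (symmDiff X {i})) (hj : 𝓕 (symmDiff X {j})) (hij : ¬ 𝓕 (symmDiff X {i, j})) :
    ∃ φ, IsSupp 𝓕 X φ ∧ faceSet 𝓕 X φ = corner X i {j} '' (threeCorners : Set (Bool × Bool)) := by
  obtain ⟨φ, hφ, hT⟩ := exists_isSupp_of_local hX {i, j} 0 (by simp)
  refine ⟨φ, hφ, ?_⟩
  ext Y
  rw [hT, image_threeCorners]
  obtain ⟨D, rfl⟩ : ∃ D, Y = symmDiff X D := ⟨symmDiff X Y, by rw [symmDiff_symmDiff_cancel_left]⟩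
  simp only [symmDiff_symmDiff_cancel_left, Pi.zero_apply, sum_const_zero, and_true,
    Set.mem_insert_iff, Set.mem_singleton_iff, symmDiff_right_inj, symmDiff_eq_left]
  constructor
  · rintro ⟨hF, hD⟩
    rcases subset_pair_cases hD with rfl | rfl | rfl | rfl
    · simp
    · simp
    · simp
    · exact absurd hF hij
  · rintro (rfl | rfl | rfl)
    · exact ⟨by simpa [← bot_eq_empty] using hX, by simp⟩
    · exact ⟨hi, by simp⟩
    · exact ⟨hj, by simp⟩

theorem exists_supp_square {𝓕 : Finset (Fin n) → Prop} {j : Fin n} (hX : 𝓕 X)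
    (hi : 𝓕 (symmDiff X {i})) (hj : 𝓕 (symmDiff X {j})) (hij : 𝓕 (symmDiff X {i, j})) :
    ∃ φ, IsSupp 𝓕 X φ ∧ faceSet 𝓕 X φ =
      corner X i {j} '' ((univ : Finset (Bool × Bool)) : Set (Bool × Bool)) := by
  obtain ⟨φ, hφ, hT⟩ := exists_isSupp_of_local hX {i, j} 0 (by simp)
  refine ⟨φ, hφ, ?_⟩
  ext Y
  rw [hT, image_univ_corners]
  obtain ⟨D, rfl⟩ : ∃ D, Y = symmDiff X D := ⟨symmDiff X Y, by rw [symmDiff_symmDiff_cancel_left]⟩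
  simp only [symmDiff_symmDiff_cancel_left, Pi.zero_apply, sum_const_zero, and_true,
    Set.mem_insert_iff, Set.mem_singleton_iff, symmDiff_right_inj, symmDiff_eq_left]
  constructor
  · rintro ⟨hF, hD⟩
    exact subset_pair_cases hD
  · rintro (rfl | rfl | rfl | rfl)
    · exact ⟨by simpa [← bot_eq_empty] using hX, by simp⟩
    · exact ⟨hi, by simp⟩
    · exact ⟨hj, by simp⟩
    · exact ⟨hij, by simp⟩

theorem subset_triple_cases {α : Type*} [DecidableEq α] {D : Finset α} {i j k : α}
    (h : D ⊆ {i, j, k}) :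
    (D ⊆ {i, j}) ∨ D = {k} ∨ D = {i, k} ∨ D = {j, k} ∨ D = {i, j, k} := by
  have h' : ∀ x ∈ D, x = i ∨ x = j ∨ x = k := fun x hx => by simpa using h hx
  by_cases hk : k ∈ D
  · right
    by_cases hi : i ∈ D <;> by_cases hj : j ∈ D
    · right; right; right; ext x; grind
    · right; left; ext x; grind
    · right; right; left; ext x; grind
    · left; ext x; grind
  · left
    intro x hx
    grind

theorem exists_supp_rectangle {𝓕 : Finset (Fin n) → Prop} {j k : Fin n} (hij : i ≠ j)
    (hik : i ≠ k) (hjk : j ≠ k) (hX : 𝓕 X) (hi : 𝓕 (symmDiff X {i}))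
    (hF : 𝓕 (symmDiff X {j, k})) (hF3 : 𝓕 (symmDiff X {i, j, k}))
    (hk : ¬ 𝓕 (symmDiff X {k})) (hk2 : ¬ 𝓕 (symmDiff X {i, k})) :
    ∃ φ, IsSupp 𝓕 X φ ∧ faceSet 𝓕 X φ =
      corner X i {j, k} '' ((univ : Finset (Bool × Bool)) : Set (Bool × Bool)) := by
  -- The functional vanishes on the rectangle; the vertices at which it is positive are infeasible.
  obtain ⟨φ, hφ, hT⟩ := exists_isSupp_of_local hX {i, j, k}
    (fun x => if x = k then 1 else if x = j then -1 else 0) (by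
      intro D hD hFD
      rcases subset_triple_cases hD with hD' | rfl | rfl | rfl | rfl
      · rcases subset_pair_cases hD' with rfl | rfl | rfl | rfl
        · simp
        · simp [hij, hik]
        · simp [hjk]
        · simp [hij, hik, hjk, sum_pair hij]
      · exact absurd hFD hk
      · exact absurd hFD hk2
      · simp [hjk, sum_pair hjk]
      · rw [sum_insert (by simp [hij, hik]), sum_pair hjk]
        simp [hij, hik, hjk])
  refine ⟨φ, hφ, ?_⟩
  ext Y
  rw [hT, image_univ_corners]
  obtain ⟨D, rfl⟩ : ∃ D, Y = symmDiff X D := ⟨symmDiff X Y, by rw [symmDiff_symmDiff_cancel_left]⟩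
  simp only [symmDiff_symmDiff_cancel_left,
    Set.mem_insert_iff, Set.mem_singleton_iff, symmDiff_right_inj, symmDiff_eq_left]
  constructor
  · rintro ⟨hFD, hD, hs⟩
    rcases subset_triple_cases hD with hD' | rfl | rfl | rfl | rfl
    · rcases subset_pair_cases hD' with rfl | rfl | rfl | rfl
      · simp
      · simp
      · simp [hjk] at hs
      · simp [hij, hik, hjk, sum_pair hij] at hs
    · exact absurd hFD hk
    · exact absurd hFD hk2
    · simp
    · simp
  · rintro (rfl | rfl | rfl | rfl)
    · exact ⟨by simpa [← bot_eq_empty] using hX, by simp⟩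
    · exact ⟨hi, by simp, by simp [hij, hik]⟩
    · exact ⟨hF, by simp, by simp [sum_pair hjk, hjk]⟩
    · refine ⟨hF3, subset_rfl, ?_⟩
      rw [sum_insert (by simp [hij, hik]), sum_pair hjk]
      simp [hij, hik, hjk]

/-- A two-dimensional face with a short edge has at most four vertices: projected along the short
edge, its plane becomes a line, and a line contains at most two vertices of the cube. -/
theorem faceSet_eq_corners {𝓕 : Finset (Fin n) → Prop} {φ : Fin n → ℝ} (hφ : IsSupp 𝓕 X φ)
    (hrank : Module.finrank ℝ (vectorSpan ℝ (convexHull ℝ (vtx '' faceSet 𝓕 X φ))) = 2)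
    (hXi : symmDiff X {i} ∈ faceSet 𝓕 X φ) (hi : i ∉ C) (hC : C.Nonempty)
    (hXC : symmDiff X C ∈ faceSet 𝓕 X φ) :
    ∃ S : Finset (Bool × Bool), (S = threeCorners ∨ S = univ) ∧
      faceSet 𝓕 X φ = corner X i C '' S := by
  have hX : X ∈ faceSet 𝓕 X φ := self_mem_faceSet hφ.1
  have hsub3 : corner X i C '' (threeCorners : Set (Bool × Bool)) ⊆ faceSet 𝓕 X φ := by
    rw [image_threeCorners]
    rintro _ (rfl | rfl | rfl) <;> assumption
  have hspan : vectorSpan ℝ (convexHull ℝ (vtx '' faceSet 𝓕 X φ)) =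
      Submodule.span ℝ {stepVec X i, ∑ k ∈ C, stepVec X k} := by
    rw [← vectorSpan_corners hi (subset_refl threeCorners)]
    refine (Submodule.eq_of_le_of_finrank_eq
      (vectorSpan_mono ℝ (convexHull_mono (Set.image_mono hsub3))) ?_).symm
    rw [hrank, finrank_corners hi hC (subset_refl threeCorners)]
  have hsub : faceSet 𝓕 X φ ⊆
      corner X i C '' ((univ : Finset (Bool × Bool)) : Set (Bool × Bool)) := by
    intro Y hY
    have hmem : vtx Y - vtx X ∈ vectorSpan ℝ (convexHull ℝ (vtx '' faceSet 𝓕 X φ)) := by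
      rw [vectorSpan_face hX]
      exact Submodule.subset_span ⟨Y, hY, rfl⟩
    rw [hspan, vtx_eq X Y, add_sub_cancel_left] at hmem
    obtain ⟨a, b, hab⟩ := Submodule.mem_span_pair.1 hmem
    set D := symmDiff X Y
    have hk : ∀ k, a * stepVec X i k + b * (if k ∈ C then stepVec X k k else 0) =
        if k ∈ D then stepVec X k k else 0 := by
      intro k
      have := congrFun hab k
      rwa [Pi.add_apply, Pi.smul_apply, Pi.smul_apply, sum_stepVec_apply, sum_stepVec_apply] at this
    have hne : ∀ k, k ≠ i → stepVec X i k = 0 := fun k hk => by simp [stepVec, hk]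
    have hout : ∀ k ∈ D, k = i ∨ k ∈ C := by
      intro k hkD
      by_contra! hcon
      have := hk k
      rw [hne k hcon.1, if_neg hcon.2, if_pos hkD, mul_zero, mul_zero, add_zero] at this
      exact stepVec_self_ne_zero X k this.symm
    have hall : ∀ k ∈ C, k ∈ D → b = 1 := by
      intro k hkC hkD
      have := hk k
      rw [hne k (fun h => hi (h ▸ hkC)), if_pos hkC, if_pos hkD, mul_zero, zero_add] at this
      exact (mul_eq_right₀ (stepVec_self_ne_zero X k)).1 this
    have hall' : ∀ k ∈ C, k ∉ D → b = 0 := by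
      intro k hkC hkD
      have := hk k
      rw [hne k (fun h => hi (h ▸ hkC)), if_pos hkC, if_neg hkD, mul_zero, zero_add] at this
      exact (mul_eq_zero.1 this).resolve_right (stepVec_self_ne_zero X k)
    refine ⟨(decide (i ∈ D), decide (b = 1)), by simp, ?_⟩
    rw [corner, ← symmDiff_right_inj (a := X), symmDiff_symmDiff_cancel_left]
    ext x
    by_cases hiD : i ∈ D <;> by_cases hb : b = 1 <;> simp [hiD, hb] <;> grind
  by_cases h4 : symmDiff X (insert i C) ∈ faceSet 𝓕 X φ
  · refine ⟨univ, Or.inr rfl, Set.Subset.antisymm hsub ?_⟩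
    rw [image_univ_corners]
    rintro _ (rfl | rfl | rfl | rfl) <;> assumption
  · refine ⟨threeCorners, Or.inl rfl, Set.Subset.antisymm (fun Y hY => ?_) hsub3⟩
    have := hsub hY
    rw [image_univ_corners] at this
    rw [image_threeCorners]
    rcases this with h | h | h | h
    · exact Or.inl h
    · exact Or.inr (Or.inl h)
    · exact Or.inr (Or.inr h)
    · rw [Set.mem_singleton_iff.1 h] at hY
      exact absurd hY h4

/-- A two-dimensional face containing the short edge from `X` to `X ∆ {i}` consists of three or
four corners of a parallelogram. Its origin `X'` is the end of the edge which agrees at `i` with some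
third vertex of the face. -/
theorem exists_faceSet_eq_corners (h : IsLagrangianMatroid n ℬ) {T : Set (Fin n → ℝ)}
    (hT : IsTwoFace ℬ T) (hX : Feas ℬ X) (hXi : Feas ℬ (symmDiff X {i})) (hXT : vtx X ∈ T)
    (hXiT : vtx (symmDiff X {i}) ∈ T) :
    ∃ (X' C : Finset (Fin n)) (φ : Fin n → ℝ) (S : Finset (Bool × Bool)),
      i ∉ C ∧ C.Nonempty ∧ IsSupp (Feas ℬ) X' φ ∧ (S = threeCorners ∨ S = univ) ∧
      faceSet (Feas ℬ) X' φ = corner X' i C '' S ∧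
      T = convexHull ℝ (vtx '' faceSet (Feas ℬ) X' φ) := by
  have hother : ∃ Y, Feas ℬ Y ∧ vtx Y ∈ T ∧ Y ≠ X ∧ Y ≠ symmDiff X {i} := by
    by_contra! hcon
    obtain ⟨φ, hφ, rfl⟩ := h.exists_supp hT.1 hX hXT
    have hle : vectorSpan ℝ (convexHull ℝ (vtx '' faceSet (Feas ℬ) X φ)) ≤
        Submodule.span ℝ {stepVec X i} := by
      rw [vectorSpan_face (self_mem_faceSet hX), Submodule.span_le]
      rintro _ ⟨Y, hY, rfl⟩
      by_cases hYX : Y = X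
      · simp [hYX]
      · have := hcon Y hY.1 ((h.vtx_mem_face_iff hφ hY.1).2 hY) hYX
        simp only [this, vtx_symmDiff, sum_singleton, add_sub_cancel_left]
        exact Submodule.mem_span_singleton_self _
    have h1 := Submodule.finrank_mono hle
    have h2 := finrank_span_le_card (R := ℝ) {stepVec X i}
    rw [hT.2] at h1
    simp at h2
    omega
  obtain ⟨Y, hY, hYT, hYX, hYXi⟩ := hother
  wlog hi : i ∉ symmDiff X Y generalizing X
  · refine this (X := symmDiff X {i}) hXi ?_ hXiT ?_ hYXi ?_ ?_
    · rwa [symmDiff_symmDiff_cancel_right]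
    · rwa [symmDiff_symmDiff_cancel_right]
    · rwa [symmDiff_symmDiff_cancel_right]
    · grind [Finset.mem_symmDiff]
  obtain ⟨φ, hφ, hTφ⟩ := h.exists_supp hT.1 hX hXT
  have hC : (symmDiff X Y).Nonempty := by
    rw [nonempty_iff_ne_empty]
    exact fun he => hYX (symmDiff_eq_bot.1 he).symm
  have hrank := hT.2
  rw [hTφ] at hXiT hYT hrank
  obtain ⟨S, hS, hQ⟩ := faceSet_eq_corners hφ hrank ((h.vtx_mem_face_iff hφ hXi).1 hXiT) hi hC
    (by rw [symmDiff_symmDiff_cancel_left]; exact (h.vtx_mem_face_iff hφ hY).1 hYT)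
  exact ⟨X, _, φ, S, hi, hC, hφ, hS, hQ, hTφ⟩

/-- The second side of the parallelogram changes at most two coordinates, since otherwise exchanges
would lead to further vertices of the face. -/
theorem exists_pair_of_corners (hE : SymmExchange (Feas ℬ)) {φ : Fin n → ℝ}
    (hφ : IsSupp (Feas ℬ) X φ) (hi : i ∉ C) (hC : C.Nonempty) {S : Finset (Bool × Bool)}
    (hS : threeCorners ⊆ S) (hQ : faceSet (Feas ℬ) X φ = corner X i C '' S) :
    ∃ u v, C = {u, v} := by
  have hXC : symmDiff X C ∈ faceSet (Feas ℬ) X φ := by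
    rw [hQ]
    exact ⟨(false, true), hS (by decide), corner_false_true⟩
  obtain ⟨u, hu, v, hv, huv⟩ := hE.exists_mem_faceSet hφ hXC
    (fun he => hC.ne_empty (symmDiff_eq_left.1 he.symm))
  rw [symmDiff_symmDiff_cancel_left] at hu hv
  refine ⟨u, v, ?_⟩
  have hsub : {u, v} ⊆ C := by
    intro x hx
    grind
  have hne : ({u, v} : Finset (Fin n)) ≠ ∅ := by simp
  rw [hQ, symmDiff_assoc] at huv
  rcases huv with huv | huv
  · rcases symmDiff_mem_corners huv with h1 | h1 | h1 | ⟨h1, -⟩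
    · exact absurd h1 hne
    · rw [h1] at hsub; exact absurd (hsub (by simp)) hi
    · exact h1.symm
    · rw [h1] at hsub; exact absurd (hsub (by simp)) hi
  · rcases symmDiff_mem_corners huv with h1 | h1 | h1 | ⟨h1, -⟩
    · exact symmDiff_eq_bot.1 h1
    · have : i ∈ symmDiff C {u, v} := by rw [h1]; simp
      grind [Finset.mem_symmDiff]
    · exact absurd (symmDiff_eq_left.1 h1) hne
    · have : i ∈ symmDiff C {u, v} := by rw [h1]; simp
      grind [Finset.mem_symmDiff]

/-- A triangular face with one short leg has two short legs. Otherwise exchanges between the ends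
`X ∆ {i}` and `X ∆ {j, k}` of its third side give bases off the face, and the supporting
functional would have to be negative on both `j` and `k`, although its values there add up to `0`.
-/
theorem eq_singleton_of_threeCorners (hE : SymmExchange (Feas ℬ)) {φ : Fin n → ℝ}
    (hφ : IsSupp (Feas ℬ) X φ) (hi : i ∉ C) (hC : C.Nonempty)
    (hQ : faceSet (Feas ℬ) X φ = corner X i C '' (threeCorners : Set (Bool × Bool))) :
    ∃ j, C = {j} := by
  obtain ⟨j, k, rfl⟩ := exists_pair_of_corners hE hφ hi hC (subset_refl _) hQ
  rcases eq_or_ne j k with rfl | hjk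
  · exact ⟨j, by simp⟩
  exfalso
  have hXi : symmDiff X {i} ∈ faceSet (Feas ℬ) X φ := by
    rw [hQ, image_threeCorners]; simp
  have hXC : symmDiff X {j, k} ∈ faceSet (Feas ℬ) X φ := by
    rw [hQ, image_threeCorners]; simp
  have hφi : φ i = 0 := by
    have := hXi.2
    rwa [symmDiff_symmDiff_cancel_left, sum_singleton] at this
  have hφC := hXC.2
  rw [symmDiff_symmDiff_cancel_left, sum_pair hjk] at hφC
  have hnot : ∀ D : Finset (Fin n), D ≠ ∅ → D ≠ {i} → D ≠ {j, k} → Feas ℬ (symmDiff X D) →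
      ∑ x ∈ D, φ x < 0 := by
    intro D h0 h1 h2 hF
    have hle := hφ.2 _ hF
    rw [symmDiff_symmDiff_cancel_left] at hle
    refine lt_of_le_of_ne hle fun he => ?_
    have hm : symmDiff X D ∈ faceSet (Feas ℬ) X φ :=
      ⟨hF, by rwa [symmDiff_symmDiff_cancel_left]⟩
    rw [hQ] at hm
    rcases symmDiff_mem_corners hm with h3 | h3 | h3 | ⟨-, h3⟩
    · exact h0 h3
    · exact h1 h3
    · exact h2 h3
    · revert h3; decide
  have key : ∀ j k : Fin n, j ≠ k → i ∉ ({j, k} : Finset (Fin n)) →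
      Feas ℬ (symmDiff X {j, k}) → φ j + φ k = 0 →
      (∀ D : Finset (Fin n), D ≠ ∅ → D ≠ {i} → D ≠ {j, k} → Feas ℬ (symmDiff X D) →
        ∑ x ∈ D, φ x < 0) → φ j < 0 := by
    intro j k hjk hi hF hsum hneg
    have hij : i ≠ j := by rintro rfl; simp at hi
    have hik : i ≠ k := by rintro rfl; simp at hi
    obtain ⟨v, hv, hv2⟩ := hE _ _ hXi.1 hF j (by grind [Finset.mem_symmDiff])
    have hv3 : v = i ∨ v = j ∨ v = k := by grind [Finset.mem_symmDiff]
    rw [symmDiff_assoc] at hv2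
    rcases hv3 with rfl | rfl | rfl
    · have e : symmDiff {v} {j, v} = ({j} : Finset (Fin n)) := by
        ext x; grind [Finset.mem_symmDiff]
      rw [e] at hv2
      have := hneg _ (by simp) (by simpa using hij.symm) (by
        intro he; have : k ∈ ({j} : Finset (Fin n)) := by rw [he]; simp
        exact hjk (mem_singleton.1 this).symm) hv2
      simpa using this
    · have e : symmDiff {i} {v, v} = ({i, v} : Finset (Fin n)) := by
        ext x; grind [Finset.mem_symmDiff]
      rw [e] at hv2
      have := hneg _ (by simp) (by
        intro he; have : v ∈ ({i} : Finset (Fin n)) := by rw [← he]; simp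
        exact hij (mem_singleton.1 this).symm) (by
        intro he; exact hi (by rw [← he]; simp)) hv2
      rw [sum_pair hij, hφi, zero_add] at this
      exact this
    · have e : symmDiff {i} {j, v} = ({i, j, v} : Finset (Fin n)) := by
        ext x; grind [Finset.mem_symmDiff]
      rw [e] at hv2
      have := hneg _ (by simp) (by
        intro he; have : j ∈ ({i} : Finset (Fin n)) := by rw [← he]; simp
        exact hij (mem_singleton.1 this).symm) (by
        intro he; exact hi (by rw [← he]; simp)) hv2
      rw [sum_insert hi, sum_pair hjk, hsum, hφi] at this
      simp at this
  have h1 := key j k hjk hi hXC.1 hφC hnot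
  have h2 := key k j hjk.symm (by rwa [pair_comm]) (by rw [pair_comm]; exact hXC.1) (by linarith)
    (by rwa [pair_comm k j])
  linarith

/-- The balance conditions of the two-dimensional faces with short edges, for the signs `δ` of
the directed short edges. -/
structure IsSignBalanced (𝓕 : Finset (Fin n) → Prop)
    (δ : Finset (Fin n) → Finset (Fin n) → ℤˣ) : Prop where
  triangle : ∀ X i j, i ≠ j → 𝓕 X → 𝓕 (symmDiff X {i}) → 𝓕 (symmDiff X {j}) →
    ¬ 𝓕 (symmDiff X {i, j}) → δ X (symmDiff X {i}) = δ X (symmDiff X {j})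
  square : ∀ X i j, i ≠ j → 𝓕 X → 𝓕 (symmDiff X {i}) → 𝓕 (symmDiff X {j}) →
    𝓕 (symmDiff X {i, j}) → (δ X (symmDiff X {i}) + δ (symmDiff X {i}) (symmDiff X {i, j}) +
      (δ (symmDiff X {i, j}) (symmDiff X {j}) + δ (symmDiff X {j}) X) : ℤ) = 0
  rectangle : ∀ X i j k, i ≠ j → i ≠ k → j ≠ k → 𝓕 X → 𝓕 (symmDiff X {i}) →
    𝓕 (symmDiff X {j, k}) → 𝓕 (symmDiff X {i, j, k}) →
    ¬ 𝓕 (symmDiff X {k}) → ¬ 𝓕 (symmDiff X {i, k}) →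
    δ X (symmDiff X {i}) = δ (symmDiff X {j, k}) (symmDiff X {i, j, k})

theorem units_add_eq_zero_iff (a b : ℤˣ) : (a : ℤ) + b = 0 ↔ b = -a := by
  rcases Int.units_eq_one_or a with rfl | rfl <;> rcases Int.units_eq_one_or b with rfl | rfl <;>
    decide

theorem sum_leftPairs_triangle (h : IsLagrangianMatroid n ℬ) (hd : IsDirection ℬ dir) {j : Fin n}
    (hX : Feas ℬ X) (hXj : Feas ℬ (symmDiff X {j})) :
    ∑ e ∈ leftPairs threeCorners (decide (({j} : Finset (Fin n)).card = 1)),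
      (dirSign dir (corner X i {j} e.1) (corner X i {j} e.2) : ℤ) = 0 ↔
    dirSign dir X (symmDiff X {i}) = dirSign dir X (symmDiff X {j}) := by
  rw [card_singleton, decide_eq_true rfl, leftPairs_threeCorners, sum_pair (by decide),
    corner_false_false, corner_true_false, corner_false_true, units_add_eq_zero_iff,
    dirSign_swap h hd hX hXj ⟨j, rfl⟩, neg_inj, eq_comm]

theorem sum_leftPairs_square {j : Fin n} :
    ∑ e ∈ leftPairs univ (decide (({j} : Finset (Fin n)).card = 1)),
      (dirSign dir (corner X i {j} e.1) (corner X i {j} e.2) : ℤ) =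
    (dirSign dir X (symmDiff X {i}) + dirSign dir (symmDiff X {i}) (symmDiff X {i, j}) +
      (dirSign dir (symmDiff X {i, j}) (symmDiff X {j}) + dirSign dir (symmDiff X {j}) X) : ℤ) := by
  rw [card_singleton, decide_eq_true rfl, leftPairs_univ_true, sum_insert (by decide),
    sum_insert (by decide), sum_pair (by decide)]
  simp only [corner_false_false, corner_true_false, corner_false_true, corner_true_true]
  ring

theorem sum_leftPairs_rectangle (h : IsLagrangianMatroid n ℬ) (hd : IsDirection ℬ dir)
    {j k : Fin n} (hjk : j ≠ k) (hi : i ∉ ({j, k} : Finset (Fin n)))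
    (hF : Feas ℬ (symmDiff X {j, k})) (hF3 : Feas ℬ (symmDiff X {i, j, k})) :
    ∑ e ∈ leftPairs univ (decide (({j, k} : Finset (Fin n)).card = 1)),
      (dirSign dir (corner X i {j, k} e.1) (corner X i {j, k} e.2) : ℤ) = 0 ↔
    dirSign dir X (symmDiff X {i}) = dirSign dir (symmDiff X {j, k}) (symmDiff X {i, j, k}) := by
  have hs : ShortAdj (symmDiff X {j, k}) (symmDiff X {i, j, k}) :=
    ⟨i, by ext x; grind [Finset.mem_symmDiff]⟩
  rw [card_pair hjk, decide_eq_false (by norm_num), leftPairs_univ_false, sum_pair (by decide)]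
  simp only [corner_false_false, corner_true_false, corner_false_true, corner_true_true]
  rw [units_add_eq_zero_iff, dirSign_swap h hd hF hF3 hs, neg_inj, eq_comm]

/-- Every two-dimensional face has as many clockwise as anticlockwise short edges. -/
def IsBalanced (ℬ : Finset (Finset (Label n)))
    (dir : Finset (Label n) → Finset (Label n) → Prop) : Prop :=
  ∀ T, IsTwoFace ℬ T → ∀ ω : (Fin n → ℝ) [⋀^Fin 2]→ₗ[ℝ] ℝ, Orients ω T →
    (anticlockwise dir ω T).ncard = (clockwise dir ω T).ncard

theorem IsBalanced.isSignBalanced (h : IsLagrangianMatroid n ℬ) (hd : IsDirection ℬ dir)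
    (hb : IsBalanced ℬ dir) : IsSignBalanced (Feas ℬ) (dirSign dir) where
  triangle X i j hij hX hi hj hn := by
    obtain ⟨φ, hφ, hQ⟩ := exists_supp_triangle hX hi hj hn
    have hij' : i ∉ ({j} : Finset (Fin n)) := by simpa using hij
    exact (sum_leftPairs_triangle h hd hX hj).1 ((forall_balanced_corners_iff h hd hφ hij'
      (singleton_nonempty j) (subset_refl _) hQ).1 (hb _ (isTwoFace_corners h hφ hij'
      (singleton_nonempty j) (subset_refl _) hQ)))
  square X i j hij hX hi hj hF := by
    obtain ⟨φ, hφ, hQ⟩ := exists_supp_square hX hi hj hF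
    have hij' : i ∉ ({j} : Finset (Fin n)) := by simpa using hij
    rw [← sum_leftPairs_square]
    exact (forall_balanced_corners_iff h hd hφ hij'
      (singleton_nonempty j) (subset_univ _) hQ).1 (hb _ (isTwoFace_corners h hφ hij'
      (singleton_nonempty j) (subset_univ _) hQ))
  rectangle X i j k hij hik hjk hX hi hF hF3 hk hik' := by
    obtain ⟨φ, hφ, hQ⟩ := exists_supp_rectangle hij hik hjk hX hi hF hF3 hk hik'
    have hi' : i ∉ ({j, k} : Finset (Fin n)) := by simp [hij, hik]
    exact (sum_leftPairs_rectangle h hd hjk hi' hF hF3).1 ((forall_balanced_corners_iff h hd hφ hi'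
      (insert_nonempty _ _) (subset_univ _) hQ).1 (hb _ (isTwoFace_corners h hφ hi'
      (insert_nonempty _ _) (subset_univ _) hQ)))

/-- The triangles, squares and rectangles of `IsSignBalanced` are all the two-dimensional faces
with short edges. The other faces are balanced for want of directed edges. -/
theorem IsSignBalanced.isBalanced (h : IsLagrangianMatroid n ℬ) (hd : IsDirection ℬ dir)
    (hb : IsSignBalanced (Feas ℬ) (dirSign dir)) : IsBalanced ℬ dir := by
  intro T hT
  by_cases hex : ∃ A B, dir A B ∧ point A ∈ T ∧ point B ∈ T
  · obtain ⟨A, B, hAB, hAT, hBT⟩ := hex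
    have hs := hd.short_of_dir A B hAB
    obtain ⟨a, rfl⟩ := h.exists_enc hs.1.1
    obtain ⟨b, rfl⟩ := h.exists_enc hs.1.2.1
    obtain ⟨ha, hb', i, rfl⟩ := h.isShortEdge_iff.1 hs
    obtain ⟨X, C, φ, S, hi, hC, hφ, hS, hQ, rfl⟩ :=
      exists_faceSet_eq_corners h hT ha hb' hAT hBT
    have hS3 : threeCorners ⊆ S := by rcases hS with rfl | rfl <;> simp
    rw [hQ]
    refine (forall_balanced_corners_iff h hd hφ hi hC hS3 hQ).2 ?_
    have hmem : ∀ {p}, p ∈ S → corner X i C p ∈ faceSet (Feas ℬ) X φ := fun {p} hp => by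
      rw [hQ]; exact ⟨p, hp, rfl⟩
    have hXi : symmDiff X {i} ∈ faceSet (Feas ℬ) X φ :=
      corner_true_false (X := X) (i := i) (C := C) ▸ hmem (hS3 (by decide))
    have hXC : symmDiff X C ∈ faceSet (Feas ℬ) X φ :=
      corner_false_true (X := X) (i := i) (C := C) ▸ hmem (hS3 (by decide))
    have hφi := hXi.2
    have hφC := hXC.2
    rw [symmDiff_symmDiff_cancel_left, sum_singleton] at hφi
    rw [symmDiff_symmDiff_cancel_left] at hφC
    rcases hS with rfl | rfl
    · obtain ⟨j, rfl⟩ := eq_singleton_of_threeCorners h.symmExchange hφ hi hC hQ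
      have hij : i ≠ j := by simpa using hi
      refine (sum_leftPairs_triangle h hd hφ.1 hXC.1).2
        (hb.triangle X i j hij hφ.1 hXi.1 hXC.1 fun hF => ?_)
      have hm : symmDiff X {i, j} ∈ faceSet (Feas ℬ) X φ := by
        refine ⟨hF, ?_⟩
        rw [symmDiff_symmDiff_cancel_left, sum_pair hij, hφi]
        simpa using hφC
      rw [hQ] at hm
      rcases symmDiff_mem_corners hm with h1 | h1 | h1 | ⟨-, h1⟩
      · simp at h1
      · have : j ∈ ({i} : Finset (Fin n)) := by rw [← h1]; simp
        exact hij (mem_singleton.1 this).symm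
      · have : i ∈ ({j} : Finset (Fin n)) := by rw [← h1]; simp
        exact hi this
      · revert h1; decide
    · have hF3 : symmDiff X (insert i C) ∈ faceSet (Feas ℬ) X φ :=
        corner_true_true (X := X) (i := i) (C := C) ▸ hmem (mem_univ _)
      obtain ⟨j, k, rfl⟩ := exists_pair_of_corners h.symmExchange hφ hi hC hS3 hQ
      rcases eq_or_ne j k with rfl | hjk
      · simp only [pair_eq_singleton] at *
        have hij : i ≠ j := by simpa using hi
        rw [sum_leftPairs_square]
        exact hb.square X i j hij hφ.1 hXi.1 hXC.1 hF3.1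
      · -- As `φ j + φ k = 0`, one of them is nonnegative; if it is `φ k`, then neither `X ∆ {k}` nor
        -- `X ∆ {i, k}` is feasible, because neither lies on the face.
        wlog hle : 0 ≤ φ k generalizing j k
        · have e := pair_comm j k
          rw [e] at hi hC hQ hmem hXC hφC hF3 ⊢
          apply this k j
          all_goals first
            | assumption
            | exact hjk.symm
            | (rw [sum_pair hjk.symm] at hφC; linarith)
        have hij : i ≠ j := by rintro rfl; simp at hi
        have hik : i ≠ k := by rintro rfl; simp at hi
        rw [sum_leftPairs_rectangle h hd hjk hi hXC.1 hF3.1]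
        have hno : ∀ D : Finset (Fin n), D ≠ {i} → k ∈ D → j ∉ D → 0 ≤ ∑ x ∈ D, φ x →
            ¬ Feas ℬ (symmDiff X D) := by
          intro D h1 hkD hjD h0 hF
          have hle' := hφ.2 _ hF
          rw [symmDiff_symmDiff_cancel_left] at hle'
          have hm : symmDiff X D ∈ faceSet (Feas ℬ) X φ :=
            ⟨hF, by rw [symmDiff_symmDiff_cancel_left]; exact le_antisymm hle' h0⟩
          rw [hQ] at hm
          rcases symmDiff_mem_corners hm with h2 | h2 | h2 | ⟨h2, -⟩
          · rw [h2] at hkD; simp at hkD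
          · exact h1 h2
          · rw [h2] at hjD; simp at hjD
          · rw [h2] at hjD; simp at hjD
        refine hb.rectangle X i j k hij hik hjk hφ.1 hXi.1 hXC.1 hF3.1 ?_ ?_
        · exact hno {k} (by simpa using hik.symm) (by simp) (by simpa using hjk) (by simpa)
        · refine hno {i, k} (fun he => ?_) (by simp) (by simp [hij.symm, hjk]) ?_
          · have : k ∈ ({i} : Finset (Fin n)) := by rw [← he]; simp
            exact hik (mem_singleton.1 this).symm
          · rwa [sum_pair hik, hφi, zero_add]
  · intro ω _
    have h1 : anticlockwise dir ω T = ∅ := by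
      rw [Set.eq_empty_iff_forall_notMem]
      rintro ⟨A, B⟩ ⟨hAB, hA, hB, -⟩
      exact hex ⟨A, B, hAB, hA, hB⟩
    have h2 : clockwise dir ω T = ∅ := by
      rw [Set.eq_empty_iff_forall_notMem]
      rintro ⟨A, B⟩ ⟨hAB, hA, hB, -⟩
      exact hex ⟨A, B, hAB, hA, hB⟩
    rw [h1, h2]

end Classification

/-! ### Sign propagation -/

/-- A unit of `ℤ` as a sign. -/
def unitSign (u : ℤˣ) : SignType := if u = 1 then 1 else -1

theorem unitSign_mul (u v : ℤˣ) : unitSign (u * v) = unitSign u * unitSign v := by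
  revert u v; decide

theorem unitSign_neg (u : ℤˣ) : unitSign (-u) = - unitSign u := by
  revert u; decide

theorem unitSign_one : unitSign 1 = 1 := by decide

theorem unitSign_ne_zero (u : ℤˣ) : unitSign u ≠ 0 := by
  revert u; decide

theorem unitSign_injective : Function.Injective unitSign := by
  intro u v; revert u v; decide

theorem unitSign_mul_self (u : ℤˣ) : unitSign u * unitSign u = 1 := by
  revert u; decide

theorem unitSign_pow (k : ℕ) : unitSign ((-1) ^ k) = (-1) ^ k := by
  induction k with
  | zero => rfl
  | succ k ih => rw [pow_succ, unitSign_mul, ih, pow_succ]; rfl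

theorem neg_one_pow_card_symmDiff {α : Type*} [DecidableEq α] (X D : Finset α) :
    (-1 : ℤˣ) ^ (symmDiff X D).card = (-1) ^ X.card * (-1) ^ D.card := by
  have h1 := card_union_add_card_inter X D
  have h2 : X ∪ D = symmDiff X D ∪ (X ∩ D) := by ext k; simp [mem_symmDiff]; tauto
  have h3 : Disjoint (symmDiff X D) (X ∩ D) := by
    rw [disjoint_left]; intro k; simp [mem_symmDiff]; tauto
  rw [h2, card_union_of_disjoint h3] at h1
  rw [← pow_add, ← h1, add_assoc, ← two_mul, pow_add, pow_mul]
  simp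

/-- Twisted by the parity of the basis, balanced directions are flat signs. -/
theorem IsSignBalanced.isFlat {𝓕 : Finset (Fin n) → Prop}
    {δ : Finset (Fin n) → Finset (Fin n) → ℤˣ} (h : IsSignBalanced 𝓕 δ)
    (hs : ∀ X Y, 𝓕 X → 𝓕 Y → ShortAdj X Y → δ Y X = - δ X Y) :
    IsFlat 𝓕 fun X Y => (-1) ^ X.card * δ X Y where
  symm X Y hX hY hXY := by
    rw [hs X Y hX hY hXY]
    obtain ⟨i, rfl⟩ := hXY
    simp [neg_one_pow_card_symmDiff]
  triangle X i j hij hX hi hj hn := by rw [h.triangle X i j hij hX hi hj hn]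
  square X i j hij hX hi hj hF := by
    have e := h.square X i j hij hX hi hj hF
    simp only [neg_one_pow_card_symmDiff, card_pair hij, card_singleton]
    generalize δ X (symmDiff X {i}) = a, δ (symmDiff X {i}) (symmDiff X {i, j}) = b,
      δ (symmDiff X {i, j}) (symmDiff X {j}) = c, δ (symmDiff X {j}) X = d,
      (-1 : ℤˣ) ^ X.card = x at e ⊢
    revert a b c d x
    decide
  rectangle X i j k hij hik hjk hX hi hF hF3 hk hik' := by
    rw [h.rectangle X i j k hij hik hjk hX hi hF hF3 hk hik', neg_one_pow_card_symmDiff,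
      card_pair hjk]
    simp

/-- The index set encoding a basis. -/
def idx (A : Finset (Label n)) : Finset (Fin n) := univ.filter fun i => pos i ∈ A

theorem idx_enc (a : Finset (Fin n)) : idx (enc a) = a := by
  ext i; simp [idx]

/-- The function of two arguments obtained from a potential `σ`: relative to `G`, the basis `A` at
height `d` has the sign `σ(G) σ(A) (-1) ^ (|G| d + ⌊d / 2⌋)`. The last factor changes by
`(-1) ^ (|G| + d) = (-1) ^ |A|` from `A` to the next level, which undoes the twist in
`IsSignBalanced.isFlat`, and by `-1` from `A` to the level after it, as vertical edges require. -/
noncomputable def totalSign (ℬ : Finset (Finset (Label n))) (σ : Finset (Fin n) → ℤˣ)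
    (G A : Finset (Label n)) : SignType :=
  open Classical in
  if G ∈ ℬ ∧ A ∈ ℬ then
    unitSign (σ (idx G) * σ (idx A) * (-1) ^ ((idx G).card * (symmDiff (idx G) (idx A)).card +
      (symmDiff (idx G) (idx A)).card / 2))
  else 0

/-- The rules of sign propagation from `f`, in terms of index sets. The two ends of a short edge have
equal signs if and only if it is directed upwards, which is expressed by `dirSign` from its lower end
`a` to its upper end `b`. -/
structure IsPropagatedFrom (ℬ : Finset (Finset (Label n)))
    (dir : Finset (Label n) → Finset (Label n) → Prop) (f : Finset (Fin n))
    (t : Finset (Label n) → SignType) : Prop where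
  isSign : IsSignOn ℬ t
  base : t (enc f) = 1
  horizontal : ∀ a b, Feas ℬ a → Feas ℬ b → LongAdj (Feas ℬ) a b →
    (symmDiff f a).card = (symmDiff f b).card → t (enc a) = t (enc b)
  vertical : ∀ a b, Feas ℬ a → Feas ℬ b → LongAdj (Feas ℬ) a b →
    (symmDiff f a).card ≠ (symmDiff f b).card → t (enc a) = - t (enc b)
  short : ∀ a b, Feas ℬ a → Feas ℬ b → ShortAdj a b →
    (symmDiff f b).card = (symmDiff f a).card + 1 →
    t (enc b) = unitSign (dirSign dir a b) * t (enc a)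

theorem not_shortAdj_of_longAdj {α : Type*} [DecidableEq α] {𝓕 : Finset α → Prop} {X Y : Finset α}
    (h : LongAdj 𝓕 X Y) : ¬ ShortAdj X Y := by
  rw [shortAdj_iff_card]
  obtain ⟨i, j, hij, rfl, -⟩ := h
  rw [symmDiff_symmDiff_cancel_left, card_pair hij]
  norm_num

theorem card_symmDiff_of_shortAdj {f a b : Finset (Fin n)} (h : ShortAdj a b) :
    (symmDiff f b).card = (symmDiff f a).card + 1 ∨
      (symmDiff f a).card = (symmDiff f b).card + 1 := by
  obtain ⟨i, rfl⟩ := h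
  rcases card_symmDiff_symmDiff_singleton f a i with h | h
  · exact Or.inl h.1
  · exact Or.inr h.1

theorem OrientedPolytope.isDirection (P : OrientedPolytope n) : IsDirection P.bases P.dir :=
  ⟨P.short_of_dir, P.dir_of_short⟩

theorem OrientedPolytope.isSignBalanced (P : OrientedPolytope n) :
    IsSignBalanced (Feas P.bases) (dirSign P.dir) :=
  IsBalanced.isSignBalanced P.isLagrangian P.isDirection P.balanced

theorem OrientedPolytope.isPropagated_iff (P : OrientedPolytope n) {f : Finset (Fin n)}
    {t : Finset (Label n) → SignType} :
    P.IsPropagated (enc f) t ↔ IsPropagatedFrom P.bases P.dir f t := by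
  have hL := P.isLagrangian
  have hdir : ∀ {a b}, P.dir (enc a) (enc b) →
      Feas P.bases a ∧ Feas P.bases b ∧ ShortAdj a b := fun h =>
    hL.isShortEdge_iff.1 (P.short_of_dir _ _ h)
  have hshort : ∀ {a b}, Feas P.bases a → Feas P.bases b → ShortAdj a b →
      (symmDiff f b).card = (symmDiff f a).card + 1 →
      (P.IsInducing (enc f) (enc a) (enc b) ↔ P.dir (enc b) (enc a)) := by
    intro a b ha hb hab hd
    rw [IsInducing, IsVerticalLongEdge, hL.isLongEdge_iff, height_enc, height_enc]
    constructor
    · rintro (⟨⟨-, -, h1⟩, -⟩ | ⟨-, h1⟩ | ⟨h1, -⟩)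
      · exact absurd hab (not_shortAdj_of_longAdj h1)
      · omega
      · exact h1
    · exact fun h => Or.inr (Or.inr ⟨h, by omega⟩)
  have hsign : ∀ {a b}, Feas P.bases a → Feas P.bases b → ShortAdj a b →
      (P.dir (enc b) (enc a) → dirSign P.dir a b = -1) ∧
      (¬ P.dir (enc b) (enc a) → dirSign P.dir a b = 1) := by
    intro a b ha hb hab
    have e := dirSign_swap hL P.isDirection ha hb hab
    constructor
    · intro h
      rw [dirSign_eq_one_iff.2 h] at e
      rw [e, neg_neg]
    · intro h
      by_contra h1
      rw [(Int.units_eq_one_or _).resolve_left h1, neg_neg] at e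
      exact h (dirSign_eq_one_iff.1 e)
  have hlong : ∀ {a b}, Feas P.bases a → Feas P.bases b → LongAdj (Feas P.bases) a b →
      (P.IsInducing (enc f) (enc a) (enc b) ↔ (symmDiff f a).card ≠ (symmDiff f b).card) := by
    intro a b ha hb hab
    rw [IsInducing, IsVerticalLongEdge, hL.isLongEdge_iff, height_enc, height_enc]
    constructor
    · rintro (⟨-, h1⟩ | ⟨h1, -⟩ | ⟨h1, -⟩)
      · exact h1
      · exact absurd (hdir h1).2.2 (not_shortAdj_of_longAdj hab)
      · exact absurd (hdir h1).2.2.symm (not_shortAdj_of_longAdj hab)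
    · exact fun h => Or.inl ⟨⟨ha, hb, hab⟩, h⟩
  constructor
  · intro h
    refine ⟨h.isSign, h.base, fun a b ha hb hab hd => ?_, fun a b ha hb hab hd => ?_,
      fun a b ha hb hab hd => ?_⟩
    · exact h.nonInducing _ _ (hL.isEdge_iff_adj.2 ⟨ha, hb, Or.inr hab⟩)
        fun hi => (hlong ha hb hab).1 hi hd
    · exact h.inducing _ _ (hL.isEdge_iff_adj.2 ⟨ha, hb, Or.inr hab⟩) ((hlong ha hb hab).2 hd)
    · have he := hL.isEdge_iff_adj.2 ⟨ha, hb, Or.inl hab⟩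
      by_cases hba : P.dir (enc b) (enc a)
      · rw [(hsign ha hb hab).1 hba, h.inducing _ _ he ((hshort ha hb hab hd).2 hba),
          unitSign_neg, unitSign_one]
        simp
      · rw [(hsign ha hb hab).2 hba, h.nonInducing _ _ he (mt (hshort ha hb hab hd).1 hba),
          unitSign_one, one_mul]
  · intro h
    have hedge : ∀ a b, Feas P.bases a → Feas P.bases b → ShortAdj a b →
        (symmDiff f b).card = (symmDiff f a).card + 1 →
        (P.IsInducing (enc f) (enc a) (enc b) → t (enc a) = - t (enc b)) ∧
        (¬ P.IsInducing (enc f) (enc a) (enc b) → t (enc a) = t (enc b)) := by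
      intro a b ha hb hab hd
      rw [hshort ha hb hab hd, h.short a b ha hb hab hd]
      constructor
      · intro hba
        rw [(hsign ha hb hab).1 hba, unitSign_neg, unitSign_one]
        simp
      · intro hba
        rw [(hsign ha hb hab).2 hba, unitSign_one, one_mul]
    have hswap : ∀ A B, P.IsInducing (enc f) A B → P.IsInducing (enc f) B A := by
      rintro A B (⟨⟨h1, i, j, hij, h2⟩, h3⟩ | h1 | h1)
      · refine Or.inl ⟨⟨⟨h1.2.1, h1.1, h1.2.2.1.symm, ?_⟩, i, j, hij, ?_⟩, h3.symm⟩
        · rw [segment_symm]; exact h1.2.2.2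
        · rw [h2, symmDiff_symmDiff_cancel_right]
      · exact Or.inr (Or.inr h1)
      · exact Or.inr (Or.inl h1)
    have hall : ∀ A B, IsEdge P.bases A B →
        (P.IsInducing (enc f) A B → t A = - t B) ∧ (¬ P.IsInducing (enc f) A B → t A = t B) := by
      intro A B he
      obtain ⟨a, rfl⟩ := hL.exists_enc he.1
      obtain ⟨b, rfl⟩ := hL.exists_enc he.2.1
      obtain ⟨ha, hb, hab | hab⟩ := hL.isEdge_iff_adj.1 he
      · rcases card_symmDiff_of_shortAdj (f := f) hab with hd | hd
        · exact hedge a b ha hb hab hd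
        · obtain ⟨e1, e2⟩ := hedge b a hb ha hab.symm hd
          exact ⟨fun hi => by rw [e1 (hswap _ _ hi), neg_neg],
            fun hi => (e2 fun h' => hi (hswap _ _ h')).symm⟩
      · rw [hlong ha hb hab]
        exact ⟨h.vertical a b ha hb hab, fun hd => h.horizontal a b ha hb hab (not_not.1 hd)⟩
    exact ⟨h.isSign, h.base, fun A B he => (hall A B he).1, fun A B he => (hall A B he).2⟩

section Propagation
variable {ℬ : Finset (Finset (Label n))} {dir : Finset (Label n) → Finset (Label n) → Prop}
  {σ : Finset (Fin n) → ℤˣ} {f : Finset (Fin n)}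

theorem totalSign_enc {g a : Finset (Fin n)} (hg : Feas ℬ g) (ha : Feas ℬ a) :
    totalSign ℬ σ (enc g) (enc a) = unitSign (σ g * σ a *
      (-1) ^ (g.card * (symmDiff g a).card + (symmDiff g a).card / 2)) := by
  rw [totalSign, if_pos ⟨hg, ha⟩, idx_enc, idx_enc]

theorem totalSign_eq_zero {G A : Finset (Label n)} (h : G ∉ ℬ ∨ A ∉ ℬ) :
    totalSign ℬ σ G A = 0 := by
  rw [totalSign, if_neg (by tauto)]

/-- The rules determine all signs, since the basis graph is connected. -/
theorem IsPropagatedFrom.ext (h : IsLagrangianMatroid n ℬ)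
    {t u : Finset (Label n) → SignType} (hf : Feas ℬ f) (ht : IsPropagatedFrom ℬ dir f t)
    (hu : IsPropagatedFrom ℬ dir f u) : t = u := by
  funext A
  by_cases hA : A ∈ ℬ
  · obtain ⟨a, rfl⟩ := h.exists_enc hA
    refine h.symmExchange.connected (p := fun a => t (enc a) = u (enc a)) ?_ ?_ hf hA
      (by rw [ht.base, hu.base])
    · intro X Y hX hY hXY hp
      rcases card_symmDiff_of_shortAdj (f := f) hXY with hd | hd
      · rw [ht.short X Y hX hY hXY hd, hu.short X Y hX hY hXY hd, hp]
      · have e1 := ht.short Y X hY hX hXY.symm hd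
        have e2 := hu.short Y X hY hX hXY.symm hd
        have e3 := hp
        rw [e1, e2] at e3
        have := congrArg (unitSign (dirSign dir Y X) * ·) e3
        simpa only [← mul_assoc, unitSign_mul_self, one_mul] using this
    · intro X Y hX hY hXY hp
      by_cases hd : (symmDiff f X).card = (symmDiff f Y).card
      · rw [← ht.horizontal X Y hX hY hXY hd, ← hu.horizontal X Y hX hY hXY hd, hp]
      · have := hp
        rwa [ht.vertical X Y hX hY hXY hd, hu.vertical X Y hX hY hXY hd, neg_inj] at this
  · have h1 : t A = 0 := by
      by_contra hne; exact hA ((ht.isSign A).1 hne)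
    have h2 : u A = 0 := by
      by_contra hne; exact hA ((hu.isSign A).1 hne)
    rw [h1, h2]

theorem isPropagatedFrom_totalSign (h : IsLagrangianMatroid n ℬ)
    (hσ : IsPotentialOn (Feas ℬ) (fun X Y => (-1) ^ X.card * dirSign dir X Y) (Feas ℬ) σ)
    (hf : Feas ℬ f) : IsPropagatedFrom ℬ dir f (totalSign ℬ σ (enc f)) where
  isSign A := by
    constructor
    · intro hne
      by_contra hA
      exact hne (totalSign_eq_zero (Or.inr hA))
    · intro hA
      obtain ⟨a, rfl⟩ := h.exists_enc hA
      rw [totalSign_enc hf hA]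
      exact unitSign_ne_zero _
  base := by
    rw [totalSign_enc hf hf]
    simp [Int.units_mul_self, unitSign_one]
  horizontal a b ha hb hab hd := by
    rw [totalSign_enc hf ha, totalSign_enc hf hb, hd, hσ.long a b ha hb hab]
  vertical a b ha hb hab hd := by
    rw [totalSign_enc hf ha, totalSign_enc hf hb, hσ.long a b ha hb hab, ← unitSign_neg]
    congr 1
    have hd2 : (symmDiff f b).card = (symmDiff f a).card + 2 ∨
        (symmDiff f a).card = (symmDiff f b).card + 2 := by
      obtain ⟨i, j, hij, rfl, -⟩ := hab
      have e : symmDiff a {i, j} = symmDiff (symmDiff a {i}) {j} := by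
        ext x; grind [Finset.mem_symmDiff]
      rw [e] at hd ⊢
      have h1 := card_symmDiff_symmDiff_singleton f a i
      have h2 := card_symmDiff_symmDiff_singleton f (symmDiff a {i}) j
      omega
    rcases hd2 with hd2 | hd2
    · rw [hd2, mul_add, Nat.add_div_right _ (by norm_num), pow_add, pow_add, pow_add, pow_succ,
        pow_mul' (-1 : ℤˣ) f.card 2]
      simp
    · rw [hd2, mul_add, Nat.add_div_right _ (by norm_num), pow_add, pow_add, pow_add, pow_succ,
        pow_mul' (-1 : ℤˣ) f.card 2]
      simp [pow_add]
  short a b ha hb hab hd := by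
    rw [totalSign_enc hf ha, totalSign_enc hf hb, ← unitSign_mul]
    congr 1
    have hκ := hσ.short a b ha hb hab
    have hpar : (-1 : ℤˣ) ^ a.card = (-1) ^ f.card * (-1) ^ (symmDiff f a).card := by
      rw [← neg_one_pow_card_symmDiff, symmDiff_symmDiff_cancel_left]
    rw [hpar] at hκ
    rw [hd]
    set d := (symmDiff f a).card
    have h2 : (-1 : ℤˣ) ^ ((d + 1) / 2) = (-1) ^ d * (-1) ^ (d / 2) := by
      have hdd : d = (d + 1) / 2 + d / 2 := by omega
      conv_rhs => rw [hdd]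
      rw [pow_add, ← hdd, mul_assoc, Int.units_mul_self, mul_one]
    rw [mul_add, mul_one, pow_add, pow_add, pow_add, h2]
    generalize (-1 : ℤˣ) ^ (f.card * d) = p, (-1 : ℤˣ) ^ f.card = q, (-1 : ℤˣ) ^ d = r,
      (-1 : ℤˣ) ^ (d / 2) = s, σ a = x, σ b = y, σ f = z, dirSign dir a b = e at hκ ⊢
    have e1 : y = x * (q * r * e) := by rw [← hκ, ← mul_assoc, Int.units_mul_self, one_mul]
    have hq : q * q = 1 := Int.units_mul_self q
    have hr : r * r = 1 := Int.units_mul_self r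
    calc z * y * (p * q * (r * s)) = z * x * e * p * s * (q * q) * (r * r) := by
          rw [e1]; ac_rfl
      _ = e * (z * x * (p * s)) := by rw [hq, hr, mul_one, mul_one]; ac_rfl

/-- The exponents of `-1` in the signs of three bases relative to each other match up to the
Gromov product `N` of their heights. -/
theorem neg_one_pow_height (c x y z N : ℕ) (h : x + y = z + 2 * N) (e : ℤˣ)
    (he : e = (-1) ^ c * (-1) ^ x) :
    (-1 : ℤˣ) ^ (c * z + z / 2) * (-1) ^ (c * x + x / 2) * (-1) ^ N =
      e ^ y * (-1) ^ (y / 2) := by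
  have key : (c * z + z / 2 + (c * x + x / 2) + N) % 2 = ((c + x) * y + y / 2) % 2 := by
    have e1 : (z / 2 + x / 2 + N) % 2 = (x * y + y / 2) % 2 := by
      obtain ⟨a, r, hr, rfl⟩ : ∃ a r, r < 2 ∧ x = 2 * a + r := ⟨x / 2, x % 2, by omega, by omega⟩
      obtain ⟨b, s, hs, rfl⟩ : ∃ b s, s < 2 ∧ y = 2 * b + s := ⟨y / 2, y % 2, by omega, by omega⟩
      have hm : (2 * a + r) * (2 * b + s) = 2 * (a * (2 * b + s) + r * b) + r * s := by ring
      rw [hm]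
      interval_cases r <;> interval_cases s <;> omega
    have e2 : c * z + c * x + 2 * (c * N) = c * y + 2 * (c * x) := by
      have := congrArg (c * ·) h
      simp only [mul_add] at this
      have h3 : c * (2 * N) = 2 * (c * N) := by ring
      omega
    rw [add_mul]
    omega
  have hpow : ∀ u v : ℕ, u % 2 = v % 2 → (-1 : ℤˣ) ^ u = (-1) ^ v := by
    intro u v huv
    rw [← Nat.div_add_mod u 2, ← Nat.div_add_mod v 2, pow_add, pow_add, pow_mul, pow_mul, huv]
    simp
  rw [he, ← pow_add, ← pow_add, ← pow_add, ← pow_mul, ← pow_add]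
  exact hpow _ _ key

/-- The extension does not depend on the basis `F` it starts from, which is why the orientations
relative to different bases are equivalent. -/
theorem extend_totalSign (h : IsLagrangianMatroid n ℬ) (hf : Feas ℬ f) :
    extend (enc f) (totalSign ℬ σ (enc f)) = totalSign ℬ σ := by
  funext G A
  by_cases hGA : G ∈ ℬ ∧ A ∈ ℬ
  · obtain ⟨hG, hA⟩ := hGA
    obtain ⟨g, rfl⟩ := h.exists_enc hG
    obtain ⟨a, rfl⟩ := h.exists_enc hA
    rw [extend, totalSign_enc hf hA, totalSign_enc hf hG, totalSign_enc hG hA, ← unitSign_pow,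
      ← unitSign_mul, ← unitSign_mul, card_enc_sdiff]
    congr 1
    have hpar : (-1 : ℤˣ) ^ g.card = (-1) ^ f.card * (-1) ^ (symmDiff f g).card := by
      rw [← neg_one_pow_card_symmDiff, symmDiff_symmDiff_cancel_left]
    have key := neg_one_pow_height f.card _ _ _ _ (card_symmDiff_add f g a) _ hpar
    rw [pow_add (-1 : ℤˣ) (g.card * _), pow_mul, ← key]
    have hff : σ f * σ f = 1 := Int.units_mul_self _
    generalize (-1 : ℤˣ) ^ (f.card * (symmDiff f a).card + (symmDiff f a).card / 2) = p,
      (-1 : ℤˣ) ^ (f.card * (symmDiff f g).card + (symmDiff f g).card / 2) = q,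
      (-1 : ℤˣ) ^ (symmDiff g f ∩ symmDiff g a).card = r
    calc σ f * σ a * p * (σ f * σ g * q) * r = σ f * σ f * (σ g * σ a * (p * q * r)) := by ac_rfl
      _ = σ g * σ a * (p * q * r) := by rw [hff, one_mul]
  · have hz : totalSign ℬ σ G A = 0 := totalSign_eq_zero (by tauto)
    rw [hz, extend]
    by_cases hG : G ∈ ℬ
    · rw [totalSign_eq_zero (A := A) (Or.inr fun hA => hGA ⟨hG, hA⟩), zero_mul, zero_mul]
    · rw [totalSign_eq_zero (A := G) (Or.inr hG), mul_zero, zero_mul]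

/-- In a square with short edges, a basis whose sign differs from the three other signs is not at
the middle height. -/
theorem IsPropagatedFrom.square (h : IsLagrangianMatroid n ℬ) (hd : IsDirection ℬ dir)
    (hb : IsSignBalanced (Feas ℬ) (dirSign dir)) {t : Finset (Label n) → SignType}
    (ht : IsPropagatedFrom ℬ dir f t) {x : Finset (Fin n)} {i j : Fin n} (hij : i ≠ j)
    (hx : Feas ℬ x) (hi : Feas ℬ (symmDiff x {i})) (hj : Feas ℬ (symmDiff x {j}))
    (hF : Feas ℬ (symmDiff x {i, j})) {ε : SignType} (ti : t (enc (symmDiff x {i})) = ε)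
    (tj : t (enc (symmDiff x {j})) = ε) (tij : t (enc (symmDiff x {i, j})) = ε)
    (tx : t (enc x) = -ε) : i ∈ symmDiff f x ↔ j ∈ symmDiff f x := by
  by_contra hcon
  wlog hmem : i ∈ symmDiff f x ∧ j ∉ symmDiff f x generalizing i j
  · exact this hij.symm hj hi (by rwa [pair_comm]) tj ti (by rwa [pair_comm]) (by tauto) (by tauto)
  obtain ⟨mi, mj⟩ := hmem
  have e : symmDiff x {i, j} = symmDiff (symmDiff x {j}) {i} := by
    ext y; grind [Finset.mem_symmDiff]
  have hi1 := card_symmDiff_symmDiff_singleton f x i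
  have hj1 := card_symmDiff_symmDiff_singleton f x j
  have hij1 := card_symmDiff_symmDiff_singleton f (symmDiff x {j}) i
  have mi2 : i ∈ symmDiff f (symmDiff x {j}) := by grind [Finset.mem_symmDiff]
  rw [← e] at hij1
  simp only [mi, mj, mi2, not_true, and_false, and_true, false_or, not_false_eq_true,
    or_false] at hi1 hj1 hij1
  have a1 : ShortAdj x (symmDiff x {i}) := ⟨i, rfl⟩
  have a2 : ShortAdj x (symmDiff x {j}) := ⟨j, rfl⟩
  have a3 : ShortAdj (symmDiff x {j}) (symmDiff x {i, j}) := ⟨i, e⟩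
  have a4 : ShortAdj (symmDiff x {i}) (symmDiff x {i, j}) :=
    ⟨j, by ext y; grind [Finset.mem_symmDiff]⟩
  have b1 := ht.short _ _ hi hx a1.symm hi1
  have b2 := ht.short _ _ hx hj a2 hj1
  have b3 := ht.short _ _ hF hj a3.symm hij1
  have b4 := ht.short _ _ hi hF a4 (by omega)
  have hε : ε ≠ 0 := by
    rw [← ti]; exact (ht.isSign _).2 hi
  have key := hb.square x i j hij hx hi hj hF
  rw [dirSign_swap h hd hi hx a1.symm, dirSign_swap h hd hx hj a2] at key
  rw [ti, tx] at b1
  rw [tj, tx] at b2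
  rw [tij, tj] at b3
  rw [tij, ti] at b4
  generalize dirSign dir (symmDiff x {i}) x = p, dirSign dir x (symmDiff x {j}) = q,
    dirSign dir (symmDiff x {i, j}) (symmDiff x {j}) = r,
    dirSign dir (symmDiff x {i}) (symmDiff x {i, j}) = s at *
  clear * - b1 b2 b3 b4 key hε
  revert p q r s ε
  decide

theorem IsPropagatedFrom.isRelativeSign (h : IsLagrangianMatroid n ℬ) (hd : IsDirection ℬ dir)
    (hb : IsSignBalanced (Feas ℬ) (dirSign dir)) {t : Finset (Label n) → SignType}
    (ht : IsPropagatedFrom ℬ dir f t) : IsRelativeSign ℬ (enc f) t where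
  isSign := ht.isSign
  horizontal A B := by
    rintro ⟨hL, hh⟩
    obtain ⟨a, rfl⟩ := h.exists_enc hL.1.1
    obtain ⟨b, rfl⟩ := h.exists_enc hL.1.2.1
    obtain ⟨ha, hb, hab⟩ := h.isLongEdge_iff.1 hL
    rw [height_enc, height_enc] at hh
    exact ht.horizontal a b ha hb hab hh
  vertical A B := by
    rintro ⟨hL, hh⟩
    obtain ⟨a, rfl⟩ := h.exists_enc hL.1.1
    obtain ⟨b, rfl⟩ := h.exists_enc hL.1.2.1
    obtain ⟨ha, hb, hab⟩ := h.isLongEdge_iff.1 hL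
    rw [height_enc, height_enc] at hh
    exact ht.vertical a b ha hb hab hh
  base := ht.base
  square Q := by
    rintro ⟨hQ, ⟨A, i, j, hij, rfl⟩, -⟩ D hD ε hε hDε
    have hQ0 : ∀ X ∈ ({A, symmDiff A (starPair i), symmDiff A (starPair j),
        symmDiff A (starPair i ∪ starPair j)} : Finset (Finset (Label n))), X ∈ ℬ := fun X hX =>
      hQ hX
    obtain ⟨a, rfl⟩ := h.exists_enc (hQ0 A (by simp))
    obtain ⟨x, rfl⟩ := h.exists_enc (hQ0 D hD)
    rw [enc_symmDiff_starPair, enc_symmDiff_starPair, enc_symmDiff_starPair_union] at *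
    -- The square is described from its corner `x` instead of `a`.
    have hset : ({enc a, enc (symmDiff a {i}), enc (symmDiff a {j}), enc (symmDiff a {i, j})} :
        Finset (Finset (Label n))) = {enc x, enc (symmDiff x {i}), enc (symmDiff x {j}),
          enc (symmDiff x {i, j})} := by
      have hii : symmDiff {i} {i, j} = ({j} : Finset (Fin n)) := by
        ext y; grind [Finset.mem_symmDiff]
      have hjj : symmDiff {j} {i, j} = ({i} : Finset (Fin n)) := by
        ext y; grind [Finset.mem_symmDiff]
      have hi' : symmDiff {i, j} {i} = ({j} : Finset (Fin n)) := by
        ext y; grind [Finset.mem_symmDiff]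
      have hj' : symmDiff {i, j} {j} = ({i} : Finset (Fin n)) := by
        ext y; grind [Finset.mem_symmDiff]
      have h1 : symmDiff {i} {j} = ({i, j} : Finset (Fin n)) := by
        ext y; grind [Finset.mem_symmDiff]
      have h2 : symmDiff {j} {i} = ({i, j} : Finset (Fin n)) := by
        ext y; grind [Finset.mem_symmDiff]
      simp only [mem_insert, mem_singleton, enc_inj] at hD
      rcases hD with rfl | rfl | rfl | rfl
      · rfl
      · simp only [symmDiff_assoc, symmDiff_self, symmDiff_bot, hii, h1]
        ext y; simp only [mem_insert, mem_singleton]; tauto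
      · simp only [symmDiff_assoc, symmDiff_self, symmDiff_bot, hjj, h2]
        ext y; simp only [mem_insert, mem_singleton]; tauto
      · simp only [symmDiff_assoc, symmDiff_self, symmDiff_bot, hi', hj']
        ext y; simp only [mem_insert, mem_singleton]; tauto
    rw [hset] at hQ0 hε ⊢
    have hne : ∀ D : Finset (Fin n), D.Nonempty → enc (symmDiff x D) ≠ enc x := by
      intro D hD he
      exact hD.ne_empty (symmDiff_eq_left.1 (enc_injective he))
    have hiff := ht.square h hd hb hij (hQ0 (enc x) (by simp))
      (hQ0 (enc (symmDiff x {i})) (by simp))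
      (hQ0 (enc (symmDiff x {j})) (by simp)) (hQ0 (enc (symmDiff x {i, j})) (by simp))
      (hε _ (by simp) (hne _ (by simp))) (hε _ (by simp) (hne _ (by simp)))
      (hε _ (by simp) (hne _ (by simp))) hDε
    have e : symmDiff x {i, j} = symmDiff (symmDiff x {j}) {i} := by
      ext y; grind [Finset.mem_symmDiff]
    have hi1 := card_symmDiff_symmDiff_singleton f x i
    have hj1 := card_symmDiff_symmDiff_singleton f x j
    have hij1 := card_symmDiff_symmDiff_singleton f (symmDiff x {j}) i
    have mi2 : i ∈ symmDiff f (symmDiff x {j}) ↔ i ∈ symmDiff f x := by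
      grind [Finset.mem_symmDiff]
    rw [mi2, ← e] at hij1
    simp only [mem_insert, mem_singleton, forall_eq_or_imp, forall_eq, height_enc]
    by_cases hi : i ∈ symmDiff f x
    · left
      simp only [hi, hiff.1 hi, not_true, and_false, and_true, false_or] at hi1 hj1 hij1
      omega
    · right
      simp only [hi, mt hiff.2 hi, not_false_eq_true, and_false, and_true, or_false] at hi1 hj1 hij1
      omega

theorem isOrientation_totalSign (h : IsLagrangianMatroid n ℬ) (hd : IsDirection ℬ dir)
    (hb : IsSignBalanced (Feas ℬ) (dirSign dir))
    (hσ : IsPotentialOn (Feas ℬ) (fun X Y => (-1) ^ X.card * dirSign dir X Y) (Feas ℬ) σ) :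
    IsOrientation ℬ (totalSign ℬ σ) where
  zero_off G A hGA := totalSign_eq_zero hGA
  relative G hG := by
    obtain ⟨g, rfl⟩ := h.exists_enc hG
    exact (isPropagatedFrom_totalSign h hσ hG).isRelativeSign h hd hb
  exchange G hG H hH A hA := by
    obtain ⟨k, rfl⟩ := h.exists_enc hH
    conv_lhs => rw [← extend_totalSign (σ := σ) h hH]
    rfl

end Propagation

/-! ### Oriented polytopes and oriented matroids -/

section FromPolytope
variable (P : OrientedPolytope n)

theorem OrientedPolytope.exists_potential :
    ∃ σ, IsPotentialOn (Feas P.bases) (fun X Y => (-1) ^ X.card * dirSign P.dir X Y)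
      (Feas P.bases) σ :=
  (P.isSignBalanced.isFlat fun _ _ hX hY hXY =>
    dirSign_swap P.isLagrangian P.isDirection hX hY hXY).exists_potential
    P.isLagrangian.symmExchange (fun i => 2 ^ (i : ℕ)) (by
      -- Distinct sets of powers of two have distinct sums.
      intro X Y h
      have : X.map Fin.valEmbedding = Y.map Fin.valEmbedding := by
        refine Finset.geomSum_injective le_rfl ?_
        simpa using h
      exact map_injective _ this)

/-- A potential of the directed polytope. -/
noncomputable def OrientedPolytope.potential : Finset (Fin n) → ℤˣ :=
  P.exists_potential.choose

theorem OrientedPolytope.isPropagated_totalSign {F : Finset (Label n)} (hF : F ∈ P.bases) :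
    P.IsPropagated F (totalSign P.bases P.potential F) := by
  obtain ⟨f, rfl⟩ := P.isLagrangian.exists_enc hF
  exact P.isPropagated_iff.2
    (isPropagatedFrom_totalSign P.isLagrangian P.exists_potential.choose_spec hF)

theorem OrientedPolytope.IsPropagated.eq {P : OrientedPolytope n} {F : Finset (Label n)}
    (hF : F ∈ P.bases) {t u : Finset (Label n) → SignType} (ht : P.IsPropagated F t)
    (hu : P.IsPropagated F u) : t = u := by
  obtain ⟨f, rfl⟩ := P.isLagrangian.exists_enc hF
  exact (P.isPropagated_iff.1 ht).ext P.isLagrangian hF (P.isPropagated_iff.1 hu)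

theorem OrientedPolytope.IsPropagated.extend_eq {P : OrientedPolytope n} {F : Finset (Label n)}
    (hF : F ∈ P.bases) {t : Finset (Label n) → SignType} (ht : P.IsPropagated F t) :
    extend F t = totalSign P.bases P.potential := by
  rw [ht.eq hF (P.isPropagated_totalSign hF)]
  obtain ⟨f, rfl⟩ := P.isLagrangian.exists_enc hF
  exact extend_totalSign P.isLagrangian hF

theorem OrientedPolytope.isOrientation :
    IsOrientation P.bases (totalSign P.bases P.potential) :=
  isOrientation_totalSign P.isLagrangian P.isDirection P.isSignBalanced
    P.exists_potential.choose_spec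

/-- The oriented Lagrangian matroid induced from an oriented polytope. -/
noncomputable def OrientedPolytope.toOrientedMatroid : OrientedMatroid n where
  bases := P.bases
  isLagrangian := P.isLagrangian
  sgn := totalSign P.bases P.potential
  isOrientation := P.isOrientation

theorem OrientedPolytope.toOrientedMatroid_eq_iff (N : OrientedMatroid n) :
    P.toOrientedMatroid = N ↔ P.Induces N := by
  constructor
  · rintro rfl
    exact ⟨rfl, fun F hF => P.isPropagated_totalSign hF⟩
  · rintro ⟨hb, hN⟩
    refine OrientedMatroid.ext hb.symm ?_
    funext G A
    by_cases hG : G ∈ P.bases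
    · exact congrFun ((P.isPropagated_totalSign hG).eq hG (hN G hG)) A
    · rw [N.isOrientation.zero_off G A (Or.inl (hb ▸ hG))]
      exact totalSign_eq_zero (Or.inl hG)

end FromPolytope

section FromMatroid
variable {ℬ : Finset (Finset (Label n))} {s : Finset (Label n) → Finset (Label n) → SignType}

/-- The direction of the short edges of an oriented Lagrangian matroid: relative to the basis `B`,
an edge `AB` directed towards `B` is directed downwards, so `A` and `B` have opposite signs. -/
def inducedDir (ℬ : Finset (Finset (Label n)))
    (s : Finset (Label n) → Finset (Label n) → SignType) (A B : Finset (Label n)) : Prop :=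
  IsShortEdge ℬ A B ∧ s B A = -1

theorem sign_mul_self_of_ne_zero {x : SignType} (hx : x ≠ 0) : x * x = 1 := by
  revert x; decide

theorem IsOrientation.ne_zero (hs : IsOrientation ℬ s) {a b : Finset (Fin n)} (ha : Feas ℬ a)
    (hb : Feas ℬ b) : s (enc a) (enc b) ≠ 0 :=
  ((hs.relative _ ha).isSign _).2 hb

/-- The sign of a short edge seen from its upper end is determined by the signs of its two ends
relative to any basis `f`, so the direction read off from it is the same for all `f`. -/
theorem IsOrientation.sgn_short (hs : IsOrientation ℬ s) {f a b : Finset (Fin n)} (hf : Feas ℬ f)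
    (ha : Feas ℬ a) (hb : Feas ℬ b) (hab : ShortAdj a b)
    (hd : (symmDiff f b).card = (symmDiff f a).card + 1) :
    s (enc b) (enc a) = - (s (enc f) (enc a) * s (enc f) (enc b)) := by
  rw [hs.exchange _ hb _ hf _ ha, card_enc_sdiff]
  obtain ⟨i, rfl⟩ := hab
  have h1 := card_symmDiff_symmDiff_singleton f a i
  have hi : i ∉ symmDiff f a := by
    intro hi
    simp only [hi, not_true, and_false, and_true, false_or] at h1
    omega
  have h2 : symmDiff (symmDiff a {i}) f ∩ symmDiff (symmDiff a {i}) a = {i} := by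
    ext x; grind [Finset.mem_symmDiff]
  rw [h2, card_singleton, pow_one, mul_neg, mul_one]

theorem IsOrientation.sgn_swap (hs : IsOrientation ℬ s) {a b : Finset (Fin n)}
    (ha : Feas ℬ a) (hb : Feas ℬ b) (hab : ShortAdj a b) :
    s (enc b) (enc a) = - s (enc a) (enc b) := by
  rw [hs.sgn_short ha ha hb hab (by
    rw [symmDiff_self, shortAdj_iff_card.1 hab]; rfl), (hs.relative _ ha).base, one_mul]

theorem isDirection_inducedDir (h : IsLagrangianMatroid n ℬ) (hs : IsOrientation ℬ s) :
    IsDirection ℬ (inducedDir ℬ s) where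
  short_of_dir A B hAB := hAB.1
  dir_of_short A B hAB := by
    obtain ⟨a, rfl⟩ := h.exists_enc hAB.1.1
    obtain ⟨b, rfl⟩ := h.exists_enc hAB.1.2.1
    obtain ⟨ha, hb, hadj⟩ := h.isShortEdge_iff.1 hAB
    have hBA : IsShortEdge ℬ (enc b) (enc a) := h.isShortEdge_iff.2 ⟨hb, ha, hadj.symm⟩
    have e := hs.sgn_swap ha hb hadj
    have hne := hs.ne_zero ha hb
    simp only [inducedDir, hAB, hBA, true_and, e, Xor]
    generalize s (enc a) (enc b) = x at hne
    revert x
    decide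

theorem dirSign_inducedDir (h : IsLagrangianMatroid n ℬ) (hs : IsOrientation ℬ s)
    {f a b : Finset (Fin n)} (hf : Feas ℬ f)
    (ha : Feas ℬ a) (hb : Feas ℬ b) (hab : ShortAdj a b)
    (hd : (symmDiff f b).card = (symmDiff f a).card + 1) :
    s (enc f) (enc b) = unitSign (dirSign (inducedDir ℬ s) a b) * s (enc f) (enc a) := by
  have e := hs.sgn_short hf ha hb hab hd
  have h1 := hs.ne_zero hf ha
  have h2 := hs.ne_zero hf hb
  have hAB : IsShortEdge ℬ (enc a) (enc b) := h.isShortEdge_iff.2 ⟨ha, hb, hab⟩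
  have h3 : dirSign (inducedDir ℬ s) a b = 1 ↔ s (enc b) (enc a) = -1 := by
    rw [dirSign_eq_one_iff, inducedDir]
    exact ⟨fun h => h.2, fun h => ⟨hAB, h⟩⟩
  rw [e] at h3
  generalize s (enc f) (enc a) = x, s (enc f) (enc b) = y,
    dirSign (inducedDir ℬ s) a b = u at h1 h2 h3 ⊢
  revert x y u
  decide

theorem isPropagatedFrom_inducedDir (h : IsLagrangianMatroid n ℬ) (hs : IsOrientation ℬ s)
    {f : Finset (Fin n)} (hf : Feas ℬ f) :
    IsPropagatedFrom ℬ (inducedDir ℬ s) f (s (enc f)) where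
  isSign := (hs.relative _ hf).isSign
  base := (hs.relative _ hf).base
  horizontal a b ha hb hab hd := (hs.relative _ hf).horizontal _ _
    ⟨h.isLongEdge_iff.2 ⟨ha, hb, hab⟩, by rwa [height_enc, height_enc]⟩
  vertical a b ha hb hab hd := (hs.relative _ hf).vertical _ _
    ⟨h.isLongEdge_iff.2 ⟨ha, hb, hab⟩, by rwa [height_enc, height_enc]⟩
  short _ _ ha hb hab hd := dirSign_inducedDir h hs hf ha hb hab hd

theorem isShortSquare_enc (h : IsLagrangianMatroid n ℬ) {x : Finset (Fin n)} {i j : Fin n}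
    (hij : i ≠ j) (hx : Feas ℬ x) (hi : Feas ℬ (symmDiff x {i})) (hj : Feas ℬ (symmDiff x {j}))
    (hF : Feas ℬ (symmDiff x {i, j})) :
    IsShortSquare ℬ
      {enc x, enc (symmDiff x {i}), enc (symmDiff x {j}), enc (symmDiff x {i, j})} := by
  refine ⟨?_, ⟨enc x, i, j, hij, ?_⟩, ?_⟩
  · intro A hA
    simp only [mem_insert, mem_singleton] at hA
    rcases hA with rfl | rfl | rfl | rfl <;> assumption
  · rw [enc_symmDiff_starPair, enc_symmDiff_starPair, enc_symmDiff_starPair_union]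
  · obtain ⟨φ, hφ, hQ⟩ := exists_supp_square hx hi hj hF
    have := isTwoFace_corners h hφ (by simpa using hij) (singleton_nonempty j) (subset_univ _) hQ
    rw [image_univ_corners] at this
    simpa [polytope, Set.image_insert_eq, vtx] using this

/-- The signs relative to the vertex `x` of a triangle, square or rectangle decide how its short
edges are directed: horizontal edges make a triangle balanced, vertical edges a rectangle, and the
condition on squares a square. -/
theorem isSignBalanced_inducedDir (h : IsLagrangianMatroid n ℬ) (hs : IsOrientation ℬ s) :
    IsSignBalanced (Feas ℬ) (dirSign (inducedDir ℬ s)) where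
  triangle x i j hij hx hi hj hn := by
    have ht := isPropagatedFrom_inducedDir h hs hx
    have e := ht.horizontal _ _ hi hj ⟨i, j, hij,
      by ext y; grind [Finset.mem_symmDiff], fun hb => by
      have : symmDiff (symmDiff x {i}) {j} = symmDiff x {i, j} := by
        ext y; grind [Finset.mem_symmDiff]
      rw [this] at hb
      exact hn hb.2⟩ (by simp [symmDiff_symmDiff_cancel_left])
    rw [ht.short x _ hx hi ⟨i, rfl⟩ (by simp [symmDiff_symmDiff_cancel_left]),
      ht.short x _ hx hj ⟨j, rfl⟩ (by simp [symmDiff_symmDiff_cancel_left]), ht.base, mul_one,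
      mul_one] at e
    exact unitSign_injective e
  square x i j hij hx hi hj hF := by
    have ht := isPropagatedFrom_inducedDir h hs hx
    have hd := isDirection_inducedDir h hs
    have eij : symmDiff x {i, j} = symmDiff (symmDiff x {i}) {j} := by
      ext y; grind [Finset.mem_symmDiff]
    have eji : symmDiff x {i, j} = symmDiff (symmDiff x {j}) {i} := by
      ext y; grind [Finset.mem_symmDiff]
    have s1 := ht.short x _ hx hi ⟨i, rfl⟩ (by simp [symmDiff_symmDiff_cancel_left])
    have s2 := ht.short x _ hx hj ⟨j, rfl⟩ (by simp [symmDiff_symmDiff_cancel_left])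
    have s3 := ht.short _ _ hi hF ⟨j, eij⟩ (by simp [symmDiff_symmDiff_cancel_left, card_pair hij])
    have s4 := ht.short _ _ hj hF ⟨i, eji⟩ (by simp [symmDiff_symmDiff_cancel_left, card_pair hij])
    have hsq := (hs.relative _ hx).square _ (isShortSquare_enc h hij hx hi hj hF)
    have hheight : height (enc x) (enc x) = 0 ∧ height (enc x) (enc (symmDiff x {i})) = 1 ∧
        height (enc x) (enc (symmDiff x {j})) = 1 ∧
        height (enc x) (enc (symmDiff x {i, j})) = 2 := by
      simp [height_enc, symmDiff_symmDiff_cancel_left, card_pair hij]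
    simp only [mem_insert, mem_singleton, forall_eq_or_imp, forall_eq, hheight] at hsq
    obtain ⟨-, hsqi, hsqj, -⟩ := hsq
    -- Relative to the lowest corner `x`, neither corner at height one is an exception. The sign
    -- patterns that remain are those of balanced squares.
    have hi' : ∀ ε, s (enc x) (enc x) = ε → s (enc x) (enc (symmDiff x {j})) = ε →
        s (enc x) (enc (symmDiff x {i, j})) = ε → s (enc x) (enc (symmDiff x {i})) ≠ -ε :=
      fun ε h0 h1 h2 h3 => by
        have := hsqi ε ⟨fun _ => h0, fun hne => absurd rfl hne, fun _ => h1, fun _ => h2⟩ h3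
        omega
    have hj' : ∀ ε, s (enc x) (enc x) = ε → s (enc x) (enc (symmDiff x {i})) = ε →
        s (enc x) (enc (symmDiff x {i, j})) = ε → s (enc x) (enc (symmDiff x {j})) ≠ -ε :=
      fun ε h0 h1 h2 h3 => by
        have := hsqj ε ⟨fun _ => h0, fun _ => h1, fun hne => absurd rfl hne, fun _ => h2⟩ h3
        omega
    clear hsqi hsqj hheight
    rw [dirSign_swap h hd hx hj ⟨j, rfl⟩, dirSign_swap h hd hj hF ⟨i, eji⟩]
    rw [ht.base] at s1 s2 hi' hj'
    rw [s1] at s3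
    rw [s2, s3] at s4
    rw [s1, s2, s3] at hi' hj'
    clear s1 s2 s3 eij eji hd ht
    generalize dirSign (inducedDir ℬ s) x (symmDiff x {i}) = a at *
    generalize dirSign (inducedDir ℬ s) x (symmDiff x {j}) = b at *
    generalize dirSign (inducedDir ℬ s) (symmDiff x {i}) (symmDiff x {i, j}) = c at *
    generalize dirSign (inducedDir ℬ s) (symmDiff x {j}) (symmDiff x {i, j}) = d at *
    clear * - hi' hj' s4
    revert a b c d
    decide
  rectangle x i j k hij hik hjk hx hi hF hF3 hk hk2 := by
    have ht := isPropagatedFrom_inducedDir h hs hx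
    have e3 : symmDiff x {i, j, k} = symmDiff (symmDiff x {i}) {j, k} := by
      ext y; grind [Finset.mem_symmDiff]
    have e2 : symmDiff x {i, k} = symmDiff (symmDiff x {i}) {k} := by
      ext y; grind [Finset.mem_symmDiff]
    have c3 : ({i, j, k} : Finset (Fin n)).card = 3 := by
      rw [card_insert_of_notMem (by simp [hij, hik]), card_pair hjk]
    have v1 := ht.vertical x _ hx hF ⟨j, k, hjk, rfl, fun hb => hk hb.2⟩
      (by simp [symmDiff_symmDiff_cancel_left, card_pair hjk])
    have v2 := ht.vertical _ _ hi hF3 ⟨j, k, hjk, e3, fun hb => hk2 (e2 ▸ hb.2)⟩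
      (by simp [symmDiff_symmDiff_cancel_left, c3])
    have s1 := ht.short x _ hx hi ⟨i, rfl⟩ (by simp [symmDiff_symmDiff_cancel_left])
    have s2 := ht.short _ _ hF hF3 ⟨i, by ext y; grind [Finset.mem_symmDiff]⟩
      (by simp [symmDiff_symmDiff_cancel_left, c3, card_pair hjk])
    rw [s2, s1, v1, mul_neg, neg_inj] at v2
    have hne := hs.ne_zero hx hF
    have := congrArg (· * s (enc x) (enc (symmDiff x {j, k}))) v2
    simp only [mul_assoc, sign_mul_self_of_ne_zero hne, mul_one] at this
    exact unitSign_injective this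

/-- The oriented polytope which induces a given oriented Lagrangian matroid. -/
def OrientedMatroid.toOrientedPolytope (N : OrientedMatroid n) : OrientedPolytope n where
  bases := N.bases
  isLagrangian := N.isLagrangian
  dir := inducedDir N.bases N.sgn
  short_of_dir := (isDirection_inducedDir N.isLagrangian N.isOrientation).short_of_dir
  dir_of_short := (isDirection_inducedDir N.isLagrangian N.isOrientation).dir_of_short
  balanced := (isSignBalanced_inducedDir N.isLagrangian N.isOrientation).isBalanced
    N.isLagrangian (isDirection_inducedDir N.isLagrangian N.isOrientation)

theorem OrientedMatroid.toOrientedPolytope_induces (N : OrientedMatroid n) :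
    N.toOrientedPolytope.Induces N := by
  refine ⟨rfl, fun F hF => ?_⟩
  obtain ⟨f, rfl⟩ := N.isLagrangian.exists_enc hF
  exact N.toOrientedPolytope.isPropagated_iff.2
    (isPropagatedFrom_inducedDir N.isLagrangian N.isOrientation hF)

end FromMatroid

/-- Relative to one end of a short edge, the sign of the other end tells its direction. -/
theorem OrientedPolytope.Induces.dir_iff {P : OrientedPolytope n} {N : OrientedMatroid n}
    (h : P.Induces N) (A B : Finset (Label n)) :
    P.dir A B ↔ inducedDir N.bases N.sgn A B := by
  have key : IsShortEdge P.bases A B → (P.dir A B ↔ N.sgn B A = -1) := by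
    intro hs
    obtain ⟨a, rfl⟩ := P.isLagrangian.exists_enc hs.1.1
    obtain ⟨b, rfl⟩ := P.isLagrangian.exists_enc hs.1.2.1
    obtain ⟨ha, hb, hab⟩ := P.isLagrangian.isShortEdge_iff.1 hs
    have hp := P.isPropagated_iff.1 (h.2 _ hb)
    have e := hp.short b a hb ha hab.symm
      (by rw [symmDiff_self, shortAdj_iff_card.1 hab.symm]; rfl)
    rw [e, hp.base, mul_one, ← dirSign_eq_one_iff (dir := P.dir) (A := a) (B := b),
      dirSign_swap P.isLagrangian P.isDirection ha hb hab]
    generalize dirSign P.dir a b = u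
    revert u
    decide
  constructor
  · intro hd
    have hs := P.short_of_dir A B hd
    exact ⟨h.1 ▸ hs, (key hs).1 hd⟩
  · rintro ⟨hs, hd⟩
    exact (key (h.1 ▸ hs)).2 hd

theorem OrientedPolytope.toOrientedMatroid_bijective :
    Function.Bijective (OrientedPolytope.toOrientedMatroid (n := n)) := by
  constructor
  · intro P P' hPP
    have h1 := (P.toOrientedMatroid_eq_iff P'.toOrientedMatroid).1 hPP
    have h2 := (P'.toOrientedMatroid_eq_iff P'.toOrientedMatroid).1 rfl
    refine OrientedPolytope.ext (h1.1.symm.trans h2.1) ?_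
    funext A B
    exact propext ((h1.dir_iff A B).trans (h2.dir_iff A B).symm)
  · intro N
    exact ⟨N.toOrientedPolytope, (N.toOrientedPolytope.toOrientedMatroid_eq_iff N).2
      N.toOrientedPolytope_induces⟩

end LagrangianMatroid

theorem mainTheorem1 (n : ℕ) :
    (∀ P : LagrangianMatroid.OrientedPolytope n,
      (∀ F ∈ P.bases, ∃! t : Finset (LagrangianMatroid.Label n) → SignType,
        P.IsPropagated F t) ∧
      (∀ F ∈ P.bases, ∀ t : Finset (LagrangianMatroid.Label n) → SignType,
        P.IsPropagated F t →
          LagrangianMatroid.IsRelativeSign P.bases F t ∧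
          LagrangianMatroid.IsOrientation P.bases (LagrangianMatroid.extend F t)) ∧
      (∀ F ∈ P.bases, ∀ G ∈ P.bases,
        ∀ t u : Finset (LagrangianMatroid.Label n) → SignType,
          P.IsPropagated F t → P.IsPropagated G u →
            LagrangianMatroid.extend F t = LagrangianMatroid.extend G u)) ∧
    (∃ Φ : LagrangianMatroid.OrientedPolytope n → LagrangianMatroid.OrientedMatroid n,
      Function.Bijective Φ ∧ ∀ P N, Φ P = N ↔ P.Induces N) := by
  refine ⟨fun P => ⟨fun F hF => ?_, fun F hF t ht => ?_, fun F hF G hG t u ht hu => ?_⟩,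
    LagrangianMatroid.OrientedPolytope.toOrientedMatroid,
    LagrangianMatroid.OrientedPolytope.toOrientedMatroid_bijective,
    fun P N => P.toOrientedMatroid_eq_iff N⟩
  · exact ⟨_, P.isPropagated_totalSign hF, fun u hu => hu.eq hF (P.isPropagated_totalSign hF)⟩
  · refine ⟨?_, ?_⟩
    · rw [ht.eq hF (P.isPropagated_totalSign hF)]
      exact P.isOrientation.relative F hF
    · rw [ht.extend_eq hF]
      exact P.isOrientation
  · rw [ht.extend_eq hF, hu.extend_eq hG]
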